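/- **Setting.** Let $\mathbf T^2=\mathbf R^2/\mathbf Z^2$. Let $\rho\in\mathcal C^\infty(\mathbf R^2)$ be nonnegative and even with $\operatorname{supp}\rho\subset(-\tfrac12,\tfrac12)^2$ and $\int_{\mathbf R^2}\rho=1$. For $\varepsilon\in(0,1)$ put $\rho^\varepsilon(x)=\varepsilon^{-2}\rho(\varepsilon^{-1}x)$, regarded as a function on $\mathbf T^2$ by periodic extension. Let $W$ be a cylindrical Wiener process on $L^2(\mathbf T^2)$ with identity covariance operator, defined on a probability space with expectation $\mathbf E$, and let $W^\varepsilon=\rho^\varepsilon*W$, i.e. $W^\varepsilon(t,x)=W_t(\rho^\varepsilon(x-\cdot))$. For $\theta\ge 0$ let $\widetilde h^\varepsilon_\theta$ be a solution on $[0,\infty)\times\mathbf T^2$ of $$\partial_t\widetilde h^\varepsilon_\theta=\tfrac12\Delta\widetilde h^\varepsilon_\theta+\tfrac12|\log\varepsilon|^{-1/2}|\nabla\widetilde h^\varepsilon_\theta|^2+\sqrt\theta\,\dot W^\varepsilon,\qquad \widetilde h^\varepsilon_\theta(0,\cdot)=0,$$ meaning that $\widetilde h^\varepsilon_\theta$ is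 a random field which almost surely is twice continuously differentiable in $x$, with $\widetilde h^\varepsilon_\theta$ and its spatial derivatives up to order two continuous on $[0,\infty)\times\mathbf T^2$, and that for all $t\ge0$ and $x\in\mathbf T^2$, almost surely, $$\widetilde h^\varepsilon_\theta(t,x)=\int_0^t\Bigl(\tfrac12\Delta\widetilde h^\varepsilon_\theta+\tfrac12|\log\varepsilon|^{-1/2}|\nabla\widetilde h^\varepsilon_\theta|^2\Bigr)(s,x)\,\mathrm ds+\sqrt\theta\,W^\varepsilon(t,x).$$ **Lemma 6.4.** There is an absolute constant $\theta_0>0$ such that the following holds whenever $0\le\theta\le\theta_0$. For all $\varepsilon\in(0,1)$ and $t\ge0$, the random variable $\widetilde h^\varepsilon_\theta(t,x)$ is integrable for every $x\in\mathbf T^2$ and its expectation $$\kappa^\varepsilon_\theta(t)=\mathbf E\,\widetilde h^\varepsilon_\theta(t,x)$$ does not depend on $x$; and for each fixed $t\ge0$, as $\varepsilon\downarrow0$, $$\kappa^\varepsilon_\theta(t)=\frac12|\log\varepsilon|^{-1/2}\,\frac{\theta t}{\varepsilon^{2}}\,\|\rho\|^2_{L^2(\mathbf R^2)}+O\bigl(|\log\varepsilon|^{1/2}\bigr),$$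 where the implied constant may depend on $\rho$, $\theta$ and $t$. -/

import Mathlib

open MeasureTheory ProbabilityTheory
open scoped NNReal Laplacian Gradient Asymptotics

noncomputable section

namespace KPZ

/-- The plane `ℝ²` with its Euclidean structure. -/
abbrev Plane : Type := EuclideanSpace ℝ (Fin 2)

/-- The torus `𝕋² = ℝ² / ℤ²`. Its `volume` is the Lebesgue (Haar probability) measure. -/
abbrev Torus : Type := UnitAddTorus (Fin 2)

/-- The quotient map `ℝ² → 𝕋²`. -/
def toTorus (z : Plane) : Torus := fun i => (z i : UnitAddCircle)

/-- The representative of a point of the torus in the cell `(-1/2, 1/2]²`. -/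
def cellRep (y : Torus) : Plane :=
  WithLp.toLp 2 fun i => ((AddCircle.equivIoc (1 : ℝ) (-1 / 2) (y i) : Set.Ioc _ _) : ℝ)

/-- A mollifier: a smooth nonnegative even function on `ℝ²` with (closed) support in the open
square `(-1/2, 1/2)²` and integral one. -/
structure Mollifier where
  toFun : Plane → ℝ
  smooth : ContDiff ℝ ((⊤ : ℕ∞) : WithTop ℕ∞) toFun
  nonneg : ∀ x, 0 ≤ toFun x
  even : ∀ x, toFun (-x) = toFun x
  support_subset : tsupport toFun ⊆ {x | ∀ i, x i ∈ Set.Ioo (-(1 / 2) : ℝ) (1 / 2)}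
  integral_eq_one : ∫ x, toFun x = 1

/-- `ρ^ε(x) = ε⁻² ρ(ε⁻¹ x)` on `ℝ²`. -/
def Mollifier.scaled (ρ : Mollifier) (ε : ℝ) (x : Plane) : ℝ :=
  (ε ^ 2)⁻¹ * ρ.toFun (ε⁻¹ • x)

/-- `ρ^ε` as a function on the torus: the periodic extension of its restriction to the
cell `(-1/2, 1/2]²`, which contains its support when `0 < ε < 1`. -/
def Mollifier.onTorus (ρ : Mollifier) (ε : ℝ) (y : Torus) : ℝ :=
  ρ.scaled ε (cellRep y)

theorem measurable_cellRep : Measurable cellRep := by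
  unfold cellRep
  refine (WithLp.measurable_toLp 2 (Fin 2 → ℝ)).comp (measurable_pi_lambda _ fun i => ?_)
  exact measurable_subtype_coe.comp
    ((AddCircle.measurableEquivIoc (1 : ℝ) (-1 / 2)).measurable.comp (measurable_pi_apply i))

theorem Mollifier.memLp_shift (ρ : Mollifier) (ε : ℝ) (x : Torus) :
    MemLp (fun y : Torus => ρ.onTorus ε (x - y)) 2 volume := by
  have hcs : HasCompactSupport ρ.toFun := by
    refine HasCompactSupport.intro (isCompact_closedBall (0 : Plane) 1) fun z hz => ?_
    by_contra h
    apply hz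
    have hb := ρ.support_subset (subset_tsupport _ h)
    have h0 := hb 0
    have h1 := hb 1
    simp only [Set.mem_Ioo] at h0 h1
    rw [mem_closedBall_zero_iff, EuclideanSpace.norm_eq, Real.sqrt_le_left (by norm_num), one_pow]
    simp only [Fin.sum_univ_two, Real.norm_eq_abs, sq_abs]
    nlinarith [h0.1, h0.2, h1.1, h1.2]
  obtain ⟨C, hC⟩ := hcs.exists_bound_of_continuous ρ.smooth.continuous
  refine MemLp.of_bound (C := ‖(ε ^ 2)⁻¹‖ * C) ?_ (Filter.Eventually.of_forall fun y => ?_)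
  · refine Measurable.aestronglyMeasurable ?_
    have h1 : Measurable fun y : Torus => cellRep (x - y) :=
      measurable_cellRep.comp (by fun_prop)
    exact (ρ.smooth.continuous.measurable.comp (h1.const_smul ε⁻¹)).const_mul _
  · rw [Mollifier.onTorus, Mollifier.scaled, norm_mul]
    exact mul_le_mul_of_nonneg_left (hC _) (norm_nonneg _)

/-- The function `y ↦ ρ^ε(x - y)` as an element of `L²(𝕋²)`. -/
def Mollifier.shiftL2 (ρ : Mollifier) (ε : ℝ) (x : Torus) : Lp ℝ 2 (volume : Measure Torus) :=
  (ρ.memLp_shift ε x).toLp _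

variable {Ω : Type*} [MeasurableSpace Ω]

/-- `W` is a cylindrical Wiener process on `L²(𝕋²)` with identity covariance operator: a centred
Gaussian family indexed by `[0, ∞) × L²(𝕋²)` with
`𝐄 [W_s(f) W_t(g)] = min(s, t) ⟨f, g⟩`, such that each `t ↦ W_t(f)` is almost surely continuous. -/
structure IsCylindricalWiener (W : ℝ≥0 → Lp ℝ 2 (volume : Measure Torus) → Ω → ℝ)
    (P : Measure Ω) : Prop where
  gaussian : IsGaussianProcess
    (fun p : ℝ≥0 × Lp ℝ 2 (volume : Measure Torus) => W p.1 p.2) P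
  centered : ∀ t f, ∫ ω, W t f ω ∂P = 0
  covariance : ∀ s t f g, ∫ ω, W s f ω * W t g ω ∂P = min (s : ℝ) t * inner ℝ f g
  continuous_paths : ∀ f, ∀ᵐ ω ∂P, Continuous fun t => W t f ω

/-- The mollified noise `W^ε(t, x) = (ρ^ε * W_t)(x)`. -/
def mollifiedNoise (ρ : Mollifier) (W : ℝ≥0 → Lp ℝ 2 (volume : Measure Torus) → Ω → ℝ)
    (ε : ℝ) (t : ℝ≥0) (x : Torus) (ω : Ω) : ℝ :=
  W t (ρ.shiftL2 ε x) ω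

/-- The `ℤ²`-periodic function on `ℝ²` corresponding to a function on the torus. -/
def lift (f : Torus → ℝ) : Plane → ℝ := fun z => f (toTorus z)

/-- The right-hand side `½ Δf + ½ |log ε|^{-1/2} |∇f|²`, without the noise, at `z`. -/
def drift (ε : ℝ) (f : Torus → ℝ) (z : Plane) : ℝ :=
  1 / 2 * (Δ (lift f)) z + 1 / 2 * |Real.log ε| ^ (-(1 / 2) : ℝ) * ‖∇ (lift f) z‖ ^ 2

/-- `h` is a (strong) solution of
`∂ₜ h = ½ Δh + ½ |log ε|^{-1/2} |∇h|² + √θ Ẇ^ε`, `h(0, ·) = 0`, on `[0, ∞) × 𝕋²`. The noise is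
additive and smooth in space, so the equation, integrated in time, holds pointwise. -/
structure IsSolution (ρ : Mollifier) (W : ℝ≥0 → Lp ℝ 2 (volume : Measure Torus) → Ω → ℝ)
    (P : Measure Ω) (ε θ : ℝ) (h : ℝ≥0 → Torus → Ω → ℝ) : Prop where
  aemeasurable : ∀ t x, AEMeasurable (h t x) P
  contDiff : ∀ᵐ ω ∂P, ∀ t, ContDiff ℝ 2 (lift fun x => h t x ω)
  continuous_derivatives : ∀ᵐ ω ∂P, ∀ k : ℕ, k ≤ 2 → Continuous fun p : ℝ≥0 × Plane =>
    iteratedFDeriv ℝ k (lift fun x => h p.1 x ω) p.2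
  equation : ∀ (t : ℝ≥0) (z : Plane), ∀ᵐ ω ∂P,
    h t (toTorus z) ω =
      (∫ s in (0 : ℝ)..t, drift ε (fun x => h s.toNNReal x ω) z)
        + √θ * mollifiedNoise ρ W ε t (toTorus z) ω

end KPZ

end

noncomputable section

namespace KPZ

/-! ### Gaussian integration by parts -/

/-! Write λ = |log ε|^{-1/2} (`coupling`) and R = ρ^ε ⋆ ρ^ε (`Mollifier.corr`), so that R(0) =
‖ρ‖²/ε². By the Cole–Hopf transform and Feynman–Kac, exp(λh) is the partition function of a directed
polymer: an average over paths of exponentials of the noise collected along the path, each a centred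
Gaussian of variance λ²θtR(0). Put F = λh − λ²θtR(0)/2, the normalised free energy. Then λκ =
λ²θtR(0)/2 + E F, and after division by λ the claim is exactly E F = O(1).

No stochastic calculus is used. Brownian motion is replaced by a walk with n steps (±√δ, ±√δ), δ =
t/n. A Taylor expansion for each realisation of the noise (`exists_one_step`) and the sup-norm
stability of the scheme (`abs_log_evolution_sub_le`) show that the discrete free energy F_n
converges to F almost surely. Each F_n is a log-sum-exp of finitely many Gaussians.

Upper side: E exp(F_n) = 1 by the normalisation. Together with a bound E F_n ≥ −C this controls
E|F_n|, and Fatou's lemma gives |E F| ≤ 2 + C (`integrable_of_ae_tendsto_of_integral_exp_le`).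
Jensen's inequality gives some C for every ε, hence integrability. A C uniform in ε comes from
coupling two replicas (`neg_log_overlap_le_integral_lse`): Gaussian interpolation bounds E F_n below
by the logarithm of an exponential moment of the overlap of two independent walks, that is, of λ²θ
times R summed along their difference.

By a Khas'minskii argument (`evolution_le_two`) that moment is at most 2 as soon as λ²θ times the
Green potential of R is small. In Fourier variables this potential is at most of order ∑
|ρ̂^ε(m)|²/(1/t + |m|²), which in dimension two is O(log(1/ε)) (`eventually_green_le`). The factor
λ² = 1/|log ε| compensates the logarithm exactly, and an absolute smallness of θ does the rest.

The expectation does not depend on x because the covariances of the noise along walks depend only on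
differences of base points, so the law of F_n, and of its limit, is the same everywhere. -/

theorem integrable_gaussianPDFReal_mul {v : ℝ≥0} (hv : v ≠ 0) {g : ℝ → ℝ}
    (hg : Integrable g (gaussianReal 0 v)) :
    Integrable fun x => gaussianPDFReal 0 v x * g x := by
  rw [gaussianReal_of_var_ne_zero _ hv, integrable_withDensity_iff_integrable_smul'
    (measurable_gaussianPDF _ _) (by simp [gaussianPDF])] at hg
  refine hg.congr (Filter.Eventually.of_forall fun x => ?_)
  simp [toReal_gaussianPDF]

/-- Supplies the antiderivative of x times the density for the integration by parts. -/
theorem hasDerivAt_gaussianPDFReal (v : ℝ≥0) (hv : v ≠ 0) (x : ℝ) :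
    HasDerivAt (fun x => -(v : ℝ) * gaussianPDFReal 0 v x) (x * gaussianPDFReal 0 v x) x := by
  have hv' : (v : ℝ) ≠ 0 := by exact_mod_cast hv
  have h1 : HasDerivAt (fun x : ℝ => -(x - 0) ^ 2 / (2 * (v : ℝ))) (-x / v) x := by
    have := (((hasDerivAt_id x).sub_const 0).pow 2).neg.div_const (2 * (v : ℝ))
    refine this.congr_deriv ?_
    simp
    field_simp
  have h2 := ((h1.exp).const_mul (√(2 * Real.pi * v))⁻¹).const_mul (-(v : ℝ))
  refine h2.congr_deriv ?_
  rw [gaussianPDFReal]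
  field_simp

/-- One-dimensional Gaussian integration by parts. -/
theorem integral_id_mul_gaussianReal (v : ℝ≥0) {f f' : ℝ → ℝ} (hf : ∀ x, HasDerivAt f (f' x) x)
    (hf'c : Continuous f') {C C' : ℝ} (hC : ∀ x, |f x| ≤ C) (hC' : ∀ x, |f' x| ≤ C') :
    ∫ x, x * f x ∂(gaussianReal 0 v) = v * ∫ x, f' x ∂(gaussianReal 0 v) := by
  rcases eq_or_ne v 0 with rfl | hv
  · simp [gaussianReal_zero_var]
  have hfc : Continuous f := continuous_iff_continuousAt.2 fun x => (hf x).continuousAt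
  have hid : Integrable (fun x : ℝ => x) (gaussianReal 0 v) :=
    memLp_one_iff_integrable.1 (memLp_id_gaussianReal 1)
  have hf1 : Integrable f (gaussianReal 0 v) :=
    Integrable.of_bound hfc.aestronglyMeasurable C (Filter.Eventually.of_forall hC)
  have hf2 : Integrable f' (gaussianReal 0 v) :=
    Integrable.of_bound hf'c.aestronglyMeasurable C' (Filter.Eventually.of_forall hC')
  have hf3 : Integrable (fun x => x * f x) (gaussianReal 0 v) :=
    hid.mul_bdd hfc.aestronglyMeasurable (Filter.Eventually.of_forall hC)
  have key := integral_mul_deriv_eq_deriv_mul_of_integrable (u := f) (u' := f')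
    (v := fun x => -(v : ℝ) * gaussianPDFReal 0 v x) (v' := fun x => x * gaussianPDFReal 0 v x)
    (fun x _ => hf x) (fun x _ => hasDerivAt_gaussianPDFReal v hv x)
    ((integrable_gaussianPDFReal_mul hv hf3).congr
      (Filter.Eventually.of_forall fun x => by simp only [Pi.mul_apply]; ring))
    (((integrable_gaussianPDFReal_mul hv hf2).const_mul (-(v : ℝ))).congr
      (Filter.Eventually.of_forall fun x => by simp only [Pi.mul_apply]; ring))
    (((integrable_gaussianPDFReal_mul hv hf1).const_mul (-(v : ℝ))).congr
      (Filter.Eventually.of_forall fun x => by simp only [Pi.mul_apply]; ring))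
  rw [integral_gaussianReal_eq_integral_smul hv, integral_gaussianReal_eq_integral_smul hv,
    ← integral_const_mul]
  simp only [smul_eq_mul]
  rw [← integral_neg] at key
  calc _ = ∫ x, f x * (x * gaussianPDFReal 0 v x) := by congr 1; ext x; ring
    _ = _ := key
    _ = _ := by congr 1; ext x; ring

variable {Ω : Type*} [MeasurableSpace Ω] {P : Measure Ω}

theorem integrable_mul_of_gaussian {J : Type*} [Fintype J] {X : J → Ω → ℝ}
    (hX : HasGaussianLaw (fun ω j => X j ω) P) (i j : J) :
    Integrable (fun ω => X i ω * X j ω) P := by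
  have h1 : MemLp (X i) 2 P := (hX.eval i).memLp_two
  have h2 : MemLp (X j) 2 P := (hX.eval j).memLp_two
  exact h1.integrable_mul h2

/-- Gaussian integration by parts for a centred Gaussian vector. Only the derivative of `f` in the
direction `j ↦ 𝐄 [X i * X j]` enters. -/
theorem integral_mul_gaussian {J : Type*} [Fintype J] {X : J → Ω → ℝ}
    (hX : HasGaussianLaw (fun ω j => X j ω) P) (h0 : ∀ j, ∫ ω, X j ω ∂P = 0) (i : J)
    {f f' : (J → ℝ) → ℝ} (hfc : Continuous f) (hf'c : Continuous f')
    {C C' : ℝ} (hC : ∀ x, |f x| ≤ C) (hC' : ∀ x, |f' x| ≤ C')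
    (hf : ∀ (x : J → ℝ) (s : ℝ), HasDerivAt
      (fun s : ℝ => f (x + s • fun j => ∫ ω, X i ω * X j ω ∂P))
      (f' (x + s • fun j => ∫ ω, X i ω * X j ω ∂P)) s) :
    ∫ ω, X i ω * f (fun j => X j ω) ∂P = ∫ ω, f' (fun j => X j ω) ∂P := by
  have hP := hX.isProbabilityMeasure
  set c : J → ℝ := fun j => ∫ ω, X i ω * X j ω ∂P with hc
  have hcov : ∀ j k, cov[X j, X k; P] = ∫ ω, X j ω * X k ω ∂P := fun j k => by
    rw [covariance_eq_sub (hX.eval j).memLp_two (hX.eval k).memLp_two, h0, h0]; simp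
  have hvar : Var[X i; P] = c i := by rw [← covariance_self (hX.eval i).aemeasurable, hcov]
  have hlaw : P.map (X i) = gaussianReal 0 (c i).toNNReal := by
    rw [(hX.eval i).map_eq_gaussianReal, hvar, h0]
  have hci : 0 ≤ c i := hvar ▸ variance_nonneg _ _
  -- Degenerate case: X i vanishes almost surely, hence so does the direction c, and f' is the
  -- derivative of a constant.
  rcases eq_or_lt_of_le hci with h | hpos
  · have hXi : X i =ᵐ[P] 0 := by
      have h2 : ∫ ω, X i ω * X i ω ∂P = 0 := h.symm
      rw [integral_eq_zero_iff_of_nonneg (fun ω => mul_self_nonneg _)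
        (integrable_mul_of_gaussian hX i i)] at h2
      filter_upwards [h2] with ω hω using by simpa using hω
    have hcz : c = 0 := by
      ext j
      refine integral_eq_zero_of_ae ?_
      filter_upwards [hXi] with ω hω using by simp [hω]
    have hf'0 : ∀ x, f' x = 0 := fun x => by
      have := hf x 0
      simp only [hcz, smul_zero, add_zero] at this
      exact this.unique (hasDerivAt_const _ _)
    simp only [hf'0, integral_zero]
    refine integral_eq_zero_of_ae ?_
    filter_upwards [hXi] with ω hω using by simp [hω]
  -- The residual of the linear regression on X i is uncorrelated with X i, hence independent of it
  -- by joint Gaussianity.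
  set Y : J → Ω → ℝ := fun j ω => X j ω - c j / c i * X i ω with hY
  have hXY : HasGaussianLaw (fun ω => (fun _ : Unit => X i ω, fun j => Y j ω)) P := by
    refine hX.map_fun (ContinuousLinearMap.prod
      (ContinuousLinearMap.pi fun _ : Unit => ContinuousLinearMap.proj i)
      (ContinuousLinearMap.pi fun j => ContinuousLinearMap.proj j -
        (c j / c i) • ContinuousLinearMap.proj (R := ℝ) (φ := fun _ : J => ℝ) i))
  have hind0 : IndepFun (fun ω (_ : Unit) => X i ω) (fun ω j => Y j ω) P := by
    refine HasGaussianLaw.indepFun_of_covariance_eval (X := fun (_ : Unit) => X i) hXY ?_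
    intro _ j
    rw [hY, covariance_fun_sub_right (hX.eval i).memLp_two (hX.eval j).memLp_two
      ((hX.eval i).memLp_two.const_mul _), covariance_const_mul_right, hcov, hcov]
    change c j - c j / c i * c i = 0
    field_simp
    simp
  have hind : IndepFun (X i) (fun ω j => Y j ω) P :=
    hind0.comp (φ := fun u : Unit → ℝ => u ()) (ψ := id) (measurable_pi_apply _) measurable_id
  have hXm : AEMeasurable (X i) P := (hX.eval i).aemeasurable
  have hYm : AEMeasurable (fun ω j => Y j ω) P := hXY.snd.aemeasurable
  have hprod := (indepFun_iff_map_prod_eq_prod_map_map hXm hYm).1 hind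
  have hrec : ∀ ω, (fun j => X j ω) = (fun j => Y j ω) + (X i ω / c i) • c := fun ω => by
    ext j; simp [hY]; ring
  have hμ : IsProbabilityMeasure (P.map fun ω j => Y j ω) :=
    Measure.isProbabilityMeasure_map hYm
  set G : ℝ × (J → ℝ) → J → ℝ := fun q => q.2 + (q.1 / c i) • c with hG
  have hGc : Continuous G := by fun_prop
  have e1 : ∫ ω, X i ω * f (fun j => X j ω) ∂P
      = ∫ y, ∫ x, x * f (G (x, y)) ∂(gaussianReal 0 (c i).toNNReal) ∂(P.map fun ω j => Y j ω) := by
    have hint : Integrable (fun q : ℝ × (J → ℝ) => q.1 * f (G q))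
        ((gaussianReal 0 (c i).toNNReal).prod (P.map fun ω j => Y j ω)) := by
      refine Integrable.mul_bdd (f := fun q : ℝ × (J → ℝ) => q.1) ?_
        (hfc.comp hGc).aestronglyMeasurable (Filter.Eventually.of_forall fun _ => hC _)
      exact (memLp_one_iff_integrable.1 (memLp_id_gaussianReal 1)).comp_fst _
    rw [← integral_prod_symm _ hint, ← hlaw, ← hprod, integral_map (hXm.prodMk hYm)
      (by exact (continuous_fst.mul (hfc.comp hGc)).aestronglyMeasurable)]
    refine integral_congr_ae (Filter.Eventually.of_forall fun ω => ?_)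
    simp only [hG, ← hrec]
  have e2 : ∫ ω, f' (fun j => X j ω) ∂P
      = ∫ y, ∫ x, f' (G (x, y)) ∂(gaussianReal 0 (c i).toNNReal) ∂(P.map fun ω j => Y j ω) := by
    have hint : Integrable (fun q : ℝ × (J → ℝ) => f' (G q))
        ((gaussianReal 0 (c i).toNNReal).prod (P.map fun ω j => Y j ω)) :=
      Integrable.of_bound (hf'c.comp hGc).aestronglyMeasurable C'
        (Filter.Eventually.of_forall fun _ => hC' _)
    rw [← integral_prod_symm _ hint, ← hlaw, ← hprod, integral_map (hXm.prodMk hYm)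
      (by exact (hf'c.comp hGc).aestronglyMeasurable)]
    refine integral_congr_ae (Filter.Eventually.of_forall fun ω => ?_)
    simp only [hG, ← hrec]
  rw [e1, e2]
  refine integral_congr_ae (Filter.Eventually.of_forall fun y => ?_)
  -- One-dimensional integration by parts with the residual y frozen; the chain-rule factor 1 / c i
  -- cancels the variance c i.
  have key := integral_id_mul_gaussianReal (c i).toNNReal (f := fun x => f (G (x, y)))
    (f' := fun x => f' (G (x, y)) * (1 / c i)) (fun x => ?_) (by fun_prop) (fun x => hC _)
    (C' := C' * |1 / c i|) (fun x => ?_)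
  · simp only [key, integral_mul_const, Real.coe_toNNReal _ hci]
    field_simp
  · have h2 : HasDerivAt (fun x : ℝ => x / c i) (1 / c i) x := (hasDerivAt_id x).div_const _
    exact (hf y (x / c i)).comp x h2
  · rw [abs_mul]
    exact mul_le_mul_of_nonneg_right (hC' _) (abs_nonneg _)

end KPZ

end

noncomputable section

namespace KPZ

/-! ### Log-partition functions and Gibbs weights -/

section Gibbs

variable {J : Type*} [Fintype J]

/-- The log-partition function `log ∑ j, exp (y j)`. -/
def lse (y : J → ℝ) : ℝ := Real.log (∑ j, Real.exp (y j))

/-- The Gibbs weights `exp (y j) / ∑ k, exp (y k)`. -/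
def gibbs (y : J → ℝ) (j : J) : ℝ := Real.exp (y j) / ∑ k, Real.exp (y k)

variable [Nonempty J]

theorem sum_exp_pos (y : J → ℝ) : 0 < ∑ j, Real.exp (y j) :=
  Finset.sum_pos (fun _ _ => Real.exp_pos _) Finset.univ_nonempty

theorem exp_lse (y : J → ℝ) : Real.exp (lse y) = ∑ j, Real.exp (y j) :=
  Real.exp_log (sum_exp_pos y)

theorem gibbs_nonneg (y : J → ℝ) (j : J) : 0 ≤ gibbs y j :=
  div_nonneg (Real.exp_pos _).le (sum_exp_pos y).le

theorem sum_gibbs (y : J → ℝ) : ∑ j, gibbs y j = 1 := by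
  simp only [gibbs, ← Finset.sum_div]
  exact div_self (sum_exp_pos y).ne'

theorem gibbs_le_one (y : J → ℝ) (j : J) : gibbs y j ≤ 1 :=
  (Finset.single_le_sum (fun k _ => gibbs_nonneg y k) (Finset.mem_univ j)).trans_eq (sum_gibbs y)

theorem continuous_gibbs (j : J) : Continuous fun y : J → ℝ => gibbs y j := by
  unfold gibbs
  exact Continuous.div (by fun_prop) (by fun_prop) fun y => (sum_exp_pos y).ne'

theorem continuous_lse : Continuous (lse : (J → ℝ) → ℝ) := by
  unfold lse
  exact Continuous.log (by fun_prop) fun y => (sum_exp_pos y).ne'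

theorem lse_add_const (y : J → ℝ) (c : ℝ) : lse (fun j => y j + c) = lse y + c := by
  simp only [lse, Real.exp_add, ← Finset.sum_mul]
  rw [Real.log_mul (sum_exp_pos y).ne' (Real.exp_pos c).ne', Real.log_exp]

theorem lse_mono {y z : J → ℝ} (h : ∀ j, y j ≤ z j) : lse y ≤ lse z :=
  Real.log_le_log (sum_exp_pos y) (Finset.sum_le_sum fun j _ => Real.exp_le_exp.2 (h j))

theorem abs_sum_gibbs_mul_le (y c : J → ℝ) : |∑ j, gibbs y j * c j| ≤ ∑ j, |c j| := by
  refine (Finset.abs_sum_le_sum_abs _ _).trans (Finset.sum_le_sum fun j _ => ?_)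
  rw [abs_mul, abs_of_nonneg (gibbs_nonneg y j)]
  exact mul_le_of_le_one_left (abs_nonneg _) (gibbs_le_one y j)

/-- Jensen's inequality for the Gibbs measure. -/
theorem lse_add_ge (y c : J → ℝ) : lse y + ∑ j, gibbs y j * c j ≤ lse (fun j => y j + c j) := by
  have h1 : Real.exp (∑ j, gibbs y j * c j) ≤ ∑ j, gibbs y j * Real.exp (c j) := by
    have := convexOn_exp.map_sum_le (t := Finset.univ) (w := gibbs y) (p := c)
      (fun j _ => gibbs_nonneg y j) (sum_gibbs y) (fun _ _ => Set.mem_univ _)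
    simpa using this
  have h2 : ∑ j, Real.exp (y j + c j)
      = (∑ j, Real.exp (y j)) * ∑ j, gibbs y j * Real.exp (c j) := by
    rw [Finset.mul_sum]
    refine Finset.sum_congr rfl fun j _ => ?_
    have := (sum_exp_pos y).ne'
    rw [gibbs, Real.exp_add]
    field_simp
  have h3 : 0 < ∑ j, gibbs y j * Real.exp (c j) := (Real.exp_pos _).trans_le h1
  rw [lse, lse, h2, Real.log_mul (sum_exp_pos y).ne' h3.ne']
  exact add_le_add_right ((Real.le_log_iff_exp_le h3).2 h1) _

/-- Jensen's inequality from 0 to y and from y back to 0. The linear growth makes free energies of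
integrable Hamiltonians integrable. -/
theorem abs_lse_le (y : J → ℝ) : |lse y| ≤ Real.log (Fintype.card J) + ∑ j, |y j| := by
  have h0 : lse (fun _ : J => (0 : ℝ)) = Real.log (Fintype.card J) := by simp [lse]
  have h1 := lse_add_ge (fun _ : J => (0 : ℝ)) y
  have h2 := lse_add_ge y (fun j => -y j)
  have h3 := abs_le.1 (abs_sum_gibbs_mul_le (fun _ : J => (0 : ℝ)) y)
  have h4 := abs_le.1 (abs_sum_gibbs_mul_le y fun j => -y j)
  have h5 : 0 ≤ Real.log (Fintype.card J) := Real.log_natCast_nonneg _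
  simp only [zero_add, add_neg_cancel, abs_neg] at h1 h2 h4
  rw [h0] at h1 h2
  rw [abs_le]
  constructor <;> linarith

theorem hasDerivAt_lse {y : ℝ → J → ℝ} {y' : J → ℝ} {s : ℝ}
    (h : ∀ j, HasDerivAt (fun s => y s j) (y' j) s) :
    HasDerivAt (fun s => lse (y s)) (∑ j, gibbs (y s) j * y' j) s := by
  have h1 : HasDerivAt (fun s => ∑ j, Real.exp (y s j)) (∑ j, Real.exp (y s j) * y' j) s :=
    HasDerivAt.fun_sum fun j _ => (h j).exp
  refine (h1.log (sum_exp_pos _).ne').congr_deriv ?_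
  rw [Finset.sum_div]
  exact Finset.sum_congr rfl fun j _ => by rw [gibbs]; ring

theorem hasDerivAt_gibbs {y : ℝ → J → ℝ} {y' : J → ℝ} {s : ℝ}
    (h : ∀ j, HasDerivAt (fun s => y s j) (y' j) s) (i : J) :
    HasDerivAt (fun s => gibbs (y s) i)
      (gibbs (y s) i * (y' i - ∑ j, gibbs (y s) j * y' j)) s := by
  have h1 : ∀ s, gibbs (y s) i = Real.exp (y s i - lse (y s)) := fun s => by
    rw [Real.exp_sub, exp_lse, gibbs]
  simp only [h1 s, show (fun s => gibbs (y s) i) = fun s => Real.exp (y s i - lse (y s)) from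
    funext h1]
  exact ((h i).sub (hasDerivAt_lse h)).exp

end Gibbs

/-! ### Free energies of Gaussian Hamiltonians -/

section FreeEnergy

variable {Ω : Type*} [MeasurableSpace Ω] {P : Measure Ω} {J : Type*} [Fintype J]

theorem aestronglyMeasurable_pi_real {Y : Ω → J → ℝ}
    (hY : ∀ j, AEStronglyMeasurable (fun ω => Y ω j) P) : AEStronglyMeasurable Y P :=
  (aemeasurable_pi_iff.2 fun j => (hY j).aemeasurable).aestronglyMeasurable

theorem integral_sum_add_const_mul {f g : J → Ω → ℝ} (hf : ∀ j, Integrable (f j) P)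
    (hg : ∀ j, Integrable (g j) P) (c : J → ℝ) :
    ∫ ω, ∑ j, (f j ω + c j * g j ω) ∂P = ∑ j, (∫ ω, f j ω ∂P + c j * ∫ ω, g j ω ∂P) := by
  rw [integral_finsetSum]
  · refine Finset.sum_congr rfl fun j _ => ?_
    rw [integral_add (hf j) ((hg j).const_mul _), integral_const_mul]
  · exact fun j _ => (hf j).add ((hg j).const_mul _)

/-- The exponents of the interpolated Hamiltonian. -/
def hamiltonian (X : J → Ω → ℝ) (a b : J → ℝ) (s : ℝ) (ω : Ω) (j : J) : ℝ :=
  s * X j ω + (a j + s ^ 2 * b j)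

theorem aestronglyMeasurable_hamiltonian {X : J → Ω → ℝ} (hX : ∀ j, Integrable (X j) P)
    (a b : J → ℝ) (s : ℝ) : AEStronglyMeasurable (fun ω => hamiltonian X a b s ω) P :=
  aestronglyMeasurable_pi_real fun j =>
    ((hX j).aestronglyMeasurable.const_mul s).add aestronglyMeasurable_const

theorem integrable_bdd_gibbs [IsProbabilityMeasure P] {X : J → Ω → ℝ}
    (hX : ∀ j, Integrable (X j) P) (a b : J → ℝ) (s : ℝ) {Φ : (J → ℝ) → ℝ} (hΦ : Continuous Φ)
    {C : ℝ} (hC : ∀ y, |Φ y| ≤ C) : Integrable (fun ω => Φ (hamiltonian X a b s ω)) P :=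
  Integrable.of_bound
    (hΦ.comp_aestronglyMeasurable (aestronglyMeasurable_hamiltonian hX a b s)) C
    (Filter.Eventually.of_forall fun _ => hC _)

variable [Nonempty J]

theorem integrable_lse {Y : J → Ω → ℝ} [IsProbabilityMeasure P] (hY : ∀ j, Integrable (Y j) P) :
    Integrable (fun ω => lse fun j => Y j ω) P := by
  have hg : Integrable (fun ω => Real.log (Fintype.card J) + ∑ j, |Y j ω|) P :=
    (integrable_const _).add (integrable_finsetSum _ fun j _ => (hY j).abs)
  refine hg.mono' ?_ (Filter.Eventually.of_forall fun ω => abs_lse_le _)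
  exact continuous_lse.comp_aestronglyMeasurable
    (aestronglyMeasurable_pi_real fun j => (hY j).aestronglyMeasurable)

/-- The covariance term `∑ j, w j * (2 * b j + K j j) - ∑ j k, w j * w k * K j k`. -/
def overlapTerm (K : J → J → ℝ) (b : J → ℝ) (y : J → ℝ) : ℝ :=
  ∑ j, gibbs y j * (2 * b j + K j j) - ∑ j, gibbs y j * ∑ k, gibbs y k * K j k

theorem abs_gibbs_sum_sum_le (K : J → J → ℝ) (y : J → ℝ) :
    |∑ j, gibbs y j * ∑ k, gibbs y k * K j k| ≤ ∑ j, ∑ k, |K j k| :=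
  (abs_sum_gibbs_mul_le _ _).trans (Finset.sum_le_sum fun _ _ => abs_sum_gibbs_mul_le _ _)

theorem continuous_gibbs_sum_sum (K : J → J → ℝ) :
    Continuous fun y : J → ℝ => ∑ j, gibbs y j * ∑ k, gibbs y k * K j k := by
  have := fun j : J => continuous_gibbs j
  fun_prop

/-- Gaussian integration by parts trades the factor X i for the derivative of the Gibbs weight in
the direction of the covariances with X i. -/
theorem gibbs_ibp {X : J → Ω → ℝ} (hX : HasGaussianLaw (fun ω j => X j ω) P)
    (h0 : ∀ j, ∫ ω, X j ω ∂P = 0) (a b : J → ℝ) (s : ℝ) (i : J) :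
    ∫ ω, X i ω * gibbs (hamiltonian X a b s ω) i ∂P =
      ∫ ω, s * (gibbs (hamiltonian X a b s ω) i * ((∫ ω', X i ω' * X i ω' ∂P) -
        ∑ k, gibbs (hamiltonian X a b s ω) k * ∫ ω', X i ω' * X k ω' ∂P)) ∂P := by
  set K : J → ℝ := fun k => ∫ ω', X i ω' * X k ω' ∂P
  have hg := fun j : J => continuous_gibbs j
  have hD : Continuous fun (x : J → ℝ) (j : J) => s * x j + (a j + s ^ 2 * b j) := by fun_prop
  have hgD : ∀ k : J, Continuous fun x : J → ℝ =>
      gibbs (fun j => s * x j + (a j + s ^ 2 * b j)) k :=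
    fun k => (hg k).comp hD
  refine integral_mul_gaussian hX h0 i
    (f := fun x => gibbs (fun j => s * x j + (a j + s ^ 2 * b j)) i)
    (f' := fun x => s * (gibbs (fun j => s * x j + (a j + s ^ 2 * b j)) i * (K i -
        ∑ k, gibbs (fun j => s * x j + (a j + s ^ 2 * b j)) k * K k)))
    (hgD i) (by fun_prop) (C := 1) (fun x => ?_) (C' := |s| * (|K i| + ∑ k, |K k|))
    (fun x => ?_) (fun x r => ?_)
  · rw [abs_of_nonneg (gibbs_nonneg _ _)]
    exact gibbs_le_one _ _
  · rw [abs_mul, abs_mul, abs_of_nonneg (gibbs_nonneg _ _)]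
    refine mul_le_mul_of_nonneg_left ?_ (abs_nonneg _)
    refine (mul_le_of_le_one_left (abs_nonneg _) (gibbs_le_one _ _)).trans ?_
    exact (abs_sub _ _).trans (add_le_add_right (abs_sum_gibbs_mul_le _ _) _)
  · have h1 : ∀ j, HasDerivAt (fun r : ℝ => s * (x + r • K) j + (a j + s ^ 2 * b j)) (s * K j) r :=
      fun j => by
        have : HasDerivAt (fun r : ℝ => x j + r * K j) (1 * K j) r :=
          ((hasDerivAt_id r).mul_const (K j)).const_add (x j)
        simpa using (this.const_mul s).add_const (a j + s ^ 2 * b j)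
    refine (hasDerivAt_gibbs h1 i).congr_deriv ?_
    have : ∑ j, gibbs (fun j => s * (x + r • K) j + (a j + s ^ 2 * b j)) j * (s * K j)
        = s * ∑ j, gibbs (fun j => s * (x + r • K) j + (a j + s ^ 2 * b j)) j * K j := by
      rw [Finset.mul_sum]
      exact Finset.sum_congr rfl fun j _ => by ring
    rw [this]
    ring

/-- The derivative of the free energy of a Gaussian Hamiltonian in the coupling strength. -/
theorem hasDerivAt_freeEnergy {X : J → Ω → ℝ} (hX : HasGaussianLaw (fun ω j => X j ω) P)
    (h0 : ∀ j, ∫ ω, X j ω ∂P = 0) {K : J → J → ℝ} (hK : ∀ j k, ∫ ω, X j ω * X k ω ∂P = K j k)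
    (a b : J → ℝ) (s : ℝ) :
    HasDerivAt (fun s => ∫ ω, lse (hamiltonian X a b s ω) ∂P)
      (s * ∫ ω, overlapTerm K b (hamiltonian X a b s ω) ∂P) s := by
  have hP := hX.isProbabilityMeasure
  have hXi : ∀ j, Integrable (X j) P := fun j => (hX.eval j).integrable
  have hder : ∀ ω s, HasDerivAt (fun s => lse (hamiltonian X a b s ω))
      (∑ j, gibbs (hamiltonian X a b s ω) j * (X j ω + 2 * s * b j)) s := fun ω s =>
    hasDerivAt_lse fun j => by
      have h1 : HasDerivAt (fun s : ℝ => s * X j ω) (1 * X j ω) s :=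
        (hasDerivAt_id s).mul_const _
      have h2 : HasDerivAt (fun s : ℝ => s ^ 2 * b j) (((2 : ℕ) : ℝ) * s ^ (2 - 1) * b j) s :=
        (hasDerivAt_pow 2 s).mul_const (b j)
      refine (h1.add (h2.const_add (a j))).congr_deriv ?_
      simp
  have hmeas : ∀ s, AEStronglyMeasurable (fun ω => hamiltonian X a b s ω) P :=
    aestronglyMeasurable_hamiltonian hXi a b
  have hg := fun j : J => continuous_gibbs j
  have key := hasDerivAt_integral_of_dominated_loc_of_deriv_le (μ := P) (s := Metric.ball s 1)
    (F := fun s ω => lse (hamiltonian X a b s ω))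
    (F' := fun s ω => ∑ j, gibbs (hamiltonian X a b s ω) j * (X j ω + 2 * s * b j))
    (bound := fun ω => ∑ j, (|X j ω| + 2 * (|s| + 1) * |b j|)) (x₀ := s)
    (Metric.ball_mem_nhds s one_pos)
    (Filter.Eventually.of_forall fun s => continuous_lse.comp_aestronglyMeasurable (hmeas s))
    (integrable_lse fun j => ((hXi j).const_mul s).add (integrable_const _))
    ?_ (Filter.Eventually.of_forall fun ω r hr => ?_)
    (integrable_finsetSum _ fun j _ => (hXi j).abs.add (integrable_const _))
    (Filter.Eventually.of_forall fun ω r _ => hder ω r)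
  · refine key.2.congr_deriv ?_
    have hint : ∀ j, Integrable (fun ω => X j ω * gibbs (hamiltonian X a b s ω) j) P := fun j =>
      -- Gibbs weights lie in [0, 1], so products with them inherit integrability.
      (hXi j).mul_bdd (c := 1) ((hg j).comp_aestronglyMeasurable (hmeas s))
        (Filter.Eventually.of_forall fun ω => by
          rw [Real.norm_eq_abs, abs_of_nonneg (gibbs_nonneg _ _)]; exact gibbs_le_one _ _)
    have hgi : ∀ j, Integrable (fun ω => gibbs (hamiltonian X a b s ω) j) P := fun j =>
      integrable_bdd_gibbs hXi a b s (hg j) (C := 1) fun y => by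
        rw [abs_of_nonneg (gibbs_nonneg _ _)]; exact gibbs_le_one _ _
    have hgs : ∀ j, Integrable (fun ω => gibbs (hamiltonian X a b s ω) j *
        (K j j - ∑ k, gibbs (hamiltonian X a b s ω) k * K j k)) P := fun j =>
      integrable_bdd_gibbs hXi a b s (Φ := fun y => gibbs y j * (K j j - ∑ k, gibbs y k * K j k))
        (by fun_prop) (C := |K j j| + ∑ k, |K j k|) fun y => by
          rw [abs_mul, abs_of_nonneg (gibbs_nonneg _ _)]
          refine (mul_le_of_le_one_left (abs_nonneg _) (gibbs_le_one _ _)).trans ?_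
          exact (abs_sub _ _).trans (add_le_add_right (abs_sum_gibbs_mul_le _ _) _)
    calc ∫ ω, ∑ j, gibbs (hamiltonian X a b s ω) j * (X j ω + 2 * s * b j) ∂P
        = ∑ j, (∫ ω, X j ω * gibbs (hamiltonian X a b s ω) j ∂P
            + 2 * s * b j * ∫ ω, gibbs (hamiltonian X a b s ω) j ∂P) := by
          rw [← integral_sum_add_const_mul hint hgi]
          congr 1
          ext ω
          exact Finset.sum_congr rfl fun j _ => by ring
      _ = ∑ j, (s * ∫ ω, gibbs (hamiltonian X a b s ω) j *
            (K j j - ∑ k, gibbs (hamiltonian X a b s ω) k * K j k) ∂P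
            + 2 * s * b j * ∫ ω, gibbs (hamiltonian X a b s ω) j ∂P) := by
          refine Finset.sum_congr rfl fun j _ => ?_
          rw [gibbs_ibp hX h0 a b s j, integral_const_mul]
          simp only [hK]
      _ = s * ∫ ω, overlapTerm K b (hamiltonian X a b s ω) ∂P := by
          have : ∀ ω, overlapTerm K b (hamiltonian X a b s ω) =
              ∑ j, (gibbs (hamiltonian X a b s ω) j *
                (K j j - ∑ k, gibbs (hamiltonian X a b s ω) k * K j k)
                + 2 * b j * gibbs (hamiltonian X a b s ω) j) := fun ω => by
            rw [overlapTerm, ← Finset.sum_sub_distrib]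
            exact Finset.sum_congr rfl fun j _ => by ring
          simp only [this]
          rw [integral_sum_add_const_mul hgs hgi, Finset.mul_sum]
          exact Finset.sum_congr rfl fun j _ => by ring
  · exact Finset.aestronglyMeasurable_fun_sum _ fun j _ =>
      ((hg j).comp_aestronglyMeasurable (hmeas s)).mul
        ((hXi j).aestronglyMeasurable.add aestronglyMeasurable_const)
  · refine (abs_sum_gibbs_mul_le _ _).trans (Finset.sum_le_sum fun j _ => ?_)
    refine (abs_add_le _ _).trans (add_le_add_right ?_ _)
    rw [abs_mul, abs_mul, abs_two]
    have : |r| ≤ |s| + 1 := by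
      have h1 : |r - s| < 1 := hr
      have h2 := abs_sub_abs_le_abs_sub r s
      linarith
    gcongr

end FreeEnergy

end KPZ

end

noncomputable section

namespace KPZ

/-! ### A lower bound for the quenched free energy by replica coupling -/

section Replica

variable {Ω : Type*} [MeasurableSpace Ω] {P : Measure Ω} {I : Type*} [Fintype I]

/-- Two replicas in the same environment are independent under the Gibbs measure of the summed
Hamiltonian. -/
theorem gibbs_pair (y : I → ℝ) (q : I × I) :
    gibbs (fun q : I × I => y q.1 + y q.2) q = gibbs y q.1 * gibbs y q.2 := by
  have : ∑ q : I × I, Real.exp (y q.1 + y q.2) = (∑ i, Real.exp (y i)) * ∑ i, Real.exp (y i) := by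
    rw [Fintype.sum_prod_type, Finset.sum_mul_sum]
    simp only [Real.exp_add]
  rw [gibbs, gibbs, gibbs, this, Real.exp_add]
  ring

variable [Nonempty I]

theorem lse_pair (y : I → ℝ) : lse (fun q : I × I => y q.1 + y q.2) = 2 * lse y := by
  have : ∑ q : I × I, Real.exp (y q.1 + y q.2) = (∑ i, Real.exp (y i)) * ∑ i, Real.exp (y i) := by
    rw [Fintype.sum_prod_type, Finset.sum_mul_sum]
    simp only [Real.exp_add]
  rw [lse, lse, this, Real.log_mul (sum_exp_pos y).ne' (sum_exp_pos y).ne']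
  ring

/-- The two-replica bound: for a centred Gaussian field with nonnegative covariances and constant
variance `N`, the normalised quenched free energy is bounded below in terms of an exponential moment
of the overlap of two independent replicas. -/
theorem neg_log_overlap_le_integral_lse {H : I → Ω → ℝ} (hH : HasGaussianLaw (fun ω i => H i ω) P)
    (h0 : ∀ i, ∫ ω, H i ω ∂P = 0) {C : I → I → ℝ} (hC : ∀ i j, ∫ ω, H i ω * H j ω ∂P = C i j)
    (hC0 : ∀ i j, 0 ≤ C i j) {N : ℝ} (hN : ∀ i, C i i = N) :
    -((Real.exp 1 - 1) / 2) *
        Real.log ((∑ i, ∑ j, Real.exp (2 * C i j)) / (Fintype.card I : ℝ) ^ 2)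
      ≤ ∫ ω, lse (fun i => H i ω + (-Real.log (Fintype.card I) - N / 2)) ∂P := by
  have hP := hH.isProbabilityMeasure
  have hcard : (0 : ℝ) < Fintype.card I := by exact_mod_cast Fintype.card_pos
  have hHi : ∀ i, Integrable (H i) P := fun i => (hH.eval i).integrable
  set a₀ : ℝ := -Real.log (Fintype.card I) with ha₀
  have hsymm : ∀ i j, C i j = C j i := fun i j => by
    rw [← hC, ← hC]; simp only [mul_comm]
  -- The drift −s²N/2 cancels the diagonal part of `overlapTerm`, leaving A' = −sD with D the mean
  -- overlap of two replicas.
  set y : ℝ → Ω → I → ℝ := hamiltonian H (fun _ => a₀) (fun _ => -N / 2) with hy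
  set A : ℝ → ℝ := fun s => ∫ ω, lse (y s ω) ∂P with hA
  set D : ℝ → ℝ := fun s => ∫ ω, ∑ j, gibbs (y s ω) j * ∑ k, gibbs (y s ω) k * C j k ∂P with hD
  have hA' : ∀ s, HasDerivAt A (-(s * D s)) s := fun s => by
    refine (hasDerivAt_freeEnergy hH h0 hC _ _ s).congr_deriv ?_
    rw [hD, ← mul_neg, ← integral_neg]
    congr 2
    ext ω
    simp only [overlapTerm, hN, hy]
    have : ∀ x : ℝ, x * (2 * (-N / 2) + N) = 0 := fun x => by ring
    simp [this]
  set X : I × I → Ω → ℝ := fun q ω => H q.1 ω + H q.2 ω with hX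
  have hXg : HasGaussianLaw (fun ω q => X q ω) P :=
    hH.map_fun (ContinuousLinearMap.pi fun q : I × I =>
      ContinuousLinearMap.proj (R := ℝ) (φ := fun _ : I => ℝ) q.1 + ContinuousLinearMap.proj q.2)
  have hX0 : ∀ q, ∫ ω, X q ω ∂P = 0 := fun q => by
    simp only [hX]
    rw [integral_add (hHi _) (hHi _), h0, h0, add_zero]
  set K : I × I → I × I → ℝ := fun q q' =>
    (C q.1 q'.1 + C q.1 q'.2) + (C q.2 q'.1 + C q.2 q'.2) with hK
  have hXK : ∀ q q', ∫ ω, X q ω * X q' ω ∂P = K q q' := fun q q' => by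
    have hi := integrable_mul_of_gaussian hH
    have : ∀ ω, X q ω * X q' ω = (H q.1 ω * H q'.1 ω + H q.1 ω * H q'.2 ω)
      + (H q.2 ω * H q'.1 ω + H q.2 ω * H q'.2 ω) := fun ω => by simp only [hX]; ring
    simp only [this]
    rw [integral_add (f := fun ω => H q.1 ω * H q'.1 ω + H q.1 ω * H q'.2 ω)
      (g := fun ω => H q.2 ω * H q'.1 ω + H q.2 ω * H q'.2 ω)
      ((hi _ _).add (hi _ _)) ((hi _ _).add (hi _ _)), integral_add (hi _ _) (hi _ _),
      integral_add (hi _ _) (hi _ _), hC, hC, hC, hC]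
  -- Replicas attract each other with strength 2C at s = 0. The coefficient b is minus half the
  -- variance 2N + 2C of the pair, so only the nonnegative covariances remain in B' and B decreases;
  -- an attraction (2 − s²)C ≥ C still survives on [0, 1].
  set a : I × I → ℝ := fun q => 2 * a₀ + 2 * C q.1 q.2 with ha
  set b : I × I → ℝ := fun q => -N - C q.1 q.2 with hb
  set B : ℝ → ℝ := fun s => ∫ ω, lse (hamiltonian X a b s ω) ∂P with hB
  have hB' : ∀ s, HasDerivAt B (s * ∫ ω, overlapTerm K b (hamiltonian X a b s ω) ∂P) s :=
    fun s => hasDerivAt_freeEnergy hXg hX0 hXK a b s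
  have hanti : AntitoneOn B (Set.Icc 0 1) := by
    refine antitoneOn_of_deriv_nonpos (convex_Icc 0 1)
      (fun s _ => (hB' s).continuousAt.continuousWithinAt)
      (fun s _ => (hB' s).differentiableAt.differentiableWithinAt) fun s hs => ?_
    rw [interior_Icc] at hs
    rw [(hB' s).deriv]
    refine mul_nonpos_of_nonneg_of_nonpos hs.1.le (integral_nonpos fun ω => ?_)
    have h1 : ∀ q, 2 * b q + K q q = 0 := fun q => by
      simp only [hb, hK, hN, hsymm q.2 q.1]; ring
    simp only [overlapTerm, h1, mul_zero, Finset.sum_const_zero, zero_sub, Pi.zero_apply,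
      neg_nonpos]
    refine Finset.sum_nonneg fun q _ => mul_nonneg (gibbs_nonneg _ _) (Finset.sum_nonneg
      fun q' _ => mul_nonneg (gibbs_nonneg _ _) ?_)
    exact add_nonneg (add_nonneg (hC0 _ _) (hC0 _ _)) (add_nonneg (hC0 _ _) (hC0 _ _))
  -- At s = 0 the pair Hamiltonian is deterministic, so B 0 is the logarithm of the exponential
  -- overlap moment.
  set C₀ : ℝ := Real.log ((∑ i, ∑ j, Real.exp (2 * C i j)) / (Fintype.card I : ℝ) ^ 2) / 2 with hC₀
  have hB0 : B 0 = 2 * C₀ := by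
    have h1 : ∀ ω, lse (hamiltonian X a b 0 ω) = 2 * C₀ := fun ω => by
      have hpos : 0 < ∑ i, ∑ j, Real.exp (2 * C i j) :=
        Finset.sum_pos (fun i _ => sum_exp_pos _) Finset.univ_nonempty
      have h2 : hamiltonian X a b 0 ω = fun q : I × I => 2 * C q.1 q.2 + 2 * a₀ := by
        ext q; simp [hamiltonian, ha]; ring
      rw [h2, lse_add_const, hC₀, lse, Fintype.sum_prod_type, Real.log_div hpos.ne' (by positivity),
        Real.log_pow, ha₀]
      push_cast
      ring
    simp [hB, h1]
  have hgc : ∀ s, Integrable (fun ω => ∑ j, gibbs (y s ω) j * ∑ k, gibbs (y s ω) k * C j k) P :=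
    fun s => integrable_bdd_gibbs hHi _ _ s (continuous_gibbs_sum_sum C) (abs_gibbs_sum_sum_le C)
  have hly : ∀ s, Integrable (fun ω => lse (y s ω)) P := fun s =>
    integrable_lse fun j => ((hHi j).const_mul s).add (integrable_const _)
  -- Jensen's inequality for the product Gibbs measure bounds the free energy of the pair with
  -- attraction C below by 2A + D; monotonicity of B bounds it above.
  have hlow : ∀ s ∈ Set.Icc (0 : ℝ) 1, 2 * A s + D s ≤ 2 * C₀ := fun s hs => by
    rw [← hB0]
    refine le_trans ?_ (hanti (Set.left_mem_Icc.2 zero_le_one) hs hs.1)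
    rw [hA, hD, ← integral_const_mul, ← integral_add ((hly s).const_mul 2) (hgc s)]
    refine integral_mono (((hly s).const_mul 2).add (hgc s)) (integrable_lse fun q =>
      ((hXg.eval q).integrable.const_mul s).add (integrable_const _)) fun ω => ?_
    have h1 := lse_add_ge (fun q : I × I => y s ω q.1 + y s ω q.2) (fun q => C q.1 q.2)
    rw [lse_pair] at h1
    simp only [gibbs_pair, Fintype.sum_prod_type] at h1
    have h2 : ∑ j, gibbs (y s ω) j * ∑ k, gibbs (y s ω) k * C j k
        = ∑ j, ∑ k, gibbs (y s ω) j * gibbs (y s ω) k * C j k := by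
      simp only [Finset.mul_sum, mul_assoc]
    simp only [h2]
    refine h1.trans (lse_mono fun q => ?_)
    simp only [hy, hamiltonian, ha, hb, hX]
    have h3 : 0 ≤ (1 - s ^ 2) * C q.1 q.2 := by
      refine mul_nonneg ?_ (hC0 _ _)
      nlinarith [hs.1, hs.2]
    nlinarith
  -- Gronwall argument for A' = −sD ≥ −s(2C₀ − 2A), with integrating factor exp(−s²). Comparing s =
  -- 0 and s = 1 yields A 1 ≥ −(e − 1)C₀.
  have hmono : MonotoneOn (fun s => Real.exp (-s ^ 2) * (A s - C₀)) (Set.Icc 0 1) := by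
    have hE : ∀ s, HasDerivAt (fun s => Real.exp (-s ^ 2) * (A s - C₀))
        (Real.exp (-s ^ 2) * (s * (2 * C₀ - (2 * A s + D s)))) s := fun s => by
      have h1 : HasDerivAt (fun s : ℝ => Real.exp (-s ^ 2)) _ s := ((hasDerivAt_pow 2 s).neg).exp
      refine (h1.mul ((hA' s).sub_const C₀)).congr_deriv ?_
      push_cast
      simp only [pow_one, Pi.neg_apply]
      ring
    refine monotoneOn_of_deriv_nonneg (convex_Icc 0 1)
      (fun s _ => (hE s).continuousAt.continuousWithinAt)
      (fun s _ => (hE s).differentiableAt.differentiableWithinAt) fun s hs => ?_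
    rw [interior_Icc] at hs
    rw [(hE s).deriv]
    exact mul_nonneg (Real.exp_pos _).le
      (mul_nonneg hs.1.le (sub_nonneg.2 (hlow s ⟨hs.1.le, hs.2.le⟩)))
  have hA0 : A 0 = 0 := by
    have h1 : ∀ ω, lse (y 0 ω) = 0 := fun ω => by
      have h2 : y 0 ω = fun _ : I => 0 + a₀ := by ext i; simp [hy, hamiltonian]
      rw [h2, lse_add_const, ha₀]
      simp [lse]
    simp [hA, h1]
  have hfin := hmono (Set.left_mem_Icc.2 zero_le_one) (Set.right_mem_Icc.2 zero_le_one) zero_le_one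
  simp only [hA0, ne_eq, OfNat.ofNat_ne_zero, not_false_eq_true, zero_pow, neg_zero, Real.exp_zero,
    one_mul, zero_sub, one_pow] at hfin
  have hA1 : A 1 = ∫ ω, lse (fun i => H i ω + (a₀ - N / 2)) ∂P := by
    simp only [hA, hy]
    congr 1
    ext ω
    congr 1
    ext i
    simp only [hamiltonian]
    ring
  rw [← hA1]
  have h2 := mul_le_mul_of_nonneg_left hfin (Real.exp_pos 1).le
  rw [← mul_assoc, ← Real.exp_add, add_neg_cancel, Real.exp_zero, one_mul] at h2
  have h3 : -((Real.exp 1 - 1) / 2) *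
      Real.log ((∑ i, ∑ j, Real.exp (2 * C i j)) / (Fintype.card I : ℝ) ^ 2)
      = -(Real.exp 1 * C₀) + C₀ := by rw [hC₀]; ring
  rw [h3]
  linarith

/-- The crude lower bound for the quenched free energy by Jensen's inequality. -/
theorem neg_half_variance_le_integral_lse [IsProbabilityMeasure P] {H : I → Ω → ℝ}
    (hH : ∀ i, Integrable (H i) P) (h0 : ∀ i, ∫ ω, H i ω ∂P = 0) (N : ℝ) :
    -(N / 2) ≤ ∫ ω, lse (fun i => H i ω + (-Real.log (Fintype.card I) - N / 2)) ∂P := by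
  set c : ℝ := -Real.log (Fintype.card I) - N / 2 with hc
  -- The Gibbs measure of a constant Hamiltonian is uniform; Jensen's inequality is applied to it.
  set g : I → ℝ := gibbs fun _ : I => c
  have h1 : ∫ ω, (-(N / 2) + ∑ i, g i * H i ω) ∂P = -(N / 2) := by
    rw [integral_add (integrable_const _) (integrable_finsetSum _ fun i _ => (hH i).const_mul _),
      integral_finsetSum _ fun i _ => (hH i).const_mul _]
    simp [integral_const_mul, h0]
  rw [← h1]
  refine integral_mono ((integrable_const _).add
    (integrable_finsetSum _ fun i _ => (hH i).const_mul _))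
    (integrable_lse fun i => (hH i).add (integrable_const _)) fun ω => ?_
  have h2 := lse_add_ge (fun _ : I => c) (fun i => H i ω)
  have h3 : lse (fun _ : I => c) = -(N / 2) := by
    have := lse_add_const (fun _ : I => (0 : ℝ)) c
    simp only [zero_add] at this
    rw [this, hc]
    simp [lse]
    ring
  rw [h3] at h2
  simpa only [add_comm c] using h2

end Replica

end KPZ

end

noncomputable section

namespace KPZ

/-! ### Random walks in a potential -/

section Walk

variable {G : Type*} [AddCommGroup G] {E : Type*} [Fintype E]

/-- The discrete evolution `u (k + 1) z = exp (f k z) * average of u k over the steps from z`. -/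
def evolution (f : ℕ → G → ℝ) (σ : E → G) : ℕ → G → ℝ
  | 0, _ => 1
  | k + 1, z => Real.exp (f k z) * ((∑ e, evolution f σ k (z + σ e)) / Fintype.card E)

/-- The potential collected along a walk from `z` with increments `σ (p i)`, run backwards in time
from time `n`. -/
def pathEnergy (f : ℕ → G → ℝ) (σ : E → G) : (n : ℕ) → (Fin n → E) → G → ℝ
  | 0, _, _ => 0
  | n + 1, p, z => f n z + pathEnergy f σ n (Fin.tail p) (z + σ (p 0))

theorem evolution_pos [Nonempty E] (f : ℕ → G → ℝ) (σ : E → G) (n : ℕ) (z : G) :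
    0 < evolution f σ n z := by
  induction n generalizing z with
  | zero => simp [evolution]
  | succ k ih =>
    rw [evolution]
    have : 0 < ∑ e, evolution f σ k (z + σ e) :=
      Finset.sum_pos (fun e _ => ih _) Finset.univ_nonempty
    have : (0 : ℝ) < Fintype.card E := by exact_mod_cast Fintype.card_pos
    positivity

/-- Discrete Feynman–Kac formula: unrolling the recursion chooses the steps of the path one at a
time. -/
theorem evolution_eq_sum (f : ℕ → G → ℝ) (σ : E → G) (n : ℕ) (z : G) :
    evolution f σ n z
      = (∑ p : Fin n → E, Real.exp (pathEnergy f σ n p z)) / (Fintype.card E : ℝ) ^ n := by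
  induction n generalizing z with
  | zero => simp [evolution, pathEnergy]
  | succ k ih =>
    have h1 : ∑ p : Fin (k + 1) → E, Real.exp (pathEnergy f σ (k + 1) p z)
        = ∑ e : E, ∑ p : Fin k → E, Real.exp (f k z) * Real.exp (pathEnergy f σ k p (z + σ e)) := by
      rw [← Fintype.sum_prod_type', ← (Fin.consEquiv fun _ : Fin (k + 1) => E).sum_comp]
      refine Finset.sum_congr rfl fun q _ => ?_
      rw [pathEnergy, Real.exp_add]
      simp [Fin.consEquiv]
    rw [evolution, h1]
    simp only [ih, ← Finset.mul_sum, ← Finset.sum_div]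
    rw [pow_succ]
    ring

/-- The truncated Green function `∑ j < k, Qʲ V` of the walk. -/
def green (V : G → ℝ) (τ : E → G) : ℕ → G → ℝ
  | 0, _ => 0
  | k + 1, y => V y + (∑ e, green V τ k (y + τ e)) / Fintype.card E

theorem green_nonneg {V : G → ℝ} (hV : ∀ y, 0 ≤ V y) (τ : E → G) (k : ℕ) (y : G) :
    0 ≤ green V τ k y := by
  induction k generalizing y with
  | zero => exact le_rfl
  | succ k ih =>
    rw [green]
    have := Finset.sum_nonneg fun e (_ : e ∈ (Finset.univ : Finset E)) => ih (y + τ e)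
    have := hV y
    positivity

/-- A potential with small Green function has bounded exponential moments along the walk. -/
theorem evolution_le_two [Nonempty E] {V : G → ℝ} (hV : ∀ y, 0 ≤ V y) (τ : E → G) {a : ℝ}
    (ha : 0 ≤ a) (haV : ∀ y, a * V y ≤ 1) {n : ℕ}
    (hg : ∀ k ≤ n, ∀ y, 4 * a * green V τ k y ≤ 1) (y : G) :
    evolution (fun _ y => a * V y) τ n y ≤ 2 := by
  have hcard : (0 : ℝ) < Fintype.card E := by exact_mod_cast Fintype.card_pos
  -- Khas'minskii's argument. With v = aV ≤ 1 and q the averaged Green function, exp v ≤ 1 + 2v and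
  -- 4aq ≤ 1, so (1 + 2v)(1 + 4aq) ≤ 1 + 4v + 4aq, which closes the induction.
  have key : ∀ k ≤ n, ∀ y, evolution (fun _ y => a * V y) τ k y ≤ 1 + 4 * a * green V τ k y := by
    intro k
    induction k with
    | zero => intro _ y; simp [evolution, green]
    | succ k ih =>
      intro hk y
      have ih' := ih (Nat.le_of_succ_le hk)
      set q : ℝ := (∑ e, green V τ k (y + τ e)) / Fintype.card E with hq
      have hq0 : 0 ≤ q :=
        div_nonneg (Finset.sum_nonneg fun e _ => green_nonneg hV τ k _) hcard.le
      have hsum : (∑ e, evolution (fun _ y => a * V y) τ k (y + τ e)) / Fintype.card E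
          ≤ 1 + 4 * a * q := by
        rw [div_le_iff₀ hcard]
        refine (Finset.sum_le_sum fun e _ => ih' (y + τ e)).trans_eq ?_
        rw [Finset.sum_add_distrib, ← Finset.mul_sum, hq]
        simp only [Finset.sum_const, Finset.card_univ, nsmul_eq_mul, mul_one]
        field_simp
      have hq1 : 4 * a * q ≤ 1 := by
        rw [hq, mul_div_assoc', div_le_iff₀ hcard, Finset.mul_sum]
        refine (Finset.sum_le_sum fun e _ => hg k (Nat.le_of_succ_le hk) (y + τ e)).trans_eq ?_
        simp
      have hv : 0 ≤ a * V y := mul_nonneg ha (hV y)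
      have hexp : Real.exp (a * V y) ≤ 1 + 2 * (a * V y) := by
        have h1 := Real.abs_exp_sub_one_le (x := a * V y) (by rw [abs_of_nonneg hv]; exact haV y)
        rw [abs_of_nonneg hv] at h1
        linarith [(abs_le.1 h1).2]
      rw [evolution, green, ← hq]
      calc _ ≤ (1 + 2 * (a * V y)) * (1 + 4 * a * q) :=
            mul_le_mul hexp hsum (div_nonneg (Finset.sum_nonneg fun e _ =>
              (evolution_pos _ τ k _).le) hcard.le) (by positivity)
        _ ≤ 1 + 4 * a * (V y + q) := by nlinarith
  exact (key n le_rfl y).trans (by linarith [hg n le_rfl y])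

/-- A pair of walks is one walk with paired steps, so the exponential overlap moment is itself a
Feynman–Kac average for the difference walk, with a deterministic potential. -/
theorem sum_pair_exp_pathEnergy (V : G → ℝ) (σ : E → G) (n : ℕ) (c : ℝ) :
    (∑ p : Fin n → E, ∑ p' : Fin n → E, Real.exp (2 * pathEnergy (fun _ y => c * V y)
        (fun q : E × E => σ q.1 - σ q.2) n (fun i => (p i, p' i)) 0)) /
          (Fintype.card (Fin n → E) : ℝ) ^ 2
      = evolution (fun _ y => 2 * c * V y) (fun q : E × E => σ q.1 - σ q.2) n 0 := by
  have hmul : ∀ (n : ℕ) (p : Fin n → E × E) (z : G), 2 * pathEnergy (fun _ y => c * V y)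
      (fun q : E × E => σ q.1 - σ q.2) n p z = pathEnergy (fun _ y => 2 * c * V y)
      (fun q : E × E => σ q.1 - σ q.2) n p z := by
    intro n
    induction n with
    | zero => intro p z; simp [pathEnergy]
    | succ k ih => intro p z; rw [pathEnergy, pathEnergy, mul_add, ih]; ring
  rw [evolution_eq_sum, ← Fintype.sum_prod_type', ← (Equiv.arrowProdEquivProdArrow (Fin n)
    (fun _ => E) (fun _ => E)).sum_comp]
  simp only [hmul]
  congr 1
  rw [Fintype.card_fun, Fintype.card_prod, Fintype.card_fin]
  push_cast
  ring

end Walk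

end KPZ

end

noncomputable section

namespace KPZ

/-! ### The Green function of the difference of two random walks -/

/-- The sign `±1` encoded by a Boolean. -/
def sgn (b : Bool) : ℝ := if b then 1 else -1

/-- The steps `(±r, ±r)` of the random walk in the plane. -/
def step (r : ℝ) (e : Bool × Bool) : Plane := !₂[r * sgn e.1, r * sgn e.2]

/-- The phase `2π ⟨m, y⟩`. -/
def phase (m : Fin 2 → ℤ) (y : Plane) : ℝ := 2 * Real.pi * (m 0 * y 0 + m 1 * y 1)

/-- The characteristic function of one step of the difference of two independent walks. -/
def stepChar (r : ℝ) (m : Fin 2 → ℤ) : ℝ :=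
  Real.cos (2 * Real.pi * m 0 * r) ^ 2 * Real.cos (2 * Real.pi * m 1 * r) ^ 2

theorem stepChar_nonneg (r : ℝ) (m : Fin 2 → ℤ) : 0 ≤ stepChar r m := by
  unfold stepChar; positivity

theorem stepChar_le_one (r : ℝ) (m : Fin 2 → ℤ) : stepChar r m ≤ 1 :=
  mul_le_one₀ (Real.cos_sq_le_one _) (sq_nonneg _) (Real.cos_sq_le_one _)

/-- The step law of the difference walk is symmetric, so cosines are eigenfunctions of its
transition operator. -/
theorem sum_cos_phase_step (r : ℝ) (m : Fin 2 → ℤ) (y : Plane) :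
    (∑ q : (Bool × Bool) × (Bool × Bool), Real.cos (phase m (y + (step r q.1 - step r q.2)))) /
        Fintype.card ((Bool × Bool) × (Bool × Bool))
      = stepChar r m * Real.cos (phase m y) := by
  set α : ℝ := 2 * Real.pi * m 0 * r with hα
  set β : ℝ := 2 * Real.pi * m 1 * r with hβ
  have h : ∀ q : (Bool × Bool) × (Bool × Bool), phase m (y + (step r q.1 - step r q.2))
      = phase m y + (α * (sgn q.1.1 - sgn q.2.1)) + (β * (sgn q.1.2 - sgn q.2.2)) := fun q => by
    simp [phase, step, hα, hβ]; ring
  simp only [h, Fintype.sum_prod_type, Fintype.sum_bool, sgn, Fintype.card_prod, Fintype.card_bool]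
  simp only [if_true, Bool.false_eq_true, if_false, sub_self, mul_zero, add_zero]
  have e1 : (1 : ℝ) - -1 = 2 := by norm_num
  have e2 : (-1 : ℝ) - 1 = -2 := by norm_num
  simp only [e1, e2, mul_neg]
  rw [stepChar, ← hα, ← hβ, mul_comm α 2, mul_comm β 2]
  simp only [Real.cos_add, Real.sin_add, Real.cos_neg, Real.sin_neg, Real.cos_two_mul]
  push_cast
  ring

section Series

variable {A : (Fin 2 → ℤ) → ℝ} {V : Plane → ℝ}

/-- Each application of the transition operator multiplies the m-th mode by `stepChar r m`, so the
Green function carries a geometric sum in every mode. -/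
theorem hasSum_green (hV : ∀ y, HasSum (fun m => A m * Real.cos (phase m y)) (V y)) (r : ℝ) (k : ℕ)
    (y : Plane) :
    HasSum (fun m => A m * (∑ j ∈ Finset.range k, stepChar r m ^ j) * Real.cos (phase m y))
      (green V (fun q : (Bool × Bool) × (Bool × Bool) => step r q.1 - step r q.2) k y) := by
  induction k generalizing y with
  | zero => simp [green]
  | succ k ih =>
    rw [green]
    have h1 := (hasSum_sum fun (q : (Bool × Bool) × (Bool × Bool)) (_ : q ∈ Finset.univ) =>
      ih (y + (step r q.1 - step r q.2))).div_const
        (Fintype.card ((Bool × Bool) × (Bool × Bool)) : ℝ)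
    refine ((hV y).add h1).congr_fun fun m => ?_
    rw [← Finset.mul_sum, mul_div_assoc, sum_cos_phase_step, Finset.sum_range_succ']
    simp only [pow_succ, ← Finset.sum_mul]
    ring

theorem green_le_tsum (hA : ∀ m, 0 ≤ A m) (hs : Summable A)
    (hV : ∀ y, HasSum (fun m => A m * Real.cos (phase m y)) (V y)) (r : ℝ) {k n : ℕ} (hk : k ≤ n)
    (y : Plane) :
    green V (fun q : (Bool × Bool) × (Bool × Bool) => step r q.1 - step r q.2) k y
      ≤ ∑' m, A m * ∑ j ∈ Finset.range n, stepChar r m ^ j := by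
  have hsum : Summable fun m => A m * ∑ j ∈ Finset.range n, stepChar r m ^ j := by
    refine Summable.of_nonneg_of_le (fun m => mul_nonneg (hA m)
      (Finset.sum_nonneg fun j _ => pow_nonneg (stepChar_nonneg r m) j)) (fun m => ?_)
      (hs.mul_right (n : ℝ))
    refine mul_le_mul_of_nonneg_left ?_ (hA m)
    refine (Finset.sum_le_sum fun j _ => pow_le_one₀ (stepChar_nonneg r m)
      (stepChar_le_one r m)).trans_eq (by simp)
  refine hasSum_le (fun m => ?_) (hasSum_green hV r k y) hsum.hasSum
  have h1 : ∑ j ∈ Finset.range k, stepChar r m ^ j ≤ ∑ j ∈ Finset.range n, stepChar r m ^ j :=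
    Finset.sum_le_sum_of_subset_of_nonneg (Finset.range_mono hk)
      fun j _ _ => pow_nonneg (stepChar_nonneg r m) j
  have h0 : 0 ≤ ∑ j ∈ Finset.range k, stepChar r m ^ j :=
    Finset.sum_nonneg fun j _ => pow_nonneg (stepChar_nonneg r m) j
  calc _ ≤ A m * (∑ j ∈ Finset.range k, stepChar r m ^ j) * 1 :=
        mul_le_mul_of_nonneg_left (Real.cos_le_one _) (mul_nonneg (hA m) h0)
    _ ≤ _ := by rw [mul_one]; exact mul_le_mul_of_nonneg_left h1 (hA m)

/-- Under diffusive scaling the symbol of the difference walk tends to that of −Δ. -/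
theorem tendsto_one_sub_stepChar (m : Fin 2 → ℤ) :
    Filter.Tendsto (fun r => (1 - stepChar r m) / r ^ 2) (nhdsWithin 0 {0}ᶜ)
      (nhds (4 * Real.pi ^ 2 * ((m 0 : ℝ) ^ 2 + (m 1 : ℝ) ^ 2))) := by
  have hsin : ∀ c : ℝ, Filter.Tendsto (fun r => Real.sin (c * r) / r) (nhdsWithin 0 {0}ᶜ)
      (nhds c) := fun c => by
    have h1 : HasDerivAt (fun r : ℝ => Real.sin (c * r)) c 0 := by
      have := ((hasDerivAt_id (0 : ℝ)).const_mul c).sin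
      simpa using this
    refine h1.tendsto_slope_zero.congr fun r => ?_
    simp [div_eq_inv_mul]
  have hcos : Filter.Tendsto (fun r => Real.cos (2 * Real.pi * m 0 * r)) (nhdsWithin 0 {0}ᶜ)
      (nhds 1) := by
    have : Continuous fun r : ℝ => Real.cos (2 * Real.pi * m 0 * r) := by fun_prop
    simpa using (this.tendsto 0).mono_left nhdsWithin_le_nhds
  have h := ((hsin (2 * Real.pi * m 0)).pow 2).add ((hcos.pow 2).mul
    ((hsin (2 * Real.pi * m 1)).pow 2))
  have e : (2 * Real.pi * m 0) ^ 2 + 1 ^ 2 * (2 * Real.pi * m 1) ^ 2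
      = 4 * Real.pi ^ 2 * ((m 0 : ℝ) ^ 2 + (m 1 : ℝ) ^ 2) := by ring
  rw [e] at h
  refine h.congr fun r => ?_
  rw [stepChar, div_pow, div_pow, ← mul_div_assoc, ← add_div, Real.sin_sq, Real.sin_sq]
  ring

/-- The geometric sum S satisfies both S ≤ n and S(1 − φ) ≤ 1; adding the two bounds gives the
constant 2 and a denominator that stays positive at φ = 1. -/
theorem geom_le {δ t φ : ℝ} {n : ℕ} (hδ : 0 < δ) (ht : 0 < t) (hn : δ * n = t) (h0 : 0 ≤ φ)
    (h1 : φ ≤ 1) :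
    δ * ∑ j ∈ Finset.range n, φ ^ j ≤ 2 / (1 / t + (1 - φ) / δ) := by
  set S := ∑ j ∈ Finset.range n, φ ^ j with hS
  have hS1 : S ≤ n := (Finset.sum_le_sum fun j _ => pow_le_one₀ h0 h1).trans_eq (by simp)
  have hS2 : S * (1 - φ) ≤ 1 := by
    rw [hS, geom_sum_mul_neg]
    linarith [pow_nonneg h0 n]
  have hd : 0 < 1 / t + (1 - φ) / δ :=
    add_pos_of_pos_of_nonneg (by positivity) (div_nonneg (by linarith) hδ.le)
  rw [le_div_iff₀ hd]
  have e : δ * S * (1 / t + (1 - φ) / δ) = δ * S / t + S * (1 - φ) := by field_simp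
  rw [e]
  have : δ * S / t ≤ 1 := by
    rw [div_le_one ht, ← hn]
    exact mul_le_mul_of_nonneg_left hS1 hδ.le
  linarith

/-- Dominated convergence in the mode sum, with majorant 2t · A m, passes to the continuum symbol;
the summand 1 is the room needed for the bound to hold eventually. -/
theorem eventually_tsum_le (hA : ∀ m, 0 ≤ A m) (hs : Summable A) {t : ℝ} (ht : 0 < t) :
    ∀ᶠ n : ℕ in Filter.atTop, t / n * ∑' m, A m * ∑ j ∈ Finset.range n, stepChar √(t / n) m ^ j
      ≤ 1 + ∑' m, A m * (2 / (1 / t + 4 * Real.pi ^ 2 * ((m 0 : ℝ) ^ 2 + (m 1 : ℝ) ^ 2))) := by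
  have hr : Filter.Tendsto (fun n : ℕ => √(t / n)) Filter.atTop (nhdsWithin 0 {0}ᶜ) := by
    refine tendsto_nhdsWithin_iff.2 ⟨?_, ?_⟩
    · have := (Real.continuous_sqrt.tendsto 0).comp (tendsto_const_div_atTop_nhds_zero_nat t)
      rwa [Real.sqrt_zero] at this
    · filter_upwards [Filter.eventually_gt_atTop 0] with n hn
      have : (0 : ℝ) < n := by exact_mod_cast hn
      exact (Real.sqrt_pos.2 (by positivity)).ne'
  have hden : ∀ (n : ℕ) m, 0 ≤ (1 - stepChar √(t / n) m) / √(t / n) ^ 2 := fun n m =>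
    div_nonneg (sub_nonneg.2 (stepChar_le_one _ _)) (sq_nonneg _)
  have hF0 : ∀ (n : ℕ) m, 0 ≤ 2 / (1 / t + (1 - stepChar √(t / n) m) / √(t / n) ^ 2) :=
    fun n m => by have := hden n m; positivity
  have hF1 : ∀ (n : ℕ) m, 2 / (1 / t + (1 - stepChar √(t / n) m) / √(t / n) ^ 2) ≤ 2 * t :=
    fun n m => by
      have h1 : 1 / t ≤ 1 / t + (1 - stepChar √(t / n) m) / √(t / n) ^ 2 := by
        linarith [hden n m]
      refine (div_le_div_of_nonneg_left zero_le_two (by positivity) h1).trans_eq ?_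
      field_simp
  have hlim := tendsto_tsum_of_dominated_convergence (𝓕 := Filter.atTop)
    (f := fun (n : ℕ) m => A m * (2 / (1 / t + (1 - stepChar √(t / n) m) / √(t / n) ^ 2)))
    (g := fun m => A m * (2 / (1 / t + 4 * Real.pi ^ 2 * ((m 0 : ℝ) ^ 2 + (m 1 : ℝ) ^ 2))))
    (bound := fun m => A m * (2 * t)) (hs.mul_right _)
    (fun m => by
      refine Filter.Tendsto.const_mul _ (Filter.Tendsto.div tendsto_const_nhds
        (((tendsto_one_sub_stepChar m).comp hr).const_add _) ?_)
      positivity)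
    (Filter.Eventually.of_forall fun n m => by
      rw [Real.norm_eq_abs, abs_of_nonneg (mul_nonneg (hA m) (hF0 n m))]
      exact mul_le_mul_of_nonneg_left (hF1 n m) (hA m))
  have hev := hlim.eventually (eventually_le_nhds (lt_one_add _))
  filter_upwards [hev, Filter.eventually_gt_atTop 0] with n hn hn0
  refine le_trans ?_ hn
  have hn' : (0 : ℝ) < n := by exact_mod_cast hn0
  have hδ : 0 < t / n := by positivity
  rw [← tsum_mul_left]
  have hle : ∀ m, t / n * (A m * ∑ j ∈ Finset.range n, stepChar √(t / n) m ^ j)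
      ≤ A m * (2 / (1 / t + (1 - stepChar √(t / n) m) / √(t / n) ^ 2)) := fun m => by
    rw [Real.sq_sqrt hδ.le, mul_left_comm]
    exact mul_le_mul_of_nonneg_left (geom_le hδ ht (by field_simp) (stepChar_nonneg _ _)
      (stepChar_le_one _ _)) (hA m)
  have hsR : Summable fun m => A m * (2 / (1 / t + (1 - stepChar √(t / n) m) / √(t / n) ^ 2)) :=
    Summable.of_nonneg_of_le (fun m => mul_nonneg (hA m) (hF0 n m))
      (fun m => mul_le_mul_of_nonneg_left (hF1 n m) (hA m)) (hs.mul_right (2 * t))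
  refine Summable.tsum_le_tsum hle (Summable.of_nonneg_of_le (fun m => ?_) hle hsR) hsR
  exact mul_nonneg hδ.le (mul_nonneg (hA m)
    (Finset.sum_nonneg fun j _ => pow_nonneg (stepChar_nonneg _ m) j))

/-- The frequencies `m` with `|m|_∞ ≤ N`. -/
def freqBox (N : ℕ) : Finset (Fin 2 → ℤ) :=
  ((Finset.range (N + 1)).biUnion fun k => Finset.box k).map (finTwoArrowEquiv ℤ).symm.toEmbedding

theorem mem_freqBox {N : ℕ} {m : Fin 2 → ℤ} :
    m ∈ freqBox N ↔ max (m 0).natAbs (m 1).natAbs ≤ N := by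
  rw [freqBox, Finset.mem_map_equiv]
  simp only [Finset.mem_biUnion, Finset.mem_range, Int.mem_box, Nat.lt_succ_iff, Equiv.symm_symm]
  constructor
  · rintro ⟨k, hk, h⟩
    simp only [finTwoArrowEquiv_apply] at h
    exact h ▸ hk
  · intro h
    exact ⟨_, h, rfl⟩

theorem sq_max_le (m : Fin 2 → ℤ) :
    ((max (m 0).natAbs (m 1).natAbs : ℕ) : ℝ) ^ 2 ≤ (m 0 : ℝ) ^ 2 + (m 1 : ℝ) ^ 2 := by
  have h : ∀ a : ℤ, ((a.natAbs : ℕ) : ℝ) ^ 2 = (a : ℝ) ^ 2 := fun a => by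
    rw [Nat.cast_natAbs, Int.cast_abs, sq_abs]
  rcases max_choice (m 0).natAbs (m 1).natAbs with h1 | h1 <;> rw [h1, h]
  · linarith [sq_nonneg (m 1 : ℝ)]
  · linarith [sq_nonneg (m 0 : ℝ)]

/-- The square shell of radius k has 8k points, each contributing at most 2/(4π²k²), so the shells
sum to a harmonic series: the two-dimensional logarithm. The mode m = 0 gives 2t. -/
theorem sum_freqBox_le {t : ℝ} (ht : 0 < t) (N : ℕ) :
    ∑ m ∈ freqBox N, 2 / (1 / t + 4 * Real.pi ^ 2 * ((m 0 : ℝ) ^ 2 + (m 1 : ℝ) ^ 2))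
      ≤ 2 * t + 4 / Real.pi ^ 2 * (1 + Real.log N) := by
  have hdisj : Set.PairwiseDisjoint (Finset.range (N + 1) : Set ℕ)
      fun k => (Finset.box k : Finset (ℤ × ℤ)) := by
    intro k _ l _ hkl
    refine Finset.disjoint_left.2 fun x hx hx' => hkl ?_
    rw [Int.mem_box] at hx hx'
    exact hx.symm.trans hx'
  rw [freqBox, Finset.sum_map, Finset.sum_biUnion hdisj, Finset.sum_range_succ', add_comm]
  refine add_le_add ?_ ?_
  · simp [finTwoArrowEquiv]
  · have h1 : ∀ k ∈ Finset.range N, ∑ x ∈ (Finset.box (k + 1) : Finset (ℤ × ℤ)),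
        2 / (1 / t + 4 * Real.pi ^ 2 * ((((finTwoArrowEquiv ℤ).symm x 0 : ℤ) : ℝ) ^ 2
          + (((finTwoArrowEquiv ℤ).symm x 1 : ℤ) : ℝ) ^ 2))
        ≤ 4 / Real.pi ^ 2 * ((k + 1 : ℕ) : ℝ)⁻¹ := fun k _ => by
      have h2 : ∀ x ∈ (Finset.box (k + 1) : Finset (ℤ × ℤ)),
          2 / (1 / t + 4 * Real.pi ^ 2 * ((((finTwoArrowEquiv ℤ).symm x 0 : ℤ) : ℝ) ^ 2
            + (((finTwoArrowEquiv ℤ).symm x 1 : ℤ) : ℝ) ^ 2))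
          ≤ 2 / (4 * Real.pi ^ 2 * ((k + 1 : ℕ) : ℝ) ^ 2) := fun x hx => by
        have h3 := sq_max_le ((finTwoArrowEquiv ℤ).symm x)
        rw [Int.mem_box] at hx
        have h4 : max ((finTwoArrowEquiv ℤ).symm x 0).natAbs
          ((finTwoArrowEquiv ℤ).symm x 1).natAbs = k + 1 := hx
        rw [h4] at h3
        have h5 : 0 < 1 / t := by positivity
        refine div_le_div_of_nonneg_left zero_le_two (by positivity) ?_
        have := mul_le_mul_of_nonneg_left h3 (by positivity : 0 ≤ 4 * Real.pi ^ 2)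
        linarith
      refine (Finset.sum_le_card_nsmul _ _ _ h2).trans_eq ?_
      rw [Int.card_box k.succ_ne_zero, nsmul_eq_mul]
      push_cast
      field_simp
      ring
    refine (Finset.sum_le_sum h1).trans ?_
    rw [← Finset.mul_sum]
    refine mul_le_mul_of_nonneg_left ?_ (by positivity)
    have h2 := harmonic_le_one_add_log N
    rw [harmonic] at h2
    push_cast at h2 ⊢
    exact h2

/-- Low modes use A ≤ 1 and produce the logarithm; high modes use decay of the kernel beyond N and
the total mass R of A. -/
theorem tsum_le_log (hA : ∀ m, 0 ≤ A m) (hA1 : ∀ m, A m ≤ 1) {R : ℝ} (hs : HasSum A R) {t : ℝ}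
    (ht : 0 < t) {N : ℕ} (hN : 0 < N) :
    ∑' m, A m * (2 / (1 / t + 4 * Real.pi ^ 2 * ((m 0 : ℝ) ^ 2 + (m 1 : ℝ) ^ 2)))
      ≤ 2 * t + 4 / Real.pi ^ 2 * (1 + Real.log N) + R / N ^ 2 := by
  have hN' : (0 : ℝ) < N := by exact_mod_cast hN
  set g : (Fin 2 → ℤ) → ℝ :=
    fun m => 2 / (1 / t + 4 * Real.pi ^ 2 * ((m 0 : ℝ) ^ 2 + (m 1 : ℝ) ^ 2)) with hg
  have hg0 : ∀ m, 0 ≤ g m := fun m => by rw [hg]; positivity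
  have hle : ∀ m, A m * g m ≤ (if m ∈ freqBox N then g m else 0) + A m / N ^ 2 := fun m => by
    have hAN : 0 ≤ A m / N ^ 2 := div_nonneg (hA m) (by positivity)
    split_ifs with hm
    · linarith [mul_le_of_le_one_left (hg0 m) (hA1 m)]
    · rw [zero_add, div_eq_mul_inv]
      refine mul_le_mul_of_nonneg_left ?_ (hA m)
      rw [mem_freqBox, not_le] at hm
      have h1 : (N : ℝ) ^ 2 ≤ (m 0 : ℝ) ^ 2 + (m 1 : ℝ) ^ 2 := by
        refine le_trans ?_ (sq_max_le m)
        have : (N : ℝ) ≤ ((max (m 0).natAbs (m 1).natAbs : ℕ) : ℝ) := by exact_mod_cast hm.le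
        gcongr
      rw [hg, ← one_div, div_le_div_iff₀ (by positivity) (by positivity)]
      have h2 : 0 < 1 / t := by positivity
      have h3 : 1 ≤ Real.pi ^ 2 := by nlinarith [Real.pi_gt_three]
      have h4 := mul_le_mul h3 h1 (by positivity) (by positivity)
      nlinarith [sq_nonneg (N : ℝ)]
  have hbox : HasSum (fun m => if m ∈ freqBox N then g m else 0) (∑ m ∈ freqBox N, g m) := by
    have : HasSum (fun m => if m ∈ freqBox N then g m else 0)
        (∑ m ∈ freqBox N, if m ∈ freqBox N then g m else 0) :=
      hasSum_sum_of_ne_finset_zero fun m hm => if_neg hm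
    rwa [Finset.sum_congr rfl fun m hm => if_pos hm] at this
  have hR := hbox.add (hs.div_const ((N : ℝ) ^ 2))
  have hL : Summable fun m => A m * g m :=
    Summable.of_nonneg_of_le (fun m => mul_nonneg (hA m) (hg0 m)) hle hR.summable
  exact (hasSum_le hle hL.hasSum hR).trans (add_le_add_left (sum_freqBox_le ht N) _)

/-- The Green function of the difference of two walks grows at most logarithmically in the
frequency cutoff. -/
theorem eventually_green_le (hA : ∀ m, 0 ≤ A m) (hA1 : ∀ m, A m ≤ 1) {R : ℝ} (hs : HasSum A R)
    (hV : ∀ y, HasSum (fun m => A m * Real.cos (phase m y)) (V y)) {t : ℝ} (ht : 0 < t) {N : ℕ}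
    (hN : 0 < N) :
    ∀ᶠ n : ℕ in Filter.atTop, ∀ k ≤ n, ∀ y, t / n * green V
        (fun q : (Bool × Bool) × (Bool × Bool) => step √(t / n) q.1 - step √(t / n) q.2) k y
      ≤ 1 + (2 * t + 4 / Real.pi ^ 2 * (1 + Real.log N) + R / N ^ 2) := by
  filter_upwards [eventually_tsum_le hA hs.summable ht] with n hn k hk y
  refine le_trans ?_ (hn.trans (add_le_add_right (tsum_le_log hA hA1 hs ht hN) _))
  exact mul_le_mul_of_nonneg_left (green_le_tsum hA hs.summable hV _ hk y) (by positivity)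

end Series

end KPZ

end

noncomputable section

namespace KPZ

/-! ### Correlations of the mollified noise -/

theorem cellRep_coe {x : Fin 2 → ℝ} (hx : ∀ i, x i ∈ Set.Ioc (-1 / 2 : ℝ) (-1 / 2 + 1)) :
    cellRep (fun i => (x i : UnitAddCircle)) = WithLp.toLp 2 x := by
  unfold cellRep
  congr 1
  ext i
  exact AddCircle.equivIoc_coe_of_mem (hx i)

/-- The product of the normalised Haar measures on the two circles. -/
def torusHaar : Measure Torus := Measure.pi fun _ => AddCircle.haarAddCircle

theorem volume_torus : (volume : Measure Torus) = torusHaar := by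
  rw [volume_pi, torusHaar]
  congr 1
  ext1 i
  rw [AddCircle.volume_eq_smul_haarAddCircle]
  simp

theorem integral_torus (f : Torus → ℝ) (a : ℝ) :
    ∫ y : Torus, f y = ∫ x in {x : Fin 2 → ℝ | ∀ i, x i ∈ Set.Ioc a (a + 1)}, f (fun i => x i) := by
  rw [volume_torus]
  exact UnitAddTorus.integral_preimage f fun _ => a

/-- Parseval's identity, moved from L² classes to functions and from Haar measure to `volume`. -/
theorem hasSum_fourier_torus {f g : Torus → ℂ} (hf : MemLp f 2 volume) (hg : MemLp g 2 volume) :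
    HasSum (fun m => (starRingEnd ℂ) (∫ t, UnitAddTorus.mFourier (-m) t * f t)
      * (∫ t, UnitAddTorus.mFourier (-m) t * g t)) (∫ t, (starRingEnd ℂ) (f t) * g t) := by
  rw [volume_torus] at *
  have h : HasSum (fun m => (starRingEnd ℂ)
      (∫ t, UnitAddTorus.mFourier (-m) t * hf.toLp f t ∂torusHaar)
      * (∫ t, UnitAddTorus.mFourier (-m) t * hg.toLp g t ∂torusHaar))
      (∫ t, (starRingEnd ℂ) (hf.toLp f t) * hg.toLp g t ∂torusHaar) :=
    UnitAddTorus.hasSum_prod_mFourierCoeff (hf.toLp f) (hg.toLp g)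
  have hint : (∫ t, (starRingEnd ℂ) (hf.toLp f t) * hg.toLp g t ∂torusHaar)
      = ∫ t, (starRingEnd ℂ) (f t) * g t ∂torusHaar := by
    refine integral_congr_ae ?_
    filter_upwards [hf.coeFn_toLp, hg.coeFn_toLp] with t h1 h2
    rw [h1, h2]
  rw [hint] at h
  have hc : ∀ {f : Torus → ℂ} (hf : MemLp f 2 torusHaar) (m : Fin 2 → ℤ),
      ∫ t, UnitAddTorus.mFourier (-m) t * hf.toLp f t ∂torusHaar
        = ∫ t, UnitAddTorus.mFourier (-m) t * f t ∂torusHaar := fun hf m => by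
    refine integral_congr_ae ?_
    filter_upwards [hf.coeFn_toLp] with t h1
    rw [h1]
  simpa only [hc] using h

instance : (volume : Measure UnitAddCircle).IsNegInvariant := inferInstance

instance : (volume : Measure Torus).IsNegInvariant := inferInstance

/-- A function vanishing off the fundamental cell has the same integral on the torus and on the
plane. -/
theorem integral_comp_cellRep {F : Plane → ℝ}
    (hF : ∀ x, F x ≠ 0 → ∀ i, x i ∈ Set.Ioc (-1 / 2 : ℝ) (-1 / 2 + 1)) :
    ∫ y : Torus, F (cellRep y) = ∫ x, F x := by
  rw [integral_torus (fun y => F (cellRep y)) (-1 / 2)]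
  have hms : MeasurableSet {x : Fin 2 → ℝ | ∀ i, x i ∈ Set.Ioc (-1 / 2 : ℝ) (-1 / 2 + 1)} :=
    MeasurableSet.univ_pi' fun i => measurableSet_Ioc
  rw [setIntegral_congr_fun hms (g := fun x => F (WithLp.toLp 2 x))
    fun x hx => by simp only [cellRep_coe hx]]
  rw [setIntegral_eq_integral_of_forall_compl_eq_zero fun x hx => by
    by_contra h
    exact hx fun i => hF _ h i]
  exact (PiLp.volume_preserving_toLp (Fin 2)).integral_comp
    (MeasurableEquiv.toLp 2 (Fin 2 → ℝ)).measurableEmbedding F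

variable (ρ : Mollifier) {ε : ℝ}

theorem Mollifier.mem_cell_of_scaled_ne_zero (hε : ε ∈ Set.Ioo (0 : ℝ) 1) {x : Plane}
    (hx : ρ.scaled ε x ≠ 0) (i : Fin 2) : x i ∈ Set.Ioc (-1 / 2 : ℝ) (-1 / 2 + 1) := by
  have h1 : ρ.toFun (ε⁻¹ • x) ≠ 0 := fun h => hx (by rw [Mollifier.scaled, h, mul_zero])
  have h2 := ρ.support_subset (subset_tsupport _ h1) i
  have e : x i = ε * (ε⁻¹ • x) i := by
    rw [PiLp.smul_apply, smul_eq_mul, mul_inv_cancel_left₀ hε.1.ne']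
  rw [e]
  constructor <;> nlinarith [h2.1, h2.2, hε.1, hε.2]

theorem Mollifier.integral_scaled (hε : ε ∈ Set.Ioo (0 : ℝ) 1) : ∫ x, ρ.scaled ε x = 1 := by
  unfold Mollifier.scaled
  rw [integral_const_mul, Measure.integral_comp_smul, ρ.integral_eq_one, finrank_euclideanSpace,
    Fintype.card_fin, abs_of_nonneg (by positivity)]
  have := hε.1.ne'
  simp
  field_simp

theorem Mollifier.integral_scaled_sq (hε : ε ∈ Set.Ioo (0 : ℝ) 1) :
    ∫ x, ρ.scaled ε x ^ 2 = (∫ x, ρ.toFun x ^ 2) / ε ^ 2 := by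
  simp only [Mollifier.scaled, mul_pow]
  rw [integral_const_mul, Measure.integral_comp_smul (μ := volume) (fun x => ρ.toFun x ^ 2),
    finrank_euclideanSpace, Fintype.card_fin, abs_of_nonneg (by positivity)]
  have := hε.1.ne'
  simp
  field_simp

theorem Mollifier.integral_onTorus (hε : ε ∈ Set.Ioo (0 : ℝ) 1) : ∫ y, ρ.onTorus ε y = 1 := by
  unfold Mollifier.onTorus
  rw [integral_comp_cellRep fun x hx => ρ.mem_cell_of_scaled_ne_zero hε hx, ρ.integral_scaled hε]

theorem Mollifier.integral_onTorus_sq (hε : ε ∈ Set.Ioo (0 : ℝ) 1) :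
    ∫ y, ρ.onTorus ε y ^ 2 = (∫ x, ρ.toFun x ^ 2) / ε ^ 2 := by
  unfold Mollifier.onTorus
  rw [integral_comp_cellRep (F := fun x => ρ.scaled ε x ^ 2) fun x hx =>
    ρ.mem_cell_of_scaled_ne_zero hε (ne_zero_pow two_ne_zero hx), ρ.integral_scaled_sq hε]

theorem Mollifier.onTorus_nonneg (y : Torus) : 0 ≤ ρ.onTorus ε y :=
  mul_nonneg (by positivity) (ρ.nonneg _)

theorem Mollifier.inner_shiftL2 (ε : ℝ) (a b : Torus) :
    inner ℝ (ρ.shiftL2 ε a) (ρ.shiftL2 ε b) = ∫ y, ρ.onTorus ε (a - y) * ρ.onTorus ε (b - y) := by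
  rw [L2.inner_def]
  refine integral_congr_ae ?_
  filter_upwards [(ρ.memLp_shift ε a).coeFn_toLp, (ρ.memLp_shift ε b).coeFn_toLp] with y h1 h2
  rw [Mollifier.shiftL2, Mollifier.shiftL2, h1, h2]
  simp [mul_comm]

theorem Mollifier.inner_shiftL2_nonneg (ε : ℝ) (a b : Torus) :
    0 ≤ inner ℝ (ρ.shiftL2 ε a) (ρ.shiftL2 ε b) := by
  rw [ρ.inner_shiftL2]
  exact integral_nonneg fun y => mul_nonneg (ρ.onTorus_nonneg _) (ρ.onTorus_nonneg _)

theorem Mollifier.inner_shiftL2_self (hε : ε ∈ Set.Ioo (0 : ℝ) 1) (a : Torus) :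
    inner ℝ (ρ.shiftL2 ε a) (ρ.shiftL2 ε a) = (∫ x, ρ.toFun x ^ 2) / ε ^ 2 := by
  rw [ρ.inner_shiftL2, ← ρ.integral_onTorus_sq hε,
    ← integral_sub_left_eq_self (fun y => ρ.onTorus ε y ^ 2) volume a]
  simp only [sq]

/-- The Fourier coefficients of the mollifier on the torus. -/
def Mollifier.coeff (ε : ℝ) (m : Fin 2 → ℤ) : ℂ :=
  ∫ y, UnitAddTorus.mFourier m y * (ρ.onTorus ε y : ℂ)

theorem Mollifier.norm_coeff_le (hε : ε ∈ Set.Ioo (0 : ℝ) 1) (m : Fin 2 → ℤ) :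
    ‖ρ.coeff ε m‖ ≤ 1 := by
  rw [← ρ.integral_onTorus hε]
  refine (norm_integral_le_integral_norm _).trans_eq (integral_congr_ae
    (Filter.Eventually.of_forall fun y => ?_))
  have : ‖UnitAddTorus.mFourier m y‖ = 1 := by
    simp only [UnitAddTorus.mFourier, ContinuousMap.coe_mk, norm_prod, fourier_apply,
      Circle.norm_coe, Finset.prod_const_one]
  simp only [norm_mul, this, one_mul, Complex.norm_real, Real.norm_eq_abs,
    abs_of_nonneg (ρ.onTorus_nonneg y)]

theorem mFourier_sub_apply (m : Fin 2 → ℤ) (x y : Torus) :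
    UnitAddTorus.mFourier m (x - y) = UnitAddTorus.mFourier m x * UnitAddTorus.mFourier (-m) y := by
  simp only [UnitAddTorus.mFourier, ContinuousMap.coe_mk, ← Finset.prod_mul_distrib]
  refine Finset.prod_congr rfl fun i _ => ?_
  rw [fourier_apply, fourier_apply, fourier_apply, ← Circle.coe_mul, ← AddCircle.toCircle_add]
  congr 2
  rw [Pi.sub_apply, Pi.neg_apply, neg_smul, zsmul_sub, sub_eq_add_neg]

theorem mFourier_toTorus (m : Fin 2 → ℤ) (z : Plane) :
    UnitAddTorus.mFourier m (toTorus z) = Complex.exp (phase m z * Complex.I) := by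
  simp only [UnitAddTorus.mFourier, ContinuousMap.coe_mk, toTorus, fourier_coe_apply,
    Fin.prod_univ_two, ← Complex.exp_add]
  congr 1
  simp only [phase]
  push_cast
  ring

theorem Mollifier.memLp_shift_complex (ε : ℝ) (a : Torus) :
    MemLp (fun y : Torus => (ρ.onTorus ε (a - y) : ℂ)) 2 volume :=
  (ρ.memLp_shift ε a).ofReal

theorem Mollifier.integral_mFourier_shift (ε : ℝ) (a : Torus) (m : Fin 2 → ℤ) :
    ∫ y, UnitAddTorus.mFourier (-m) y * (ρ.onTorus ε (a - y) : ℂ)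
      = UnitAddTorus.mFourier (-m) a * ρ.coeff ε m := by
  rw [← integral_sub_left_eq_self
    (fun y : Torus => UnitAddTorus.mFourier (-m) y * (ρ.onTorus ε (a - y) : ℂ)) volume a,
    Mollifier.coeff, ← integral_const_mul]
  refine integral_congr_ae (Filter.Eventually.of_forall fun y => ?_)
  simp only [mFourier_sub_apply, neg_neg, sub_sub_cancel]
  ring

/-- The correlation of the mollified noise as a cosine series. -/
theorem Mollifier.hasSum_inner (ε : ℝ) (z z' : Plane) :
    HasSum (fun m => ‖ρ.coeff ε m‖ ^ 2 * Real.cos (phase m (z - z')))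
      (inner ℝ (ρ.shiftL2 ε (toTorus z)) (ρ.shiftL2 ε (toTorus z'))) := by
  have h := hasSum_fourier_torus (ρ.memLp_shift_complex ε (toTorus z))
    (ρ.memLp_shift_complex ε (toTorus z'))
  have hint : (∫ y : Torus, (starRingEnd ℂ) (ρ.onTorus ε (toTorus z - y) : ℂ)
      * (ρ.onTorus ε (toTorus z' - y) : ℂ))
      = ((inner ℝ (ρ.shiftL2 ε (toTorus z)) (ρ.shiftL2 ε (toTorus z')) : ℝ) : ℂ) := by
    rw [ρ.inner_shiftL2, ← integral_complex_ofReal]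
    refine integral_congr_ae (Filter.Eventually.of_forall fun y => ?_)
    simp
  rw [hint] at h
  have h2 := Complex.hasSum_re h
  rw [Complex.ofReal_re] at h2
  refine h2.congr_fun fun m => ?_
  rw [ρ.integral_mFourier_shift, ρ.integral_mFourier_shift, map_mul, UnitAddTorus.mFourier_neg,
    UnitAddTorus.mFourier_neg, Complex.conj_conj, mFourier_toTorus, mFourier_toTorus,
    ← Complex.exp_conj, map_mul, Complex.conj_I, Complex.conj_ofReal]
  have e : Complex.exp (phase m z * Complex.I) * (starRingEnd ℂ) (ρ.coeff ε m) *
      (Complex.exp (phase m z' * -Complex.I) * ρ.coeff ε m)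
      = ((‖ρ.coeff ε m‖ ^ 2 : ℝ) : ℂ) * Complex.exp ((phase m (z - z') : ℝ) * Complex.I) := by
    have h3 : Complex.exp ((phase m (z - z') : ℝ) * Complex.I)
        = Complex.exp (phase m z * Complex.I) * Complex.exp (phase m z' * -Complex.I) := by
      rw [← Complex.exp_add]
      congr 1
      simp only [phase, PiLp.sub_apply]
      push_cast
      ring
    rw [h3, Complex.ofReal_pow, ← Complex.conj_mul']
    ring
  rw [e, Complex.re_ofReal_mul, Complex.exp_ofReal_mul_I_re]

/-- The correlation function `y ↦ (ρ^ε ⋆ ρ^ε)(y)` of the mollified noise. -/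
def Mollifier.corr (ε : ℝ) (y : Plane) : ℝ :=
  inner ℝ (ρ.shiftL2 ε (toTorus y)) (ρ.shiftL2 ε (toTorus 0))

theorem Mollifier.hasSum_corr (ε : ℝ) (y : Plane) :
    HasSum (fun m => ‖ρ.coeff ε m‖ ^ 2 * Real.cos (phase m y)) (ρ.corr ε y) := by
  simpa [Mollifier.corr] using ρ.hasSum_inner ε y 0

/-- Stationarity of the noise: both sides are sums of the same cosine series. -/
theorem Mollifier.inner_eq_corr (ε : ℝ) (z z' : Plane) :
    inner ℝ (ρ.shiftL2 ε (toTorus z)) (ρ.shiftL2 ε (toTorus z')) = ρ.corr ε (z - z') :=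
  (ρ.hasSum_inner ε z z').unique (ρ.hasSum_corr ε (z - z'))

theorem Mollifier.corr_nonneg (ε : ℝ) (y : Plane) : 0 ≤ ρ.corr ε y := ρ.inner_shiftL2_nonneg ε _ _

theorem Mollifier.corr_zero (hε : ε ∈ Set.Ioo (0 : ℝ) 1) :
    ρ.corr ε 0 = (∫ x, ρ.toFun x ^ 2) / ε ^ 2 := ρ.inner_shiftL2_self hε _

theorem Mollifier.hasSum_coeff_sq (ε : ℝ) : HasSum (fun m => ‖ρ.coeff ε m‖ ^ 2) (ρ.corr ε 0) := by
  simpa [phase] using ρ.hasSum_corr ε 0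

theorem Mollifier.corr_le (ε : ℝ) (y : Plane) : ρ.corr ε y ≤ ρ.corr ε 0 :=
  hasSum_le (fun _ => mul_le_of_le_one_right (sq_nonneg _) (Real.cos_le_one _))
    (ρ.hasSum_corr ε y) (ρ.hasSum_coeff_sq ε)

end KPZ

end

noncomputable section

namespace KPZ

/-! ### The noise along random walk paths -/

section Noise

variable {Ω : Type*}

variable {W : ℝ≥0 → Lp ℝ 2 (volume : Measure Torus) → Ω → ℝ}

/-- The random variables which are linear functionals of the noise. -/
def noiseSpan (W : ℝ≥0 → Lp ℝ 2 (volume : Measure Torus) → Ω → ℝ) : Submodule ℝ (Ω → ℝ) :=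
  Submodule.span ℝ (Set.range fun q : ℝ≥0 × Lp ℝ 2 (volume : Measure Torus) => W q.1 q.2)

theorem mem_noiseSpan (t : ℝ≥0) (f : Lp ℝ 2 (volume : Measure Torus)) : W t f ∈ noiseSpan W :=
  Submodule.subset_span ⟨(t, f), rfl⟩

/-- The increment over the `k`-th time step of length `δ` of the mollified noise, times `c`. -/
def noiseStep (ρ : Mollifier) (W : ℝ≥0 → Lp ℝ 2 (volume : Measure Torus) → Ω → ℝ) (ε c : ℝ)
    (δ : ℝ≥0) (ω : Ω) (k : ℕ) (z : Plane) : ℝ :=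
  c * (mollifiedNoise ρ W ε ((k + 1 : ℕ) * δ) (toTorus z) ω
    - mollifiedNoise ρ W ε (k * δ) (toTorus z) ω)

theorem noiseStep_mem (ρ : Mollifier) (ε c : ℝ) (δ : ℝ≥0) (k : ℕ) (z : Plane) :
    (fun ω => noiseStep ρ W ε c δ ω k z) ∈ noiseSpan W :=
  (noiseSpan W).smul_mem c ((noiseSpan W).sub_mem (mem_noiseSpan _ _) (mem_noiseSpan _ _))

theorem pathEnergy_mem {E : Type*} (ρ : Mollifier) (ε c : ℝ) (δ : ℝ≥0) (σ : E → Plane) (n : ℕ)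
    (p : Fin n → E) (z : Plane) :
    (fun ω => pathEnergy (noiseStep ρ W ε c δ ω) σ n p z) ∈ noiseSpan W := by
  induction n generalizing z with
  | zero => exact (noiseSpan W).zero_mem
  | succ n ih => exact (noiseSpan W).add_mem (noiseStep_mem ρ ε c δ n z) (ih _ _)

variable [MeasurableSpace Ω] {P : Measure Ω}

theorem integral_add_four {f₁ f₂ f₃ f₄ : Ω → ℝ} (h₁ : Integrable f₁ P) (h₂ : Integrable f₂ P)
    (h₃ : Integrable f₃ P) (h₄ : Integrable f₄ P) :
    ∫ ω, ((f₁ ω + f₂ ω) + (f₃ ω + f₄ ω)) ∂P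
      = (∫ ω, f₁ ω ∂P + ∫ ω, f₂ ω ∂P) + (∫ ω, f₃ ω ∂P + ∫ ω, f₄ ω ∂P) := by
  rw [integral_add (f := fun ω => f₁ ω + f₂ ω) (g := fun ω => f₃ ω + f₄ ω) (h₁.add h₂) (h₃.add h₄),
    integral_add h₁ h₂, integral_add h₃ h₄]

/-- Each variable uses finitely many coordinates of the process, and finite linear images of
Gaussian vectors are Gaussian. -/
theorem hasGaussianLaw_of_mem_span {T : Type*} {Y : T → Ω → ℝ} (hY : IsGaussianProcess Y P)
    {J : Type*} [Fintype J] {X : J → Ω → ℝ} (hX : ∀ j, X j ∈ Submodule.span ℝ (Set.range Y)) :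
    HasGaussianLaw (fun ω j => X j ω) P := by
  have h : IsGaussianProcess X P := by
    refine hY.of_isGaussianProcess fun j => ?_
    obtain ⟨c, hc⟩ := Finsupp.mem_span_range_iff_exists_finsupp.1 (hX j)
    refine ⟨c.support, ∑ i : c.support, c i • ContinuousLinearMap.proj i, fun ω => ?_⟩
    rw [← hc, Finsupp.sum, Finset.sum_apply, sum_apply,
      ← Finset.sum_coe_sort c.support]
    simp
  exact (h.hasGaussianLaw Finset.univ).map_fun (ContinuousLinearMap.pi fun j =>
    ContinuousLinearMap.proj (R := ℝ) (φ := fun _ : (Finset.univ : Finset J) => ℝ)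
      ⟨j, Finset.mem_univ j⟩)

theorem IsCylindricalWiener.hasGaussianLaw (hW : IsCylindricalWiener W P)
    {J : Type*} [Fintype J] {X : J → Ω → ℝ}
    (hX : ∀ j, X j ∈ noiseSpan W) : HasGaussianLaw (fun ω j => X j ω) P :=
  hasGaussianLaw_of_mem_span hW.gaussian hX

theorem IsCylindricalWiener.memLp (hW : IsCylindricalWiener W P)
    {X : Ω → ℝ} (hX : X ∈ noiseSpan W) : MemLp X 2 P :=
  ((hW.hasGaussianLaw (J := Unit) (X := fun _ => X) fun _ => hX).eval ()).memLp_two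

theorem IsCylindricalWiener.integrable (hW : IsCylindricalWiener W P)
    {X : Ω → ℝ} (hX : X ∈ noiseSpan W) : Integrable X P :=
  ((hW.hasGaussianLaw (J := Unit) (X := fun _ => X) fun _ => hX).eval ()).integrable

theorem IsCylindricalWiener.integrable_mul (hW : IsCylindricalWiener W P)
    {X Y : Ω → ℝ} (hX : X ∈ noiseSpan W)
    (hY : Y ∈ noiseSpan W) : Integrable (fun ω => X ω * Y ω) P :=
  (hW.memLp hX).integrable_mul (hW.memLp hY)

theorem IsCylindricalWiener.integral_eq_zero (hW : IsCylindricalWiener W P)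
    {X : Ω → ℝ} (hX : X ∈ noiseSpan W) :
    ∫ ω, X ω ∂P = 0 := by
  induction hX using Submodule.span_induction with
  | mem x hx => obtain ⟨q, rfl⟩ := hx; exact hW.centered _ _
  | zero => simp
  | add x y hx hy h1 h2 =>
    simp only [Pi.add_apply]
    rw [integral_add (hW.integrable hx) (hW.integrable hy), h1, h2, add_zero]
  | smul c x hx h => simp only [Pi.smul_apply, smul_eq_mul, integral_const_mul, h, mul_zero]

variable (ρ : Mollifier) (ε c : ℝ) (δ : ℝ≥0)

/-- Increments over distinct time steps are uncorrelated: the four minima of times combine to δ if k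
= l and cancel otherwise. -/
theorem IsCylindricalWiener.covariance_noiseStep (hW : IsCylindricalWiener W P)
    (k l : ℕ) (z z' : Plane) :
    ∫ ω, noiseStep ρ W ε c δ ω k z * noiseStep ρ W ε c δ ω l z' ∂P
      = if k = l then c ^ 2 * δ * ρ.corr ε (z - z') else 0 := by
  set f := ρ.shiftL2 ε (toTorus z) with hf
  set g := ρ.shiftL2 ε (toTorus z') with hg
  have hi : ∀ s t, Integrable (fun ω => W s f ω * W t g ω) P := fun s t =>
    hW.integrable_mul (mem_noiseSpan _ _) (mem_noiseSpan _ _)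
  have e : ∀ ω, noiseStep ρ W ε c δ ω k z * noiseStep ρ W ε c δ ω l z'
      = c ^ 2 * ((W ((k + 1 : ℕ) * δ) f ω * W ((l + 1 : ℕ) * δ) g ω
          + -(W ((k + 1 : ℕ) * δ) f ω * W (l * δ) g ω))
        + (-(W (k * δ) f ω * W ((l + 1 : ℕ) * δ) g ω) + W (k * δ) f ω * W (l * δ) g ω)) :=
      fun ω => by
    simp only [noiseStep, mollifiedNoise]; ring
  simp only [e]
  rw [integral_const_mul, integral_add_four (hi _ _) (hi _ _).fun_neg (hi _ _).fun_neg (hi _ _),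
    integral_neg, integral_neg]
  simp only [hW.covariance]
  rw [hf, hg, ρ.inner_eq_corr]
  have hδ : (0 : ℝ) ≤ δ := δ.2
  have hmin : ∀ a b : ℕ, min (((a * δ : ℝ≥0) : ℝ)) ((b * δ : ℝ≥0) : ℝ) = (min a b : ℕ) * δ :=
    fun a b => by
      push_cast
      rw [min_mul_of_nonneg _ _ hδ]
  simp only [hmin]
  split_ifs with h
  · subst h
    simp only [min_self, Nat.le_succ, min_eq_left, min_eq_right]
    push_cast
    ring
  · rcases lt_or_gt_of_ne h with h | h
    · rw [min_eq_left (by omega), min_eq_left (by omega), min_eq_left (by omega),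
        min_eq_left (by omega)]
      ring
    · rw [min_eq_right (by omega), min_eq_right (by omega), min_eq_right (by omega),
        min_eq_right (by omega)]
      ring

variable {E : Type*} (σ : E → Plane)

/-- A path of length n collects only the increments 0, …, n − 1, all of which precede the k-th. -/
theorem IsCylindricalWiener.covariance_noiseStep_pathEnergy (hW : IsCylindricalWiener W P)
    {k n : ℕ} (hn : n ≤ k)
    (p : Fin n → E) (z z' : Plane) :
    ∫ ω, noiseStep ρ W ε c δ ω k z * pathEnergy (noiseStep ρ W ε c δ ω) σ n p z' ∂P = 0 := by
  induction n generalizing z' with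
  | zero => simp [pathEnergy]
  | succ n ih =>
    simp only [pathEnergy, mul_add]
    rw [integral_add (hW.integrable_mul (noiseStep_mem ρ ε c δ k z) (noiseStep_mem ρ ε c δ n z'))
      (hW.integrable_mul (noiseStep_mem ρ ε c δ k z) (pathEnergy_mem ρ ε c δ σ n _ _)),
      hW.covariance_noiseStep, if_neg (by omega), ih (by omega), add_zero]

/-- The covariance of the noise collected along two walks is the overlap of the walks. -/
theorem IsCylindricalWiener.covariance_pathEnergy (hW : IsCylindricalWiener W P)
    (n : ℕ) (p p' : Fin n → E)
    (z z' : Plane) :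
    ∫ ω, pathEnergy (noiseStep ρ W ε c δ ω) σ n p z *
        pathEnergy (noiseStep ρ W ε c δ ω) σ n p' z' ∂P
      = pathEnergy (fun _ y => c ^ 2 * δ * ρ.corr ε y) (fun q : E × E => σ q.1 - σ q.2) n
          (fun i => (p i, p' i)) (z - z') := by
  induction n generalizing z z' with
  | zero => simp [pathEnergy]
  | succ n ih =>
    have e : ∀ ω, pathEnergy (noiseStep ρ W ε c δ ω) σ (n + 1) p z *
        pathEnergy (noiseStep ρ W ε c δ ω) σ (n + 1) p' z'
        = (noiseStep ρ W ε c δ ω n z * noiseStep ρ W ε c δ ω n z'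
          + noiseStep ρ W ε c δ ω n z *
            pathEnergy (noiseStep ρ W ε c δ ω) σ n (Fin.tail p') (z' + σ (p' 0)))
          + (noiseStep ρ W ε c δ ω n z' *
              pathEnergy (noiseStep ρ W ε c δ ω) σ n (Fin.tail p) (z + σ (p 0))
            + pathEnergy (noiseStep ρ W ε c δ ω) σ n (Fin.tail p) (z + σ (p 0)) *
              pathEnergy (noiseStep ρ W ε c δ ω) σ n (Fin.tail p') (z' + σ (p' 0))) := fun ω => by
      simp only [pathEnergy]; ring
    have hs := fun z => noiseStep_mem (W := W) ρ ε c δ n z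
    have hp := fun p z => pathEnergy_mem (W := W) ρ ε c δ σ n p z
    simp only [e]
    rw [integral_add_four (hW.integrable_mul (hs _) (hs _)) (hW.integrable_mul (hs _) (hp _ _))
      (hW.integrable_mul (hs _) (hp _ _)) (hW.integrable_mul (hp _ _) (hp _ _)),
      hW.covariance_noiseStep, if_pos rfl, hW.covariance_noiseStep_pathEnergy ρ ε c δ σ le_rfl,
      hW.covariance_noiseStep_pathEnergy ρ ε c δ σ le_rfl, ih, pathEnergy]
    have e2 : z + σ (p 0) - (z' + σ (p' 0)) = z - z' + (σ (p 0) - σ (p' 0)) := by abel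
    rw [e2]
    simp only [add_zero, zero_add]
    rfl

end Noise

end KPZ

end

noncomputable section

namespace KPZ

/-! ### Consistency of the random walk scheme with the equation -/

/-- The coupling constant `|log ε|^{-1/2}`. -/
def coupling (ε : ℝ) : ℝ := |Real.log ε| ^ (-(1 / 2) : ℝ)

theorem abs_log_pos {ε : ℝ} (hε : ε ∈ Set.Ioo (0 : ℝ) 1) : 0 < |Real.log ε| :=
  abs_pos.2 (Real.log_neg hε.1 hε.2).ne

theorem coupling_pos {ε : ℝ} (hε : ε ∈ Set.Ioo (0 : ℝ) 1) : 0 < coupling ε :=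
  Real.rpow_pos_of_pos (abs_log_pos hε) _

/-- Taylor's formula with the remainder controlled by the oscillation of f'' alone: only two spatial
derivatives of the solution are available. -/
theorem abs_sub_taylor_le {f f' f'' : ℝ → ℝ} {r c η : ℝ} (hr : 0 ≤ r)
    (hf : ∀ x, HasDerivAt f (f' x) x) (hf' : ∀ x, HasDerivAt f' (f'' x) x)
    (hη : ∀ x ∈ Set.Icc 0 r, |f'' x - c| ≤ η) :
    |f r - (f 0 + r * f' 0 + r ^ 2 / 2 * c)| ≤ η * r ^ 2 := by
  have hη0 : 0 ≤ η := (abs_nonneg _).trans (hη 0 ⟨le_rfl, hr⟩)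
  have h1 : ∀ x ∈ Set.Icc 0 r, |f' x - f' 0 - c * x| ≤ η * r := fun x hx => by
    have h2 := norm_image_sub_le_of_norm_deriv_le_segment' (f := fun x => f' x - c * x)
      (f' := fun x => f'' x - c) (a := 0) (b := r) (C := η)
      (fun x _ => by
        have := (hf' x).sub ((hasDerivAt_id x).const_mul c)
        simp only [mul_one] at this
        exact this.hasDerivWithinAt)
      (fun x hx => hη x ⟨hx.1, hx.2.le⟩) x hx
    simp only [mul_zero, sub_zero, Real.norm_eq_abs] at h2
    rw [show f' x - f' 0 - c * x = f' x - c * x - f' 0 by ring]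
    exact h2.trans (mul_le_mul_of_nonneg_left hx.2 hη0)
  have h3 := norm_image_sub_le_of_norm_deriv_le_segment'
    (f := fun x => f x - (x * f' 0 + x ^ 2 / 2 * c)) (f' := fun x => f' x - f' 0 - c * x)
    (a := 0) (b := r) (C := η * r)
    (fun x _ => by
      have h4 : HasDerivAt (fun x : ℝ => x * f' 0 + x ^ 2 / 2 * c) (f' 0 + c * x) x := by
        refine (((hasDerivAt_id x).mul_const (f' 0)).add
          (((hasDerivAt_pow 2 x).div_const 2).mul_const c)).congr_deriv ?_
        push_cast
        ring
      refine ((hf x).sub h4).hasDerivWithinAt.congr_deriv ?_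
      ring)
    (fun x hx => h1 x ⟨hx.1, hx.2.le⟩) r ⟨hr, le_rfl⟩
  simp only [zero_mul, ne_eq, OfNat.ofNat_ne_zero, not_false_eq_true, zero_pow, zero_div, add_zero,
    sub_zero, Real.norm_eq_abs] at h3
  rw [show f r - (f 0 + r * f' 0 + r ^ 2 / 2 * c) = f r - (r * f' 0 + r ^ 2 / 2 * c) - f 0 by ring]
  exact h3.trans_eq (by ring)

/-- Uses x − 2x² ≤ log(1 + x) ≤ x for x ≥ −1/2; the second smallness condition absorbs the quadratic
error into ηδ. -/
theorem abs_log_sub_le {y δ b B η : ℝ} (hδ : 0 ≤ δ) (hy : |y - (1 + δ * b)| ≤ η * δ) (hb : |b| ≤ B)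
    (h1 : δ * (B + η) ≤ 1 / 2) (h2 : δ * (2 * (B + η) ^ 2) ≤ η) :
    |Real.log y - δ * b| ≤ 2 * η * δ := by
  have hy' := abs_le.1 hy
  have hb' := abs_le.1 hb
  have hx1 : y - 1 ≤ δ * (B + η) := by nlinarith
  have hx2 : -(δ * (B + η)) ≤ y - 1 := by nlinarith
  have hy0 : 1 / 2 ≤ y := by linarith
  have hsq : (y - 1) ^ 2 ≤ (δ * (B + η)) ^ 2 := sq_le_sq' hx2 hx1
  have hsq2 : 2 * (y - 1) ^ 2 ≤ η * δ := by
    have := mul_le_mul_of_nonneg_left h2 hδ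
    nlinarith
  have hηδ : 0 ≤ η * δ := (abs_nonneg _).trans hy
  have hup := Real.log_le_sub_one_of_pos (by linarith : 0 < y)
  have hlow := Real.one_sub_inv_le_log_of_pos (by linarith : 0 < y)
  have hinv : (y - 1) - 2 * (y - 1) ^ 2 ≤ 1 - y⁻¹ := by
    have hypos : 0 < y := by linarith
    have e : 1 - y⁻¹ - ((y - 1) - 2 * (y - 1) ^ 2) = (y - 1) ^ 2 * (2 * y - 1) / y := by
      field_simp
      ring
    have : 0 ≤ (y - 1) ^ 2 * (2 * y - 1) / y :=
      div_nonneg (mul_nonneg (sq_nonneg _) (by linarith)) hypos.le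
    linarith
  rw [abs_le]
  constructor <;> linarith

theorem toTorus_add (z w : Plane) : toTorus (z + w) = toTorus z + toTorus w := by
  ext i
  simp [toTorus]

theorem toTorus_cellRep (y : Torus) : toTorus (cellRep y) = y := by
  ext i
  simp only [toTorus, cellRep]
  exact AddCircle.coe_equivIoc

theorem cellRep_mem_closedBall (y : Torus) : cellRep y ∈ Metric.closedBall (0 : Plane) 1 := by
  have h : ∀ i, (cellRep y i) ^ 2 ≤ 1 / 4 := fun i => by
    have := (AddCircle.equivIoc (1 : ℝ) (-1 / 2) (y i)).2
    change ((AddCircle.equivIoc (1 : ℝ) (-1 / 2) (y i) : Set.Ioc _ _) : ℝ) ^ 2 ≤ 1 / 4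
    nlinarith [this.1, this.2]
  rw [mem_closedBall_zero_iff, EuclideanSpace.norm_eq, Real.sqrt_le_left (by norm_num), one_pow]
  simp only [Fin.sum_univ_two, Real.norm_eq_abs, sq_abs]
  linarith [h 0, h 1]

theorem lift_add_eq {z z' : Plane} (h : toTorus z = toTorus z') (f : Torus → ℝ) (w : Plane) :
    lift f (z + w) = lift f (z' + w) := by
  simp only [lift, toTorus_add, h]

/-- Periodicity of the drift reduces uniform estimates on the plane to the compact unit ball. -/
theorem drift_eq_of_toTorus_eq {z z' : Plane} (h : toTorus z = toTorus z') (ε : ℝ)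
    (f : Torus → ℝ) : drift ε f z = drift ε f z' := by
  have hper : (fun w => lift f (w + (z - z'))) = lift f := by
    ext w
    have := lift_add_eq h f (w - z')
    rwa [show z + (w - z') = w + (z - z') by abel, show z' + (w - z') = w by abel] at this
  have h1 : iteratedFDeriv ℝ 2 (lift f) z = iteratedFDeriv ℝ 2 (lift f) z' := by
    have := iteratedFDeriv_comp_add_right (𝕜 := ℝ) (f := lift f) 2 (z - z') z'
    rw [hper, add_sub_cancel] at this
    exact this.symm
  have h2 : fderiv ℝ (lift f) z = fderiv ℝ (lift f) z' := by
    have := fderiv_comp_add_right (𝕜 := ℝ) (f := lift f) (x := z') (z - z')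
    rw [hper, add_sub_cancel] at this
    exact this.symm
  simp only [drift, gradient, h2,
    InnerProductSpace.laplacian_eq_iteratedFDeriv_orthonormalBasis (lift f)
      (EuclideanSpace.basisFun (Fin 2) ℝ), h1]

/-- The generator of the exponentiated equation along the direction `d`. -/
def lineDrift (ε : ℝ) (f : Torus → ℝ) (z d : Plane) : ℝ :=
  iteratedFDeriv ℝ 2 (lift f) z ![d, d] + coupling ε * fderiv ℝ (lift f) z d ^ 2

theorem step_eq (r : ℝ) (e : Bool × Bool) : step r e = r • step 1 e := by
  ext i
  fin_cases i <;> simp [step]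

theorem step_one_eq (e : Bool × Bool) : step 1 e = sgn e.1 • EuclideanSpace.basisFun (Fin 2) ℝ 0
    + sgn e.2 • EuclideanSpace.basisFun (Fin 2) ℝ 1 := by
  ext i
  fin_cases i <;> simp [step]

/-- The steps (±1, ±1) have identity covariance, so averaging over them gives Δf + λ|∇f|²; the mixed
terms cancel by sign. -/
theorem drift_eq_sum_lineDrift (ε : ℝ) (f : Torus → ℝ) (z : Plane) :
    (∑ e, lineDrift ε f z (step 1 e)) / 4 = 2 * drift ε f z := by
  set b := EuclideanSpace.basisFun (Fin 2) ℝ with hb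
  have hgrad : ‖∇ (lift f) z‖ ^ 2 =
      fderiv ℝ (lift f) z (b 0) ^ 2 + fderiv ℝ (lift f) z (b 1) ^ 2 := by
    rw [← b.sum_sq_norm_inner_right, Fin.sum_univ_two]
    simp only [inner_gradient_right, conj_trivial, Real.norm_eq_abs, sq_abs]
  rw [drift, InnerProductSpace.laplacian_eq_iteratedFDeriv_orthonormalBasis (lift f) b, hgrad]
  simp only [Fintype.sum_prod_type, Fintype.sum_bool, lineDrift, step_one_eq, ← hb, sgn,
    iteratedFDeriv_two_apply, Fin.sum_univ_two, if_true, Bool.false_eq_true, if_false,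
    Matrix.cons_val_zero, Matrix.cons_val_one, map_add, map_smul, add_apply,
    smul_apply, smul_eq_mul]
  rw [coupling]
  ring

theorem sum_fderiv_step (f : Torus → ℝ) (z : Plane) :
    ∑ e, fderiv ℝ (lift f) z (step 1 e) = 0 := by
  simp only [Fintype.sum_prod_type, Fintype.sum_bool, step_one_eq, sgn, if_true,
    Bool.false_eq_true, if_false, map_add, map_smul, smul_eq_mul]
  ring

section Line

variable {f : Torus → ℝ}

theorem hasDerivAt_lift_line (hf : ContDiff ℝ 2 (lift f)) (z d : Plane) (r : ℝ) :
    HasDerivAt (fun r : ℝ => lift f (z + r • d)) (fderiv ℝ (lift f) (z + r • d) d) r := by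
  have h1 : HasFDerivAt (lift f) (fderiv ℝ (lift f) (z + r • d)) (z + r • d) :=
    (hf.differentiable (by norm_num) _).hasFDerivAt
  have h2 : HasDerivAt (fun r : ℝ => z + r • d) d r := by
    simpa using ((hasDerivAt_id r).smul_const d).const_add z
  exact h1.comp_hasDerivAt r h2

theorem hasDerivAt_fderiv_line (hf : ContDiff ℝ 2 (lift f)) (z d : Plane) (r : ℝ) :
    HasDerivAt (fun r : ℝ => fderiv ℝ (lift f) (z + r • d) d)
      (iteratedFDeriv ℝ 2 (lift f) (z + r • d) ![d, d]) r := by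
  have hd : ContDiff ℝ 1 (fderiv ℝ (lift f)) := hf.fderiv_right (by norm_num)
  have h1 : HasFDerivAt (fderiv ℝ (lift f)) (fderiv ℝ (fderiv ℝ (lift f)) (z + r • d))
      (z + r • d) := (hd.differentiable (by norm_num) _).hasFDerivAt
  have h2 : HasDerivAt (fun r : ℝ => z + r • d) d r := by
    simpa using ((hasDerivAt_id r).smul_const d).const_add z
  have h3 : HasDerivAt (fun r : ℝ => fderiv ℝ (lift f) (z + r • d))
      (fderiv ℝ (fderiv ℝ (lift f)) (z + r • d) d) r := h1.comp_hasDerivAt r h2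
  rw [iteratedFDeriv_two_apply]
  exact (ContinuousLinearMap.apply ℝ ℝ d).hasFDerivAt.comp_hasDerivAt r h3

/-- The first two derivatives of `r ↦ exp (λ (f (z + r d) - f z))`. -/
theorem hasDerivAt_exp_line (hf : ContDiff ℝ 2 (lift f)) (ε : ℝ) (z d : Plane) (r : ℝ) :
    HasDerivAt (fun r : ℝ => Real.exp (coupling ε * (lift f (z + r • d) - lift f z)))
      (coupling ε * fderiv ℝ (lift f) (z + r • d) d *
        Real.exp (coupling ε * (lift f (z + r • d) - lift f z))) r ∧
    HasDerivAt (fun r : ℝ => coupling ε * fderiv ℝ (lift f) (z + r • d) d *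
        Real.exp (coupling ε * (lift f (z + r • d) - lift f z)))
      (coupling ε * lineDrift ε f (z + r • d) d *
        Real.exp (coupling ε * (lift f (z + r • d) - lift f z))) r := by
  have h1 : HasDerivAt (fun r : ℝ => Real.exp (coupling ε * (lift f (z + r • d) - lift f z)))
      (coupling ε * fderiv ℝ (lift f) (z + r • d) d *
        Real.exp (coupling ε * (lift f (z + r • d) - lift f z))) r :=
    ((((hasDerivAt_lift_line hf z d r).sub_const (lift f z)).const_mul 
      (coupling ε)).exp).congr_deriv
      (by ring)
  refine ⟨h1, (((hasDerivAt_fderiv_line hf z d r).const_mul (coupling ε)).mul h1).congr_deriv ?_⟩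
  rw [lineDrift]
  ring

end Line

section OneStep

variable {H : ℝ≥0 → Torus → ℝ}

theorem continuous_lift_of (hc : ∀ k : ℕ, k ≤ 2 → Continuous fun p : ℝ≥0 × Plane =>
    iteratedFDeriv ℝ k (lift (H p.1)) p.2) :
    Continuous fun p : ℝ≥0 × Plane => lift (H p.1) p.2 := by
  have := (ContinuousMultilinearMap.apply ℝ (fun _ : Fin 0 => Plane) ℝ 0).continuous.comp
    (hc 0 (by norm_num))
  simpa [Function.comp_def] using this

theorem continuous_lineDrift_of (hc : ∀ k : ℕ, k ≤ 2 → Continuous fun p : ℝ≥0 × Plane =>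
    iteratedFDeriv ℝ k (lift (H p.1)) p.2) (ε : ℝ) (d : Plane) :
    Continuous fun p : ℝ≥0 × Plane => lineDrift ε (H p.1) p.2 d := by
  have h1 : Continuous fun p : ℝ≥0 × Plane => fderiv ℝ (lift (H p.1)) p.2 d := by
    have := (ContinuousMultilinearMap.apply ℝ (fun _ : Fin 1 => Plane) ℝ ![d]).continuous.comp
      (hc 1 (by norm_num))
    simpa [Function.comp_def, iteratedFDeriv_one_apply] using this
  have h2 : Continuous fun p : ℝ≥0 × Plane => iteratedFDeriv ℝ 2 (lift (H p.1)) p.2 ![d, d] :=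
    (ContinuousMultilinearMap.apply ℝ (fun _ : Fin 2 => Plane) ℝ ![d, d]).continuous.comp
      (hc 2 le_rfl)
  unfold lineDrift
  exact h2.add (continuous_const.mul (h1.pow 2))

theorem continuous_drift_of (hc : ∀ k : ℕ, k ≤ 2 → Continuous fun p : ℝ≥0 × Plane =>
    iteratedFDeriv ℝ k (lift (H p.1)) p.2) (ε : ℝ) :
    Continuous fun p : ℝ≥0 × Plane => drift ε (H p.1) p.2 := by
  have h : ∀ p : ℝ≥0 × Plane, drift ε (H p.1) p.2
      = (∑ e, lineDrift ε (H p.1) p.2 (step 1 e)) / 4 / 2 := fun p => by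
    rw [drift_eq_sum_lineDrift]; ring
  simp only [h]
  exact ((continuous_finsetSum _ fun e _ => continuous_lineDrift_of hc ε _).div_const _).div_const _

/-- Uniform continuity on a compact set, stated as a modulus in the last variable, which serves both
for spatial displacements and for time increments. -/
theorem exists_modulus {F : ℝ × Plane × ℝ → ℝ} (hF : Continuous F) (T : ℝ) {η : ℝ} (hη : 0 < η) :
    ∃ r₀ > 0, ∀ s ∈ Set.Icc 0 T, ∀ z ∈ Metric.closedBall (0 : Plane) 1, ∀ r ∈ Set.Icc (0 : ℝ) 1,
      r < r₀ → |F (s, z, r) - F (s, z, 0)| ≤ η := by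
  have hK : IsCompact (Set.Icc (0 : ℝ) T ×ˢ Metric.closedBall (0 : Plane) 1 ×ˢ Set.Icc (0 : ℝ) 1) :=
    isCompact_Icc.prod ((isCompact_closedBall _ _).prod isCompact_Icc)
  obtain ⟨r₀, hr₀, h⟩ := Metric.uniformContinuousOn_iff.1
    (hK.uniformContinuousOn_of_continuous hF.continuousOn) η hη
  refine ⟨r₀, hr₀, fun s hs z hz r hr hlt => ?_⟩
  have := h (s, z, r) ⟨hs, hz, hr⟩ (s, z, 0) ⟨hs, hz, ⟨le_rfl, zero_le_one⟩⟩ (by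
    simp only [Prod.dist_eq, dist_self, Real.dist_eq, sub_zero, abs_of_nonneg hr.1]
    simp [hr.1, hlt])
  exact (Real.dist_eq _ _ ▸ this).le

/-- Second-order expansion of exp(λ(h(z + step) − h(z))) in each of the four directions. First-order
terms cancel in the average, and the square in `lineDrift` is the Cole–Hopf nonlinearity. -/
theorem exists_step_expansion (hC : ∀ t, ContDiff ℝ 2 (lift (H t)))
    (hc : ∀ k : ℕ, k ≤ 2 → Continuous fun p : ℝ≥0 × Plane =>
      iteratedFDeriv ℝ k (lift (H p.1)) p.2) (ε T : ℝ) {η : ℝ} (hη : 0 < η) :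
    ∃ r₀ > 0, ∀ s ∈ Set.Icc 0 T, ∀ z ∈ Metric.closedBall (0 : Plane) 1, ∀ r, 0 ≤ r → r < r₀ →
      |(∑ e, Real.exp (coupling ε *
          (lift (H s.toNNReal) (z + step r e) - lift (H s.toNNReal) z))) / 4
        - (1 + r ^ 2 * (coupling ε * drift ε (H s.toNNReal) z))| ≤ η * r ^ 2 := by
  have hex : ∀ e : Bool × Bool, ∃ r₀ > 0, ∀ s ∈ Set.Icc 0 T, ∀ z ∈ Metric.closedBall (0 : Plane) 1,
      ∀ r, 0 ≤ r → r < r₀ →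
      |Real.exp (coupling ε * (lift (H s.toNNReal) (z + step r e) - lift (H s.toNNReal) z))
        - (1 + r * (coupling ε * fderiv ℝ (lift (H s.toNNReal)) z (step 1 e))
          + r ^ 2 / 2 * (coupling ε * lineDrift ε (H s.toNNReal) z (step 1 e)))| ≤ η * r ^ 2 := by
    intro e
    set d := step 1 e
    have hcont : Continuous fun q : ℝ × Plane × ℝ =>
        coupling ε * lineDrift ε (H q.1.toNNReal) (q.2.1 + q.2.2 • d) d *
          Real.exp (coupling ε * (lift (H q.1.toNNReal) (q.2.1 + q.2.2 • d)
            - lift (H q.1.toNNReal) q.2.1)) := by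
      have h1 : Continuous fun q : ℝ × Plane × ℝ => (q.1.toNNReal, q.2.1 + q.2.2 • d) := by fun_prop
      have h2 : Continuous fun q : ℝ × Plane × ℝ => (q.1.toNNReal, q.2.1) := by fun_prop
      have h3 := (continuous_lineDrift_of hc ε d).comp h1
      have h4 := (continuous_lift_of hc).comp h1
      have h5 := (continuous_lift_of hc).comp h2
      simp only [Function.comp_def] at h3 h4 h5
      fun_prop
    obtain ⟨r₀, hr₀, h⟩ := exists_modulus hcont T hη
    refine ⟨min r₀ 1, lt_min hr₀ one_pos, fun s hs z hz r hr hlt => ?_⟩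
    have hder := hasDerivAt_exp_line (hC s.toNNReal) ε z d
    have key := abs_sub_taylor_le hr (fun x => (hder x).1) (fun x => (hder x).2)
      (c := coupling ε * lineDrift ε (H s.toNNReal) z d) (η := η) (fun x hx => by
        have hx1 : x < min r₀ 1 := hx.2.trans_lt hlt
        have := h s hs z hz x ⟨hx.1, (hx1.trans_le (min_le_right _ _)).le⟩
          (hx1.trans_le (min_le_left _ _))
        simpa using this)
    rw [step_eq]
    simpa using key
  choose r₀ hr₀ h using hex
  refine ⟨Finset.univ.inf' Finset.univ_nonempty r₀,
    (Finset.lt_inf'_iff _).2 fun e _ => hr₀ e, fun s hs z hz r hr hlt => ?_⟩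
  have h1 : ∀ e, _ := fun e => h e s hs z hz r hr
    (hlt.trans_le (Finset.inf'_le _ (Finset.mem_univ e)))
  have e1 : (1 + r ^ 2 * (coupling ε * drift ε (H s.toNNReal) z))
      = (∑ e, (1 + r * (coupling ε * fderiv ℝ (lift (H s.toNNReal)) z (step 1 e))
          + r ^ 2 / 2 * (coupling ε * lineDrift ε (H s.toNNReal) z (step 1 e)))) / 4 := by
    have h2 := drift_eq_sum_lineDrift ε (H s.toNNReal) z
    rw [Finset.sum_add_distrib, Finset.sum_add_distrib, ← Finset.mul_sum, ← Finset.mul_sum,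
      ← Finset.mul_sum, ← Finset.mul_sum, sum_fderiv_step]
    simp only [Finset.sum_const, Finset.card_univ, Fintype.card_prod, Fintype.card_bool]
    have h3 : drift ε (H s.toNNReal) z
        = (∑ e, lineDrift ε (H s.toNNReal) z (step 1 e)) / 4 / 2 := by rw [h2]; ring
    rw [h3]
    ring
  rw [e1, ← sub_div, ← Finset.sum_sub_distrib, abs_div, abs_of_pos (four_pos : (0 : ℝ) < 4),
    div_le_iff₀ four_pos]
  refine (Finset.abs_sum_le_sum_abs _ _).trans ((Finset.sum_le_sum fun e _ => h1 e).trans_eq ?_)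
  simp [Fintype.card_prod]
  ring

theorem exists_integral_drift (hc : ∀ k : ℕ, k ≤ 2 → Continuous fun p : ℝ≥0 × Plane =>
      iteratedFDeriv ℝ k (lift (H p.1)) p.2) (ε T : ℝ) {η : ℝ} (hη : 0 < η) :
    ∃ δ₀ > 0, ∀ δ, 0 ≤ δ → δ < δ₀ → ∀ s ∈ Set.Icc 0 T, ∀ z ∈ Metric.closedBall (0 : Plane) 1,
      |(∫ τ in s..(s + δ), drift ε (H τ.toNNReal) z) - δ * drift ε (H s.toNNReal) z| ≤ η * δ := by
  have hdc := continuous_drift_of hc ε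
  have hcont : Continuous fun q : ℝ × Plane × ℝ => drift ε (H (q.1 + q.2.2).toNNReal) q.2.1 := by
    have h1 : Continuous fun q : ℝ × Plane × ℝ => ((q.1 + q.2.2).toNNReal, q.2.1) := by fun_prop
    simpa only [Function.comp_def] using hdc.comp h1
  obtain ⟨δ₁, hδ₁, hB⟩ := exists_modulus hcont T hη
  refine ⟨min δ₁ 1, lt_min hδ₁ one_pos, fun δ hδ hlt s hs z hz => ?_⟩
  obtain ⟨hlt2, hlt3⟩ := lt_min_iff.1 hlt
  have hci : Continuous fun τ : ℝ => drift ε (H τ.toNNReal) z := by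
    have h1 : Continuous fun τ : ℝ => (τ.toNNReal, z) := by fun_prop
    simpa only [Function.comp_def] using hdc.comp h1
  have e2 : δ * drift ε (H s.toNNReal) z = ∫ τ in s..(s + δ), drift ε (H s.toNNReal) z := by
    rw [intervalIntegral.integral_const, add_sub_cancel_left, smul_eq_mul]
  rw [e2, ← intervalIntegral.integral_sub (hci.intervalIntegrable _ _)
    (continuous_const.intervalIntegrable _ _)]
  have h := intervalIntegral.norm_integral_le_of_norm_le_const (a := s) (b := s + δ) (C := η)
    (f := fun τ => drift ε (H τ.toNNReal) z - drift ε (H s.toNNReal) z) (fun τ hτ => by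
      rw [Set.uIoc_of_le (by linarith)] at hτ
      have := hB s hs z hz (τ - s) ⟨by linarith [hτ.1], by linarith [hτ.2]⟩ (by linarith [hτ.2])
      simp only [add_sub_cancel, add_zero] at this
      exact this)
  rw [add_sub_cancel_left, abs_of_nonneg hδ] at h
  exact h

theorem exists_drift_bound (hc : ∀ k : ℕ, k ≤ 2 → Continuous fun p : ℝ≥0 × Plane =>
      iteratedFDeriv ℝ k (lift (H p.1)) p.2) (ε T : ℝ) :
    ∃ B, ∀ s ∈ Set.Icc 0 T, ∀ z ∈ Metric.closedBall (0 : Plane) 1,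
      |coupling ε * drift ε (H s.toNNReal) z| ≤ B := by
  have hcont0 : Continuous fun q : ℝ × Plane => coupling ε * drift ε (H q.1.toNNReal) q.2 := by
    have h1 : Continuous fun q : ℝ × Plane => (q.1.toNNReal, q.2) := by fun_prop
    simpa only [Function.comp_def] using ((continuous_drift_of hc ε).comp h1).const_mul (coupling ε)
  obtain ⟨B, hB⟩ := (((isCompact_Icc (a := (0 : ℝ)) (b := T)).prod
    (isCompact_closedBall (0 : Plane) 1)).exists_bound_of_continuousOn hcont0.continuousOn)
  exact ⟨B, fun s hs z hz => hB (s, z) ⟨hs, hz⟩⟩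

theorem exists_one_step_cell (hC : ∀ t, ContDiff ℝ 2 (lift (H t)))
    (hc : ∀ k : ℕ, k ≤ 2 → Continuous fun p : ℝ≥0 × Plane =>
      iteratedFDeriv ℝ k (lift (H p.1)) p.2) (ε T : ℝ) {η : ℝ} (hη : 0 < η) :
    ∃ δ₀ > 0, ∀ δ, 0 ≤ δ → δ < δ₀ → ∀ s ∈ Set.Icc 0 T, ∀ z ∈ Metric.closedBall (0 : Plane) 1,
      |Real.log ((∑ e, Real.exp (coupling ε *
          (lift (H s.toNNReal) (z + step √δ e) - lift (H s.toNNReal) z))) / 4)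
        - coupling ε * ∫ τ in s..(s + δ), drift ε (H τ.toNNReal) z| ≤ η * δ := by
  -- The error is 2ζδ from taking the logarithm plus |λ|ζδ from freezing the drift in time.
  obtain ⟨ζ, hζ0, e3⟩ : ∃ ζ > 0, η = ζ * (2 + |coupling ε|) :=
    ⟨η / (2 + |coupling ε|), by positivity, by field_simp⟩
  obtain ⟨r₀, hr₀, hA⟩ := exists_step_expansion hC hc ε T hζ0
  obtain ⟨δ₁, hδ₁, hI⟩ := exists_integral_drift hc ε T hζ0
  obtain ⟨B, hB⟩ := exists_drift_bound hc ε T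
  have hBabs : 0 < |B| + ζ := by positivity
  have hpos : 0 < 1 / 2 / (|B| + ζ) := by positivity
  have hpos' : 0 < ζ / (2 * (|B| + ζ) ^ 2) := by positivity
  -- The square comes from r = √δ; the last two thresholds are the smallness conditions of
  -- `abs_log_sub_le`.
  refine ⟨min (min (r₀ ^ 2) δ₁) (min (1 / 2 / (|B| + ζ)) (ζ / (2 * (|B| + ζ) ^ 2))),
    lt_min (lt_min (pow_pos hr₀ 2) hδ₁) (lt_min hpos hpos'), fun δ hδ hlt s hs z hz => ?_⟩
  obtain ⟨hlt', hlt''⟩ := lt_min_iff.1 hlt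
  obtain ⟨hlt1, hlt2⟩ := lt_min_iff.1 hlt'
  obtain ⟨hlt4, hlt5⟩ := lt_min_iff.1 hlt''
  have h1 := hA s hs z hz √δ (Real.sqrt_nonneg _) ((Real.sqrt_lt' hr₀).2 hlt1)
  rw [Real.sq_sqrt hδ] at h1
  have h2 := abs_log_sub_le hδ h1 ((hB s hs z hz).trans (le_abs_self B))
    ((le_div_iff₀ hBabs).1 hlt4.le) ((le_div_iff₀ (by positivity)).1 hlt5.le)
  have h4 := mul_le_mul_of_nonneg_left (hI δ hδ hlt2 s hs z hz) (abs_nonneg (coupling ε))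
  rw [← abs_mul, mul_sub] at h4
  generalize (∫ τ in s..(s + δ), drift ε (H τ.toNNReal) z) = I at h4 ⊢
  generalize Real.log ((∑ e, Real.exp (coupling ε *
          (lift (H s.toNNReal) (z + step √δ e) - lift (H s.toNNReal) z))) / 4) = L at h2 ⊢
  have h5 := abs_le.1 h2
  have h6 := abs_le.1 h4
  rw [e3, abs_le]
  constructor <;> linarith

/-- One step of the scheme agrees with the evolution without noise up to `o(δ)`, uniformly. -/
theorem exists_one_step (hC : ∀ t, ContDiff ℝ 2 (lift (H t)))
    (hc : ∀ k : ℕ, k ≤ 2 → Continuous fun p : ℝ≥0 × Plane =>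
      iteratedFDeriv ℝ k (lift (H p.1)) p.2) (ε T : ℝ) {η : ℝ} (hη : 0 < η) :
    ∃ δ₀ > 0, ∀ δ, 0 ≤ δ → δ < δ₀ → ∀ s ∈ Set.Icc 0 T, ∀ z : Plane,
      |Real.log ((∑ e, Real.exp (coupling ε *
          (lift (H s.toNNReal) (z + step √δ e) - lift (H s.toNNReal) z))) / 4)
        - coupling ε * ∫ τ in s..(s + δ), drift ε (H τ.toNNReal) z| ≤ η * δ := by
  obtain ⟨δ₀, hδ₀, h⟩ := exists_one_step_cell hC hc ε T hη
  refine ⟨δ₀, hδ₀, fun δ hδ hlt s hs z => ?_⟩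
  have hzt : toTorus z = toTorus (cellRep (toTorus z)) := (toTorus_cellRep _).symm
  have e0 := lift_add_eq hzt (H s.toNNReal)
  have e00 : lift (H s.toNNReal) z = lift (H s.toNNReal) (cellRep (toTorus z)) := by
    simp only [lift, ← hzt]
  have e1 := fun τ : ℝ => drift_eq_of_toTorus_eq hzt ε (H τ.toNNReal)
  have := h δ hδ hlt s hs (cellRep (toTorus z)) (cellRep_mem_closedBall _)
  simp only [← e0, ← e00, ← e1] at this
  exact this

end OneStep

end KPZ

end

noncomputable section

namespace KPZ

/-! ### Convergence of the random walk scheme -/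

/-- The scheme is monotone and a constant added to the logarithm passes through an averaging step
unchanged, so one-step errors merely add up. The set Z restricts the comparison to points where the
equation is known to hold. -/
theorem abs_log_evolution_sub_le {G : Type*} [AddCommGroup G] {E : Type*} [Fintype E] [Nonempty E]
    {f : ℕ → G → ℝ} {σ : E → G} {V : ℕ → G → ℝ} {Z : Set G} (hZ : ∀ z ∈ Z, ∀ e, z + σ e ∈ Z)
    {n : ℕ} {κ : ℝ} (h0 : ∀ z ∈ Z, V 0 z = 0)
    (hstep : ∀ k < n, ∀ z ∈ Z, |Real.log ((∑ e, Real.exp (V k (z + σ e) - V k z)) / Fintype.card E)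
      - (V (k + 1) z - V k z - f k z)| ≤ κ) (k : ℕ) (hk : k ≤ n) (z : G) (hz : z ∈ Z) :
    |Real.log (evolution f σ k z) - V k z| ≤ k * κ := by
  have hcard : (0 : ℝ) < Fintype.card E := by exact_mod_cast Fintype.card_pos
  induction k generalizing z with
  | zero => simp [evolution, h0 z hz]
  | succ k ih =>
    set S : ℝ := (∑ e, Real.exp (V k (z + σ e) - V k z)) / Fintype.card E with hS
    have hSpos : 0 < S :=
      div_pos (Finset.sum_pos (fun _ _ => Real.exp_pos _) Finset.univ_nonempty) hcard
    set S' : ℝ := (∑ e, evolution f σ k (z + σ e)) / Fintype.card E with hS'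
    have hS'pos : 0 < S' :=
      div_pos (Finset.sum_pos (fun _ _ => evolution_pos _ _ _ _) Finset.univ_nonempty) hcard
    have ih' : ∀ e, |Real.log (evolution f σ k (z + σ e)) - V k (z + σ e)| ≤ k * κ := fun e =>
      ih (Nat.le_of_succ_le hk) _ (hZ z hz e)
    have hup : S' ≤ Real.exp (k * κ + V k z) * S := by
      rw [hS, hS', mul_div_assoc', Finset.mul_sum]
      refine div_le_div_of_nonneg_right (Finset.sum_le_sum fun e _ => ?_) hcard.le
      rw [← Real.exp_add, ← Real.log_le_iff_le_exp (evolution_pos _ _ _ _)]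
      linarith [(abs_le.1 (ih' e)).2]
    have hlow : Real.exp (-(k * κ) + V k z) * S ≤ S' := by
      rw [hS, hS', mul_div_assoc', Finset.mul_sum]
      refine div_le_div_of_nonneg_right (Finset.sum_le_sum fun e _ => ?_) hcard.le
      rw [← Real.exp_add, ← Real.le_log_iff_exp_le (evolution_pos _ _ _ _)]
      linarith [(abs_le.1 (ih' e)).1]
    have hup' := Real.log_le_log hS'pos hup
    have hlow' := Real.log_le_log (mul_pos (Real.exp_pos _) hSpos) hlow
    rw [Real.log_mul (Real.exp_pos _).ne' hSpos.ne', Real.log_exp] at hup' hlow'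
    have hst := abs_le.1 (hstep k hk z hz)
    rw [evolution, ← hS', Real.log_mul (Real.exp_pos _).ne' hS'pos.ne', Real.log_exp, abs_le]
    push_cast
    constructor <;> linarith [hst.1, hst.2]

section Limit

variable {Ω : Type*} [MeasurableSpace Ω] {P : Measure Ω}
  {W : ℝ≥0 → Lp ℝ 2 (volume : Measure Torus) → Ω → ℝ}

theorem IsCylindricalWiener.ae_zero (hW : IsCylindricalWiener W P)
    (f : Lp ℝ 2 (volume : Measure Torus)) : W 0 f =ᵐ[P] 0 := by
  have h2 := hW.covariance 0 0 f f
  rw [min_self, NNReal.coe_zero, zero_mul, integral_eq_zero_iff_of_nonneg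
    (fun ω => mul_self_nonneg _) (hW.integrable_mul (mem_noiseSpan _ _) (mem_noiseSpan _ _))] at h2
  filter_upwards [h2] with ω hω using by simpa using hω

/-- The point of the lattice of mesh `r` through `z` with coordinates `a`, `b`. -/
def latticePoint (z : Plane) (r : ℝ) (q : ℤ × ℤ) : Plane := z + !₂[r * q.1, r * q.2]

theorem latticePoint_add_step (z : Plane) (r : ℝ) (q : ℤ × ℤ) (e : Bool × Bool) :
    latticePoint z r q + step r e ∈ Set.range (latticePoint z r) := by
  refine ⟨(q.1 + if e.1 then 1 else -1, q.2 + if e.2 then 1 else -1), ?_⟩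
  ext i
  rcases e with ⟨e₁, e₂⟩
  fin_cases i
  · cases e₁ <;> simp [latticePoint, step, sgn] <;> ring
  · cases e₂ <;> simp [latticePoint, step, sgn] <;> ring

theorem mem_range_latticePoint (z : Plane) (r : ℝ) : z ∈ Set.range (latticePoint z r) := by
  refine ⟨0, ?_⟩
  ext i
  fin_cases i <;> simp [latticePoint]

variable {ρ : Mollifier} {ε θ : ℝ} {h : ℝ≥0 → Torus → Ω → ℝ}

/-- The solution is the almost sure limit of the random walk scheme. -/
theorem IsSolution.tendsto_log_evolution (hW : IsCylindricalWiener W P)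
    (hsol : IsSolution ρ W P ε θ h) (t : ℝ≥0) (z : Plane) :
    ∀ᵐ ω ∂P, Filter.Tendsto (fun n : ℕ => Real.log (evolution
      (noiseStep ρ W ε (coupling ε * √θ) (t / n) ω) (step √((t / n : ℝ≥0) : ℝ)) n z))
      Filter.atTop (nhds (coupling ε * h t (toTorus z) ω)) := by
  -- The exceptional null set of the equation depends on time and point; the grid times and lattice
  -- points of all the schemes together are countable, so one null set suffices.
  have heq : ∀ᵐ ω ∂P, ∀ (n k : ℕ) (q : ℤ × ℤ),
      h (k * (t / n)) (toTorus (latticePoint z √((t / n : ℝ≥0) : ℝ) q)) ω =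
      (∫ s in (0 : ℝ)..(k * (t / n) : ℝ≥0), drift ε (fun x => h s.toNNReal x ω)
        (latticePoint z √((t / n : ℝ≥0) : ℝ) q))
        + √θ * mollifiedNoise ρ W ε (k * (t / n))
          (toTorus (latticePoint z √((t / n : ℝ≥0) : ℝ) q)) ω :=
    ae_all_iff.2 fun n => ae_all_iff.2 fun k => ae_all_iff.2 fun q => hsol.equation _ _
  have hzero : ∀ᵐ ω ∂P, ∀ (n : ℕ) (q : ℤ × ℤ),
      mollifiedNoise ρ W ε 0 (toTorus (latticePoint z √((t / n : ℝ≥0) : ℝ) q)) ω = 0 :=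
    ae_all_iff.2 fun n => ae_all_iff.2 fun q => hW.ae_zero _
  filter_upwards [hsol.contDiff, hsol.continuous_derivatives, heq, hzero] with ω hC hc heq hzero
  set l := coupling ε with hl
  set H : ℝ≥0 → Torus → ℝ := fun s x => h s x ω with hH
  have hdrift : ∀ w : Plane, Continuous fun τ : ℝ => drift ε (H τ.toNNReal) w := fun w => by
    have h1 : Continuous fun τ : ℝ => (τ.toNNReal, w) := by fun_prop
    simpa only [Function.comp_def] using (continuous_drift_of hc ε).comp h1
  rw [Metric.tendsto_atTop']
  intro ζ hζ
  -- With relative error ζ/(t + 1) per unit time the accumulated error is ζt/(t + 1) < ζ, also when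
  -- t = 0.
  obtain ⟨δ₀, hδ₀, hone⟩ := exists_one_step hC hc ε t
    (div_pos hζ (by positivity : (0 : ℝ) < (t : ℝ) + 1))
  obtain ⟨n₀, hn₀⟩ := (((tendsto_const_div_atTop_nhds_zero_nat (t : ℝ)).eventually
    (gt_mem_nhds hδ₀)).and (Filter.eventually_gt_atTop 0)).exists_forall_of_atTop
  refine ⟨n₀, fun n hn => ?_⟩
  obtain ⟨hnδ, hnpos⟩ := hn₀ n hn.le
  have hn' : (n : ℝ≥0) ≠ 0 := by exact_mod_cast hnpos.ne'
  set δ : ℝ≥0 := t / n with hδ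
  have hnt : (n : ℝ≥0) * δ = t := mul_div_cancel₀ t hn'
  have hδr : (δ : ℝ) < δ₀ := by
    rw [hδ]; push_cast; exact hnδ
  have hbound := abs_log_evolution_sub_le (f := noiseStep ρ W ε (l * √θ) δ ω)
    (σ := step √(δ : ℝ)) (V := fun k w => l * lift (H (k * δ)) w)
    (Z := Set.range (latticePoint z √(δ : ℝ))) (n := n) (κ := ζ / (t + 1) * δ) ?_ ?_ ?_ n le_rfl z
    (mem_range_latticePoint z _)
  · rw [hnt] at hbound
    rw [Real.dist_eq]
    refine hbound.trans_lt ?_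
    have e1 : (n : ℝ) * (δ : ℝ) = t := by exact_mod_cast congrArg NNReal.toReal hnt
    have e2 : (n : ℝ) * (ζ / (t + 1) * δ) = ζ / (t + 1) * t := by rw [← e1]; ring
    rw [e2, div_mul_eq_mul_div, div_lt_iff₀ (by positivity)]
    nlinarith
  · rintro _ ⟨q, rfl⟩ e
    exact latticePoint_add_step z _ q e
  · rintro _ ⟨q, rfl⟩
    have h1 := heq n 0 q
    have h2 := hzero n q
    simp only [Nat.cast_zero, zero_mul, NNReal.coe_zero, intervalIntegral.integral_same,
      zero_add] at h1 ⊢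
    rw [h2, mul_zero] at h1
    have h3 : h 0 (toTorus (latticePoint z √(δ : ℝ) q)) ω = 0 := h1
    simp only [lift, hH, h3, mul_zero]
  · rintro k hk _ ⟨q, rfl⟩
    set w := latticePoint z √(δ : ℝ) q with hw
    have h1 := heq n k q
    have h2 := heq n (k + 1) q
    have hs : ((k * δ : ℝ≥0) : ℝ) ∈ Set.Icc (0 : ℝ) t := by
      refine ⟨NNReal.coe_nonneg _, ?_⟩
      rw [← hnt]
      exact_mod_cast mul_le_mul_of_nonneg_right (Nat.cast_le.2 hk.le) (zero_le (a := δ))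
    have h3 := hone δ δ.2 hδr _ hs w
    rw [Real.toNNReal_coe] at h3
    have e1 : ((k * δ : ℝ≥0) : ℝ) + δ = (((k + 1 : ℕ) * δ : ℝ≥0) : ℝ) := by push_cast; ring
    rw [e1, ← intervalIntegral.integral_interval_sub_left ((hdrift w).intervalIntegrable 0 _)
      ((hdrift w).intervalIntegrable 0 _)] at h3
    have e2 : l * lift (H ((k + 1 : ℕ) * δ)) w - l * lift (H (k * δ)) w
        - noiseStep ρ W ε (l * √θ) δ ω k w
        = l * ((∫ τ in (0 : ℝ)..((k + 1 : ℕ) * δ : ℝ≥0), drift ε (H τ.toNNReal) w)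
          - ∫ τ in (0 : ℝ)..(k * δ : ℝ≥0), drift ε (H τ.toNNReal) w) := by
      have h1' : lift (H (k * δ)) w = _ := h1
      have h2' : lift (H ((k + 1 : ℕ) * δ)) w = _ := h2
      rw [h1', h2', noiseStep]
      ring
    have e3 : ∀ e, l * lift (H (k * δ)) (w + step √(δ : ℝ) e) - l * lift (H (k * δ)) w
        = l * (lift (H (k * δ)) (w + step √(δ : ℝ) e) - lift (H (k * δ)) w) := fun e => by ring
    have e4 : (Fintype.card (Bool × Bool) : ℝ) = 4 := by norm_num [Fintype.card_prod]
    rw [e2, e4]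
    simp only [e3]
    exact h3

end Limit

end KPZ

end

noncomputable section

namespace KPZ

/-! ### Laws and limits of Gaussian free energies -/

section Law

variable {Ω : Type*} [MeasurableSpace Ω] {P : Measure Ω} {J : Type*} [Fintype J]

theorem integral_sum_sq {X : J → Ω → ℝ} (hX : HasGaussianLaw (fun ω j => X j ω) P)
    (a : J → ℝ) :
    ∫ ω, (∑ j, a j * X j ω) ^ 2 ∂P = ∑ i, ∑ j, a i * a j * ∫ ω, X i ω * X j ω ∂P := by
  have hint : ∀ i j, Integrable (fun ω => a i * a j * (X i ω * X j ω)) P := fun i j =>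
    ((hX.eval i).memLp_two.integrable_mul (hX.eval j).memLp_two).const_mul _
  have e : ∀ ω, (∑ j, a j * X j ω) ^ 2 = ∑ i, ∑ j, a i * a j * (X i ω * X j ω) := fun ω => by
    rw [sq, Finset.sum_mul_sum]
    exact Finset.sum_congr rfl fun i _ => Finset.sum_congr rfl fun j _ => by ring
  simp only [e]
  rw [integral_finsetSum _ fun i _ => integrable_finsetSum _ fun j _ => hint i j]
  refine Finset.sum_congr rfl fun i _ => ?_
  rw [integral_finsetSum _ fun j _ => hint i j]
  exact Finset.sum_congr rfl fun j _ => integral_const_mul _ _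

/-- The law of a centred Gaussian vector is determined by its covariances. -/
theorem map_eq_of_covariance_eq {X Y : J → Ω → ℝ} (hX : HasGaussianLaw (fun ω j => X j ω) P)
    (hY : HasGaussianLaw (fun ω j => Y j ω) P) (hX0 : ∀ j, ∫ ω, X j ω ∂P = 0)
    (hY0 : ∀ j, ∫ ω, Y j ω ∂P = 0)
    (hXY : ∀ i j, ∫ ω, X i ω * X j ω ∂P = ∫ ω, Y i ω * Y j ω ∂P) :
    P.map (fun ω j => X j ω) = P.map fun ω j => Y j ω := by
  classical
  have hP := hX.isProbabilityMeasure
  have key : ∀ {Z : J → Ω → ℝ} (_ : HasGaussianLaw (fun ω j => Z j ω) P)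
      (_ : ∀ j, ∫ ω, Z j ω ∂P = 0) (L : StrongDual ℝ (J → ℝ)),
      charFunDual (P.map fun ω j => Z j ω) L = Complex.exp (-((∑ i, ∑ j, L (Pi.single i 1) *
        L (Pi.single j 1) * ∫ ω, Z i ω * Z j ω ∂P : ℝ) : ℂ) / 2) := by
    intro Z hZ hZ0 L
    have hL : ∀ ω, L (fun j => Z j ω) = ∑ j, L (Pi.single j 1) * Z j ω := fun ω => by
      conv_lhs => rw [pi_eq_sum_univ' (fun j => Z j ω)]
      rw [map_sum]
      refine Finset.sum_congr rfl fun j _ => ?_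
      rw [map_smul, smul_eq_mul, mul_comm]
    have hint : ∀ j, Integrable (fun ω => L (Pi.single j 1) * Z j ω) P := fun j =>
      (hZ.eval j).integrable.const_mul _
    have hmean : ∫ ω, L (fun j => Z j ω) ∂P = 0 := by
      simp only [hL]
      rw [integral_finsetSum _ fun j _ => hint j]
      simp [integral_const_mul, hZ0]
    rw [hZ.charFunDual_map_eq_fun, hmean, variance_of_integral_eq_zero _ hmean]
    · simp only [hL, integral_sum_sq hZ]
      simp [neg_div]
    · exact L.continuous.measurable.comp_aemeasurable hZ.aemeasurable
  have h1 := hX.isGaussian_map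
  have h2 := hY.isGaussian_map
  refine Measure.ext_of_charFunDual (funext fun L => ?_)
  rw [key hX hX0, key hY hY0]
  simp only [hXY]

theorem integral_exp_gaussian {X : Ω → ℝ} (hX : HasGaussianLaw X P) (h0 : ∫ ω, X ω ∂P = 0) {N : ℝ}
    (hN : ∫ ω, X ω * X ω ∂P = N) :
    Integrable (fun ω => Real.exp (X ω)) P ∧ ∫ ω, Real.exp (X ω) ∂P = Real.exp (N / 2) := by
  have h2 : Var[X; P] = N := by
    rw [variance_of_integral_eq_zero hX.aemeasurable h0, ← hN]
    simp only [sq]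
  have h3 := mgf_gaussianReal hX.map_eq_gaussianReal 1
  have hN0 : 0 ≤ N := h2 ▸ variance_nonneg _ _
  rw [h0, h2, zero_mul, zero_add, one_pow, mul_one, Real.coe_toNNReal _ hN0, mgf] at h3
  simp only [one_mul] at h3
  exact ⟨Integrable.of_integral_ne_zero (h3.trans_ne (Real.exp_pos _).ne'), h3⟩

/-- Almost sure convergence implies convergence in law, and limits in law are unique. -/
theorem map_eq_of_ae_tendsto [IsProbabilityMeasure P] {F G : ℕ → Ω → ℝ} {f g : Ω → ℝ}
    (hF : ∀ n, AEMeasurable (F n) P) (hG : ∀ n, AEMeasurable (G n) P) (hf : AEMeasurable f P)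
    (hg : AEMeasurable g P) (hFf : ∀ᵐ ω ∂P, Filter.Tendsto (F · ω) Filter.atTop (nhds (f ω)))
    (hGg : ∀ᵐ ω ∂P, Filter.Tendsto (G · ω) Filter.atTop (nhds (g ω)))
    (hFG : ∀ n, P.map (F n) = P.map (G n)) : P.map f = P.map g := by
  have h2 := tendstoInDistribution_of_ae_tendsto hG hg hGg
  refine tendstoInDistribution_unique F (tendstoInDistribution_of_ae_tendsto hF hf hFf)
    ⟨hF, hg, ?_⟩
  refine h2.tendsto.congr fun n => ?_
  exact Subtype.ext (hFG n).symm

/-- Fatou's lemma for random variables with bounded exponential moments and expectations bounded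
below. -/
theorem integrable_of_ae_tendsto_of_integral_exp_le [IsProbabilityMeasure P] {F : ℕ → Ω → ℝ}
    {f : Ω → ℝ} {C : ℝ} (hF : ∀ n, Integrable (F n) P)
    (hexp : ∀ᶠ n in Filter.atTop, Integrable (fun ω => Real.exp (F n ω)) P ∧
      ∫ ω, Real.exp (F n ω) ∂P ≤ 1)
    (hC : ∀ᶠ n in Filter.atTop, -C ≤ ∫ ω, F n ω ∂P)
    (hFf : ∀ᵐ ω ∂P, Filter.Tendsto (F · ω) Filter.atTop (nhds (f ω))) :
    Integrable f P ∧ |∫ ω, f ω ∂P| ≤ 2 + C := by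
  have hbound : ∀ᶠ n in Filter.atTop, eLpNorm (F n) 1 P ≤ ENNReal.ofReal (2 + C) := by
    filter_upwards [hexp, hC] with n ⟨h1, h2⟩ h3
    rw [eLpNorm_one_eq_lintegral_enorm, ← ofReal_integral_norm_eq_lintegral_enorm (hF n)]
    refine ENNReal.ofReal_le_ofReal ?_
    -- The elementary bound |x| ≤ 2eˣ − x turns the exponential moment and the lower bound on the
    -- mean into an L¹ bound.
    have h4 : ∫ ω, ‖F n ω‖ ∂P ≤ ∫ ω, (2 * Real.exp (F n ω) - F n ω) ∂P := by
      refine integral_mono (hF n).norm ((h1.const_mul 2).sub (hF n)) fun ω => ?_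
      have h5 := Real.add_one_le_exp (F n ω)
      have h6 := Real.exp_pos (F n ω)
      rw [Real.norm_eq_abs, abs_le']
      constructor <;> linarith
    rw [integral_sub (h1.const_mul 2) (hF n), integral_const_mul] at h4
    linarith
  have hmeas : AEStronglyMeasurable f P :=
    aestronglyMeasurable_of_tendsto_ae _ (fun n => (hF n).aestronglyMeasurable) hFf
  have hlim : eLpNorm f 1 P ≤ ENNReal.ofReal (2 + C) :=
    (Lp.eLpNorm_lim_le_liminf_eLpNorm (fun n => (hF n).aestronglyMeasurable) f hFf).trans
      (Filter.liminf_le_of_frequently_le' hbound.frequently)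
  have hint : Integrable f P :=
    memLp_one_iff_integrable.1 ⟨hmeas, hlim.trans_lt ENNReal.ofReal_lt_top⟩
  refine ⟨hint, ?_⟩
  have h0 : 0 ≤ 2 + C := by
    obtain ⟨n, ⟨h1, h2⟩, h3⟩ := (hexp.and hC).exists
    have := integral_mono (hF n) h1 fun ω => by linarith [Real.add_one_le_exp (F n ω)]
    linarith
  rw [eLpNorm_one_eq_lintegral_enorm, ← ofReal_integral_norm_eq_lintegral_enorm hint,
    ENNReal.ofReal_le_ofReal_iff h0] at hlim
  exact (norm_integral_le_integral_norm f).trans hlim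

end Law

section Paths

variable {G : Type*} [AddCommGroup G] {E : Type*}

theorem log_evolution_add [Fintype E] [Nonempty E] (f : ℕ → G → ℝ) (σ : E → G) (n : ℕ) (z : G)
    (a : ℝ) :
    Real.log (evolution f σ n z) + a
      = lse fun p : Fin n → E =>
          pathEnergy f σ n p z + (-Real.log (Fintype.card (Fin n → E)) + a) := by
  have hcard : (0 : ℝ) < (Fintype.card E : ℝ) ^ n :=
    pow_pos (by exact_mod_cast Fintype.card_pos) _
  rw [lse_add_const, evolution_eq_sum, Real.log_div (sum_exp_pos _).ne' hcard.ne', lse,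
    Fintype.card_fun, Fintype.card_fin]
  push_cast
  ring

theorem pathEnergy_nonneg {f : ℕ → G → ℝ} (hf : ∀ k z, 0 ≤ f k z) (σ : E → G) (n : ℕ)
    (p : Fin n → E) (z : G) : 0 ≤ pathEnergy f σ n p z := by
  induction n generalizing z with
  | zero => exact le_rfl
  | succ n ih => exact add_nonneg (hf _ _) (ih _ _)

/-- The difference of a walk with itself stays at 0; thus all paths have the same variance. -/
theorem pathEnergy_diag (V : G → ℝ) (σ : E → G) (n : ℕ) (p : Fin n → E) :
    pathEnergy (fun _ y => V y) (fun q : E × E => σ q.1 - σ q.2) n (fun i => (p i, p i)) 0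
      = n * V 0 := by
  induction n with
  | zero => simp [pathEnergy]
  | succ n ih =>
    have := ih (Fin.tail p)
    simp only [pathEnergy, sub_self, add_zero]
    rw [show Fin.tail (fun i => (p i, p i)) = fun i => (Fin.tail p i, Fin.tail p i) from rfl, this]
    push_cast
    ring

end Paths

section Scheme

variable {Ω : Type*} {W : ℝ≥0 → Lp ℝ 2 (volume : Measure Torus) → Ω → ℝ} {E : Type*}
variable (ρ : Mollifier) (ε c : ℝ) (δ : ℝ≥0) (σ : E → Plane) (n : ℕ) (z : Plane)

theorem IsCylindricalWiener.variance_pathEnergy [MeasurableSpace Ω] {P : Measure Ω}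
    (hW : IsCylindricalWiener W P) (p : Fin n → E) :
    ∫ ω, pathEnergy (noiseStep ρ W ε c δ ω) σ n p z *
      pathEnergy (noiseStep ρ W ε c δ ω) σ n p z ∂P = n * (c ^ 2 * δ * ρ.corr ε 0) := by
  rw [hW.covariance_pathEnergy, sub_self,
    pathEnergy_diag (fun y => c ^ 2 * (δ : ℝ) * ρ.corr ε y)]

variable [Fintype E]

/-- The logarithm of the random walk scheme, recentred by half the variance. -/
def freeEnergy (ρ : Mollifier) (W : ℝ≥0 → Lp ℝ 2 (volume : Measure Torus) → Ω → ℝ) (ε c : ℝ)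
    (δ : ℝ≥0) (σ : E → Plane) (n : ℕ) (z : Plane) (ω : Ω) : ℝ :=
  Real.log (evolution (noiseStep ρ W ε c δ ω) σ n z) + -(n * (c ^ 2 * δ * ρ.corr ε 0) / 2)

theorem freeEnergy_eq_lse [Nonempty E] (ω : Ω) : freeEnergy ρ W ε c δ σ n z ω =
    lse fun p : Fin n → E => pathEnergy (noiseStep ρ W ε c δ ω) σ n p z +
      (-Real.log (Fintype.card (Fin n → E)) - n * (c ^ 2 * δ * ρ.corr ε 0) / 2) := by
  rw [freeEnergy, log_evolution_add, sub_eq_add_neg]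

variable [MeasurableSpace Ω] {P : Measure Ω}

theorem IsCylindricalWiener.integrable_freeEnergy [Nonempty E] [IsProbabilityMeasure P]
    (hW : IsCylindricalWiener W P) :
    Integrable (freeEnergy ρ W ε c δ σ n z) P := by
  simp only [funext (freeEnergy_eq_lse (W := W) ρ ε c δ σ n z)]
  exact integrable_lse fun p => (hW.integrable (pathEnergy_mem ρ ε c δ σ n p z)).add
    (integrable_const _)

/-- Half the common variance is precisely what normalises the Gaussian exponential along each path.
-/
theorem IsCylindricalWiener.integral_exp_freeEnergy [Nonempty E]
    (hW : IsCylindricalWiener W P) :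
    Integrable (fun ω => Real.exp (freeEnergy ρ W ε c δ σ n z ω)) P ∧
      ∫ ω, Real.exp (freeEnergy ρ W ε c δ σ n z ω) ∂P = 1 := by
  have hcard : (0 : ℝ) < Fintype.card (Fin n → E) := by exact_mod_cast Fintype.card_pos
  have h1 := fun p : Fin n → E => integral_exp_gaussian
    ((hW.hasGaussianLaw fun p : Fin n → E => pathEnergy_mem ρ ε c δ σ n p z).eval p)
    (hW.integral_eq_zero (pathEnergy_mem ρ ε c δ σ n p z)) (hW.variance_pathEnergy ρ ε c δ σ n z p)
  simp only [freeEnergy_eq_lse, exp_lse, Real.exp_add]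
  refine ⟨integrable_finsetSum _ fun p _ => (h1 p).1.mul_const _, ?_⟩
  rw [integral_finsetSum _ fun p _ => (h1 p).1.mul_const _]
  simp only [integral_mul_const, (h1 _).2]
  rw [Finset.sum_const, Finset.card_univ, nsmul_eq_mul, ← Real.exp_add,
    add_sub_cancel, Real.exp_neg, Real.exp_log hcard, mul_inv_cancel₀ hcard.ne']

theorem IsCylindricalWiener.neg_half_variance_le_freeEnergy [Nonempty E] [IsProbabilityMeasure P]
    (hW : IsCylindricalWiener W P) :
    -(n * (c ^ 2 * δ * ρ.corr ε 0) / 2) ≤ ∫ ω, freeEnergy ρ W ε c δ σ n z ω ∂P := by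
  simp only [freeEnergy_eq_lse]
  exact neg_half_variance_le_integral_lse
    (fun p => hW.integrable (pathEnergy_mem ρ ε c δ σ n p z))
    (fun p => hW.integral_eq_zero (pathEnergy_mem ρ ε c δ σ n p z)) _

/-- The replica bound, with the exponential overlap moment estimated by 2 through the Khas'minskii
argument at coupling a = 2c²δ. -/
theorem IsCylindricalWiener.neg_log_two_le_freeEnergy [Nonempty E]
    (hW : IsCylindricalWiener W P)
    (h1 : 2 * (c ^ 2 * δ) * ρ.corr ε 0 ≤ 1)
    (h2 : ∀ k ≤ n, ∀ y, 4 * (2 * (c ^ 2 * δ)) *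
      green (ρ.corr ε) (fun q : E × E => σ q.1 - σ q.2) k y ≤ 1) :
    -((Real.exp 1 - 1) / 2 * Real.log 2) ≤ ∫ ω, freeEnergy ρ W ε c δ σ n z ω ∂P := by
  have hpos : 0 ≤ c ^ 2 * (δ : ℝ) := by positivity
  have h := neg_log_overlap_le_integral_lse
    (hW.hasGaussianLaw fun p : Fin n → E => pathEnergy_mem ρ ε c δ σ n p z)
    (fun p => hW.integral_eq_zero (pathEnergy_mem ρ ε c δ σ n p z))
    (fun p p' => hW.covariance_pathEnergy ρ ε c δ σ n p p' z z)
    (fun p p' => pathEnergy_nonneg (fun _ y => mul_nonneg hpos (ρ.corr_nonneg ε y)) _ _ _ _)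
    (N := n * (c ^ 2 * δ * ρ.corr ε 0))
    (fun p => by rw [sub_self, pathEnergy_diag (fun y => c ^ 2 * (δ : ℝ) * ρ.corr ε y)])
  simp only [sub_self] at h
  rw [sum_pair_exp_pathEnergy] at h
  simp only [freeEnergy_eq_lse]
  refine le_trans ?_ h
  rw [neg_mul, neg_le_neg_iff]
  refine mul_le_mul_of_nonneg_left (Real.log_le_log (evolution_pos _ _ _ _) ?_)
    (by linarith [Real.add_one_le_exp 1])
  exact evolution_le_two (ρ.corr_nonneg ε) _ (by positivity)
    (fun y => (mul_le_mul_of_nonneg_left (ρ.corr_le ε y) (by positivity)).trans h1) h2 _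

/-- The law of the scheme does not depend on the base point. -/
theorem IsCylindricalWiener.map_freeEnergy_eq [Nonempty E]
    (hW : IsCylindricalWiener W P) (z' : Plane) :
    P.map (freeEnergy ρ W ε c δ σ n z) = P.map (freeEnergy ρ W ε c δ σ n z') := by
  have hX := fun z => hW.hasGaussianLaw fun p : Fin n → E => pathEnergy_mem ρ ε c δ σ n p z
  have h := map_eq_of_covariance_eq (hX z) (hX z')
    (fun p => hW.integral_eq_zero (pathEnergy_mem ρ ε c δ σ n p z))
    (fun p => hW.integral_eq_zero (pathEnergy_mem ρ ε c δ σ n p z'))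
    fun p p' => by rw [hW.covariance_pathEnergy, hW.covariance_pathEnergy, sub_self, sub_self]
  set Φ : ((Fin n → E) → ℝ) → ℝ := fun y => lse fun p => y p +
    (-Real.log (Fintype.card (Fin n → E)) - n * (c ^ 2 * δ * ρ.corr ε 0) / 2) with hΦ
  have hΦm : Measurable Φ := (continuous_lse.comp (by fun_prop)).measurable
  have e : ∀ z, P.map (freeEnergy ρ W ε c δ σ n z) = (P.map fun ω (p : Fin n → E) =>
      pathEnergy (noiseStep ρ W ε c δ ω) σ n p z).map Φ := fun z => by
    rw [AEMeasurable.map_map_of_aemeasurable hΦm.aemeasurable (hX z).aemeasurable]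
    exact congrArg P.map (funext fun ω => freeEnergy_eq_lse ρ ε c δ σ n z ω)
  rw [e, e, h]

end Scheme

end KPZ

end

noncomputable section

namespace KPZ

/-! ### The expectation of the solution -/

section Solution

variable {Ω : Type*} [MeasurableSpace Ω] {P : Measure Ω}
  {W : ℝ≥0 → Lp ℝ 2 (volume : Measure Torus) → Ω → ℝ} {ρ : Mollifier} {ε θ : ℝ}
  {h : ℝ≥0 → Torus → Ω → ℝ}

theorem coupling_sq (ε : ℝ) : coupling ε ^ 2 = |Real.log ε|⁻¹ := by
  rw [coupling, ← Real.rpow_natCast, ← Real.rpow_mul (abs_nonneg _), ← Real.rpow_neg_one]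
  norm_num

theorem natCast_mul_variance_step (hθ : 0 ≤ θ) (t : ℝ≥0) {n : ℕ} (hn : 0 < n) :
    (n : ℝ) * ((coupling ε * √θ) ^ 2 * (t / n : ℝ≥0) * ρ.corr ε 0)
      = coupling ε ^ 2 * θ * t * ρ.corr ε 0 := by
  have : (n : ℝ) ≠ 0 := by exact_mod_cast hn.ne'
  rw [mul_pow, Real.sq_sqrt hθ]
  push_cast
  field_simp

theorem IsSolution.tendsto_freeEnergy (hW : IsCylindricalWiener W P)
    (hsol : IsSolution ρ W P ε θ h) (hθ : 0 ≤ θ) (t : ℝ≥0) (z : Plane) :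
    ∀ᵐ ω ∂P, Filter.Tendsto (fun n : ℕ => freeEnergy ρ W ε (coupling ε * √θ) (t / n)
      (step √((t / n : ℝ≥0) : ℝ)) n z ω) Filter.atTop
      (nhds (coupling ε * h t (toTorus z) ω - coupling ε ^ 2 * θ * t * ρ.corr ε 0 / 2)) := by
  filter_upwards [hsol.tendsto_log_evolution hW t z] with ω hω
  refine (hω.sub_const _).congr' ?_
  filter_upwards [Filter.eventually_gt_atTop 0] with n hn
  rw [freeEnergy, natCast_mul_variance_step hθ t hn, sub_eq_add_neg]

/-- Fatou's lemma along the scheme: any eventual lower bound on the mean discrete free energies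
yields integrability and a two-sided bound for the solution. -/
theorem IsSolution.integrable_of_le_freeEnergy [IsProbabilityMeasure P]
    (hW : IsCylindricalWiener W P) (hsol : IsSolution ρ W P ε θ h) (hε : ε ∈ Set.Ioo (0 : ℝ) 1)
    (hθ : 0 ≤ θ) (t : ℝ≥0) (z : Plane) {C : ℝ}
    (hC : ∀ᶠ n : ℕ in Filter.atTop, -C ≤ ∫ ω, freeEnergy ρ W ε (coupling ε * √θ) (t / n)
      (step √((t / n : ℝ≥0) : ℝ)) n z ω ∂P) :
    Integrable (h t (toTorus z)) P ∧
      |coupling ε * ∫ ω, h t (toTorus z) ω ∂P - coupling ε ^ 2 * θ * t * ρ.corr ε 0 / 2|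
        ≤ 2 + C := by
  obtain ⟨h1, h2⟩ := integrable_of_ae_tendsto_of_integral_exp_le
    (fun n : ℕ => hW.integrable_freeEnergy ρ ε (coupling ε * √θ) (t / n)
      (step √((t / n : ℝ≥0) : ℝ)) n z)
    (Filter.Eventually.of_forall fun n => (hW.integral_exp_freeEnergy ρ ε (coupling ε * √θ) (t / n)
      (step √((t / n : ℝ≥0) : ℝ)) n z).imp_right le_of_eq) hC
    (hsol.tendsto_freeEnergy hW hθ t z)
  have h3 : Integrable (h t (toTorus z)) P := by
    have h4 := (h1.add (integrable_const (coupling ε ^ 2 * θ * t * ρ.corr ε 0 / 2))).const_mul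
      (coupling ε)⁻¹
    refine h4.congr (Filter.Eventually.of_forall fun ω => ?_)
    simp only [Pi.add_apply, sub_add_cancel]
    exact inv_mul_cancel_left₀ (coupling_pos hε).ne' _
  refine ⟨h3, ?_⟩
  rwa [integral_sub (h3.const_mul _) (integrable_const _), integral_const_mul, integral_const,
    probReal_univ, one_smul] at h2

theorem IsSolution.integrable [IsProbabilityMeasure P]
    (hW : IsCylindricalWiener W P) (hsol : IsSolution ρ W P ε θ h) (hε : ε ∈ Set.Ioo (0 : ℝ) 1)
    (hθ : 0 ≤ θ) (t : ℝ≥0) (z : Plane) :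
    Integrable (h t (toTorus z)) P ∧
      |coupling ε * ∫ ω, h t (toTorus z) ω ∂P - coupling ε ^ 2 * θ * t * ρ.corr ε 0 / 2|
        ≤ 2 + coupling ε ^ 2 * θ * t * ρ.corr ε 0 / 2 := by
  refine hsol.integrable_of_le_freeEnergy hW hε hθ t z ?_
  filter_upwards [Filter.eventually_gt_atTop 0] with n hn
  have := hW.neg_half_variance_le_freeEnergy ρ ε (coupling ε * √θ) (t / n)
      (step √((t / n : ℝ≥0) : ℝ)) n z
  rwa [natCast_mul_variance_step hθ t hn] at this

/-- The schemes based at z and z' are equal in law for each n, hence so are their almost sure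
limits. -/
theorem IsSolution.integral_eq [IsProbabilityMeasure P]
    (hW : IsCylindricalWiener W P) (hsol : IsSolution ρ W P ε θ h) (hε : ε ∈ Set.Ioo (0 : ℝ) 1)
    (hθ : 0 ≤ θ) (t : ℝ≥0) (z z' : Plane) :
    ∫ ω, h t (toTorus z) ω ∂P = ∫ ω, h t (toTorus z') ω ∂P := by
  have hl := coupling_pos hε
  set f : Plane → Ω → ℝ := fun z ω =>
    coupling ε * h t (toTorus z) ω - coupling ε ^ 2 * θ * t * ρ.corr ε 0 / 2 with hf
  have hfm : ∀ z, AEMeasurable (f z) P := fun z =>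
    ((hsol.aemeasurable t (toTorus z)).const_mul _).sub_const _
  have hFm := fun z (n : ℕ) => (hW.integrable_freeEnergy ρ ε (coupling ε * √θ) (t / n)
      (step √((t / n : ℝ≥0) : ℝ)) n z).aestronglyMeasurable.aemeasurable
  have h1 : P.map (f z) = P.map (f z') := map_eq_of_ae_tendsto (hFm z) (hFm z') (hfm z) (hfm z')
    (hsol.tendsto_freeEnergy hW hθ t z) (hsol.tendsto_freeEnergy hW hθ t z')
    fun n => hW.map_freeEnergy_eq ρ ε _ _ _ n z z'
  have h2 : ∀ z, ∫ ω, f z ω ∂P = coupling ε * ∫ ω, h t (toTorus z) ω ∂P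
      - coupling ε ^ 2 * θ * t * ρ.corr ε 0 / 2 := fun z => by
    rw [hf, integral_sub ((hsol.integrable hW hε hθ t z).1.const_mul _) (integrable_const _),
      integral_const_mul, integral_const, probReal_univ, one_smul]
  have h3 : ∫ ω, f z ω ∂P = ∫ ω, f z' ω ∂P := by
    have e : ∀ z, ∫ ω, f z ω ∂P = ∫ x, x ∂(P.map (f z)) := fun z =>
      (integral_map (hfm z) aestronglyMeasurable_id).symm
    rw [e, e, h1]
  rw [h2, h2] at h3
  exact mul_left_cancel₀ hl.ne' (sub_left_inj.1 h3)

/-- The bound on the Green function gives the sharp estimate of the expectation. -/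
theorem IsSolution.abs_integral_sub_le [IsProbabilityMeasure P]
    (hW : IsCylindricalWiener W P) (hsol : IsSolution ρ W P ε θ h) (hε : ε ∈ Set.Ioo (0 : ℝ) 1)
    (hθ : 0 ≤ θ) {t : ℝ≥0} (ht : 0 < t) (z : Plane) {N : ℕ} (hN : 0 < N)
    (hsmall : 8 * θ * coupling ε ^ 2 *
      (1 + (2 * t + 4 / Real.pi ^ 2 * (1 + Real.log N) + ρ.corr ε 0 / N ^ 2)) ≤ 1) :
    |coupling ε * ∫ ω, h t (toTorus z) ω ∂P - coupling ε ^ 2 * θ * t * ρ.corr ε 0 / 2|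
        ≤ 2 + (Real.exp 1 - 1) / 2 * Real.log 2 := by
  refine (hsol.integrable_of_le_freeEnergy hW hε hθ t z ?_).2
  have hgreen := eventually_green_le (A := fun m => ‖ρ.coeff ε m‖ ^ 2) (V := ρ.corr ε)
    (fun m => sq_nonneg _) (fun m => pow_le_one₀ (norm_nonneg _) (ρ.norm_coeff_le hε m))
    (ρ.hasSum_coeff_sq ε) (ρ.hasSum_corr ε) (t := t) (by exact_mod_cast ht) hN
  -- The potential collected in a single time step vanishes as n grows, which gives the condition aV
  -- ≤ 1 at fixed ε.
  have hlim : Filter.Tendsto (fun n : ℕ => 2 * coupling ε ^ 2 * θ * ρ.corr ε 0 * t / (n : ℝ))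
    Filter.atTop (nhds 0) := tendsto_const_div_atTop_nhds_zero_nat _
  filter_upwards [hgreen, hlim.eventually (ge_mem_nhds one_pos)] with n hn hn1
  have e : (coupling ε * √θ) ^ 2 * ((t / n : ℝ≥0) : ℝ) = coupling ε ^ 2 * θ * (t / n) := by
    rw [mul_pow, Real.sq_sqrt hθ]
    push_cast
    rfl
  have et : ((t / n : ℝ≥0) : ℝ) = t / n := by push_cast; rfl
  refine hW.neg_log_two_le_freeEnergy ρ ε _ _ _ n z ?_ fun k hk y => ?_
  · rw [e]
    refine le_trans (le_of_eq ?_) hn1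
    ring
  · rw [e, et]
    have h1 := mul_le_mul_of_nonneg_left (hn k hk y)
      (by positivity : 0 ≤ 8 * θ * coupling ε ^ 2)
    refine le_trans (le_of_eq ?_) (h1.trans hsmall)
    ring

/-- The smallness condition holds near `ε = 0` with `N = ⌈1/ε⌉`. -/
theorem eventually_small (ρ : Mollifier) (hθ : 0 ≤ θ) (hθ' : θ ≤ 1 / 100) (t : ℝ) :
    ∀ᶠ ε in nhdsWithin (0 : ℝ) (Set.Ioi 0), 8 * θ * coupling ε ^ 2 *
      (1 + (2 * t + 4 / Real.pi ^ 2 * (1 + Real.log ⌈ε⁻¹⌉₊) +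
        ρ.corr ε 0 / (⌈ε⁻¹⌉₊ : ℝ) ^ 2)) ≤ 1 := by
  have hρ : 0 ≤ ∫ x, ρ.toFun x ^ 2 := integral_nonneg fun x => sq_nonneg _
  -- Makes l = −log ε dominate all constants, including t and ‖ρ‖², so that the bracket is at most
  -- 2l.
  have hlog := Real.tendsto_log_nhdsGT_zero.eventually
    (Filter.eventually_le_atBot (-(1 + 2 * |t| + 2 + ∫ x, ρ.toFun x ^ 2)))
  filter_upwards [hlog, Ioo_mem_nhdsGT one_pos] with ε hl hε
  have hneg : Real.log ε < 0 := Real.log_neg hε.1 hε.2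
  set l : ℝ := -Real.log ε with hldef
  have hlpos : 0 < l := by linarith
  have hceil : ε⁻¹ ≤ (⌈ε⁻¹⌉₊ : ℝ) := Nat.le_ceil _
  have hinv : 1 < ε⁻¹ := (one_lt_inv₀ hε.1).2 hε.2
  -- From ⌈1/ε⌉ < 1/ε + 1 ≤ 2/ε and 2 ≤ e; the factor e costs exactly 1 in the logarithm.
  have hceil' : (⌈ε⁻¹⌉₊ : ℝ) ≤ ε⁻¹ * Real.exp 1 := by
    have h1 := Nat.ceil_lt_add_one (inv_nonneg.2 hε.1.le)
    have h2 := Real.add_one_le_exp 1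
    nlinarith
  have hpos : (0 : ℝ) < ⌈ε⁻¹⌉₊ := by linarith
  have hlogN : Real.log ⌈ε⁻¹⌉₊ ≤ l + 1 := by
    have := Real.log_le_log hpos hceil'
    rwa [Real.log_mul (by positivity) (Real.exp_pos 1).ne', Real.log_inv, Real.log_exp] at this
  have hlogN0 : 0 ≤ Real.log ⌈ε⁻¹⌉₊ := Real.log_natCast_nonneg _
  have hR : ρ.corr ε 0 / (⌈ε⁻¹⌉₊ : ℝ) ^ 2 ≤ ∫ x, ρ.toFun x ^ 2 := by
    rw [ρ.corr_zero hε, div_div]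
    refine div_le_self hρ ?_
    rw [← mul_pow]
    refine one_le_pow₀ ?_
    rwa [inv_le_iff_one_le_mul₀' hε.1] at hceil
  have hpi : 4 / Real.pi ^ 2 ≤ 1 := by
    rw [div_le_one (by positivity)]
    nlinarith [Real.pi_gt_three]
  have hP : 4 / Real.pi ^ 2 * (1 + Real.log ⌈ε⁻¹⌉₊) ≤ l + 2 := by
    have := mul_le_mul_of_nonneg_right hpi (by linarith : 0 ≤ 1 + Real.log ⌈ε⁻¹⌉₊)
    linarith
  rw [coupling_sq ε, abs_of_neg hneg, ← hldef]
  have hsum : 1 + (2 * t + 4 / Real.pi ^ 2 * (1 + Real.log ⌈ε⁻¹⌉₊) +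
      ρ.corr ε 0 / (⌈ε⁻¹⌉₊ : ℝ) ^ 2) ≤ 2 * l := by
    linarith [le_abs_self t]
  -- Here λ² = 1/l cancels the logarithmic growth of the Green function; only 16θ ≤ 1 is needed.
  calc _ ≤ 8 * θ * l⁻¹ * (2 * l) := mul_le_mul_of_nonneg_left hsum (by positivity)
    _ = 16 * θ := by field_simp; ring
    _ ≤ 1 := by linarith

end Solution

end KPZ

end

theorem lemma6p4 :
    ∃ θ₀ : ℝ, 0 < θ₀ ∧
      ∀ (ρ : KPZ.Mollifier) {Ω : Type*} [MeasurableSpace Ω] (P : Measure Ω)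
        [IsProbabilityMeasure P]
        (W : ℝ≥0 → Lp ℝ 2 (volume : Measure KPZ.Torus) → Ω → ℝ),
        KPZ.IsCylindricalWiener W P →
      ∀ θ : ℝ, 0 ≤ θ → θ ≤ θ₀ →
      ∀ h : ℝ → ℝ≥0 → KPZ.Torus → Ω → ℝ,
        (∀ ε ∈ Set.Ioo (0 : ℝ) 1, KPZ.IsSolution ρ W P ε θ (h ε)) →
      -- the renormalization constant `κ^ε_θ(t) = 𝐄 h(t, x)` is well defined, free of `x`
      ∃ κ : ℝ → ℝ≥0 → ℝ,
        (∀ ε ∈ Set.Ioo (0 : ℝ) 1, ∀ t x,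
          Integrable (h ε t x) P ∧ ∫ ω, h ε t x ω ∂P = κ ε t) ∧
        ∀ t : ℝ≥0,
          (fun ε : ℝ => κ ε t -
              1 / 2 * |Real.log ε| ^ (-(1 / 2) : ℝ) * (θ * t / ε ^ 2) * ∫ x, ρ.toFun x ^ 2)
            =O[nhdsWithin 0 (Set.Ioi 0)] fun ε : ℝ => |Real.log ε| ^ (1 / 2 : ℝ) := by
  -- Any θ₀ ≤ 1/16 would serve in `KPZ.eventually_small`.
  refine ⟨1 / 100, by norm_num, ?_⟩
  intro ρ Ω _ P _ W hW θ hθ hθ' h hsol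
  refine ⟨fun ε t => ∫ ω, h ε t (KPZ.toTorus 0) ω ∂P, fun ε hε t x => ?_, fun t => ?_⟩
  · rw [← KPZ.toTorus_cellRep x]
    exact ⟨((hsol ε hε).integrable hW hε hθ t _).1, (hsol ε hε).integral_eq hW hε hθ t _ _⟩
  · have hK : 0 ≤ (Real.exp 1 - 1) / 2 * Real.log 2 :=
      mul_nonneg (by linarith [Real.add_one_le_exp 1]) (Real.log_nonneg one_le_two)
    refine Asymptotics.IsBigO.of_bound (2 + (Real.exp 1 - 1) / 2 * Real.log 2) ?_
    filter_upwards [KPZ.eventually_small ρ hθ hθ' t, Ioo_mem_nhdsGT one_pos] with ε hsmall hε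
    have hl := KPZ.coupling_pos hε
    have hkey : |KPZ.coupling ε * ∫ ω, h ε t (KPZ.toTorus 0) ω ∂P
        - KPZ.coupling ε ^ 2 * θ * t * ρ.corr ε 0 / 2|
          ≤ 2 + (Real.exp 1 - 1) / 2 * Real.log 2 := by
      -- The Green function estimate requires t > 0; at t = 0 the variance vanishes and the crude
      -- bound already gives 2.
      rcases eq_zero_or_pos t with rfl | ht
      · have := ((hsol ε hε).integrable hW hε hθ 0 0).2
        simp only [NNReal.coe_zero, mul_zero, zero_mul, zero_div, add_zero] at this ⊢
        linarith
      · exact (hsol ε hε).abs_integral_sub_le hW hε hθ ht 0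
          (Nat.ceil_pos.2 (inv_pos.2 hε.1)) hsmall
    rw [ρ.corr_zero hε] at hkey
    -- The error size |log ε|^{1/2} is 1/λ, so the O(1) bound on the mean free energy divided by λ
    -- is the claim.
    have hinv : |Real.log ε| ^ (1 / 2 : ℝ) = (KPZ.coupling ε)⁻¹ := by
      rw [KPZ.coupling, Real.rpow_neg (abs_nonneg _), inv_inv]
    rw [hinv, Real.norm_eq_abs, Real.norm_of_nonneg (inv_nonneg.2 hl.le), ← div_eq_mul_inv,
      le_div_iff₀ hl, ← KPZ.coupling]
    refine le_trans (le_of_eq ?_) hkey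
    nth_rewrite 2 [← abs_of_pos hl]
    rw [← abs_mul]
    congr 1
    ring
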